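/- **Notation.** For a positive integer $m$ let $\zeta_m=e^{2\pi i/m}$, $G_m=\mathrm{Gal}(\mathbb{Q}(\zeta_m)/\mathbb{Q})$, let $\sigma_{s}\in G_m$ (for $(s,m)=1$) be the automorphism raising $m$-th roots of unity to the $s$-th power, let $N_m=\sum_{\tau\in G_m}\tau$, and for $a\in\mathbb{Z}$ put $$\theta_m(a)=\sum_{0<s\le m,\ (s,m)=1}\Bigl\langle-\frac{as}{m}\Bigr\rangle\,\sigma_s^{-1}\in\mathbb{Q}[G_m],$$ where $\langle x\rangle\in[0,1)$ is the fractional part of $x$. For $d\mid m$, $\mathrm{res}:\mathbb{Q}[G_m]\to\mathbb{Q}[G_d]$ is the ring homomorphism given by restriction of automorphisms, and $\mathrm{cor}:\mathbb{Q}[G_d]\to\mathbb{Q}[G_m]$ is the linear map sending $\tau\in G_d$ to the sum of all $\sigma\in G_m$ restricting to $\tau$. Let $S'_m$ be the additive subgroup of $\mathbb{Q}[G_m]$ generated by the elements $$\mathrm{cor}_{\mathbb{Q}(\zeta_m)/\mathbb{Q}(\zeta_d)}\bigl(\mathrm{res}_{\mathbb{Q}(\zeta_n)/\mathbb{Q}(\zeta_d)}(\theta_n(a))\bigr),\qquad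 d=(m,n),$$ for all $a,n\in\mathbb{Z}$ with $n>0$, and let $S_m=S'_m\cap\mathbb{Z}[G_m]$ be the Stickelberger ideal. Let now $m>1$, $m\not\equiv2\pmod 4$, and write $m=q_1\cdots q_t$ with pairwise coprime prime powers $q_i$, in an arbitrary fixed order; let $p_i$ be the prime dividing $q_i$ (so $q_i>2$). *The sets $M_m$ and $M'_m$.* Let $X_m=\{a\in\mathbb{Z}: 0<a<m,\ (a,\tfrac{m}{(a,m)})=1\}$, and let $M_m$ be the set of all $a\in X_m$ such that * for every $i$, if $q_i\nmid a$ then $a\not\equiv-(a,m)\pmod{q_i}$; * if $a\nmid m$ and $k=\max\{i: a\not\equiv(a,m)\pmod{q_i}\}$, then $\bigl\langle\frac{a}{(a,m)q_k}\bigr\rangle<\frac12$; * if $a\mid m$, then the number of $i$ with $q_i\nmid a$ is odd. Put $$M'_m=\Bigl\{a\in M_m:\ \tfrac{m}{q_i}\nmid a\text{ for all }i\Bigr\}\ \cup\ \bigcup_{i=1}^t\Bigl\{\tfrac{mb}{q_i}:\ 1\le b\le\tfrac{\varphi(q_i)}2\Bigr\}.$$ *The elements $\alpha_m(b)$.* For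 $0<b<m$ let $J'_b=\{i: q_i\nmid b\}\neq\emptyset$ and $r_b=\prod_{q_i\mid b}q_i$. * If $|J'_b|>1$, let $u=q_{\min J'_b}$, $v=\frac{m}{ur_b}$, choose $x,y\in\mathbb{Z}$ with $ux+vy=-1$, and put $\alpha_m(b)=\theta_m(b)+\theta_m(bux)+\theta_m(bvy)-N_m$ (this does not depend on the choice of $x,y$). * If $J'_b=\{j\}$ and $b\ne\frac{m}{q_j}$, put $\alpha_m(b)=\theta_m(-b)+\theta_m(b-\frac{m}{q_j})+\theta_m(\frac{m}{q_j})-N_m$. * If $J'_b=\{j\}$ and $b=\frac{m}{q_j}$, put $\alpha_m(b)=2\theta_m\bigl(\frac{m\varphi(q_j)}{2q_j}\bigr)+\theta_m\bigl(\frac{m}{p_j}\bigr)-N_m$. **Theorem.** For every integer $m>1$ with $m\not\equiv2\pmod4$ (and any ordering of the $q_i$), the elements $\alpha_m(a)$, $a\in M'_m$, together with $N_m$, form a $\mathbb{Z}$-basis of the Stickelberger ideal $S_m$. Moreover, every element of this basis is short, i.e. all its coefficients lie in $\{0,1\}$. -/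

import Mathlib

open scoped IntermediateField

noncomputable section

namespace ShortStickelberger

/-- The `m`-th cyclotomic field `ℚ(ζ_m)`, `ζ_m = exp(2πi/m)`, as a subfield of `ℂ`. -/
abbrev Cyc (m : ℕ) : Subfield ℂ :=
  ℚ⟮Complex.exp (2 * Real.pi * Complex.I / m)⟯.toSubfield

instance cyc_isCyclotomic (m : ℕ) [NeZero m] : IsCyclotomicExtension {m} ℚ (Cyc m) := by
  have hζ := Complex.isPrimitiveRoot_exp m (NeZero.ne m)
  let A : Subalgebra ℚ ℂ := Algebra.adjoin ℚ {Complex.exp (2 * Real.pi * Complex.I / m)}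
  have hA : ℚ⟮Complex.exp (2 * Real.pi * Complex.I / m)⟯.toSubalgebra = A :=
    IntermediateField.adjoin_simple_toSubalgebra_of_isAlgebraic
      (hζ.isIntegral (NeZero.pos m)).tower_top.isAlgebraic
  have hmem (x : ℂ) : x ∈ A ↔ x ∈ Cyc m := by rw [← hA]; rfl
  have hcyc : IsCyclotomicExtension {m} ℚ A := hζ.adjoin_isCyclotomicExtension ℚ
  let e : A ≃+* Cyc m :=
    { toFun := fun x => ⟨x, (hmem _).1 x.2⟩
      invFun := fun x => ⟨x, (hmem _).2 x.2⟩
      left_inv := fun _ => rfl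
      right_inv := fun _ => rfl
      map_mul' := fun _ _ => rfl
      map_add' := fun _ _ => rfl }
  exact IsCyclotomicExtension.equiv {m} ℚ A
    (AlgEquiv.ofRingEquiv (f := e) fun r => DFunLike.congr_fun
      (Subsingleton.elim ((e : A →+* Cyc m).comp (algebraMap ℚ A)) (algebraMap ℚ (Cyc m))) r)

instance cyc_numberField (m : ℕ) [NeZero m] : NumberField (Cyc m) :=
  IsCyclotomicExtension.numberField {m} ℚ (Cyc m)

instance cyc_isGalois (m : ℕ) [NeZero m] : IsGalois ℚ (Cyc m) :=
  IsCyclotomicExtension.isGalois {m} ℚ (Cyc m)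

lemma cyc_le {d n : ℕ} [NeZero n] (h : d ∣ n) : Cyc d ≤ Cyc n := by
  obtain ⟨k, rfl⟩ := h
  have hd : (d : ℂ) ≠ 0 := by
    have := NeZero.ne (d * k)
    exact_mod_cast left_ne_zero_of_mul this
  have hk : (k : ℂ) ≠ 0 := by
    have := NeZero.ne (d * k)
    exact_mod_cast right_ne_zero_of_mul this
  suffices hs : ℚ⟮Complex.exp (2 * Real.pi * Complex.I / d)⟯
      ≤ ℚ⟮Complex.exp (2 * Real.pi * Complex.I / (d * k : ℕ))⟯ from hs
  rw [IntermediateField.adjoin_simple_le_iff]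
  have : Complex.exp (2 * Real.pi * Complex.I / d)
      = Complex.exp (2 * Real.pi * Complex.I / (d * k : ℕ)) ^ k := by
    rw [← Complex.exp_nat_mul]
    congr 1
    push_cast
    field_simp
  rw [this]
  exact pow_mem (IntermediateField.mem_adjoin_simple_self ℚ _) k

/-- The Galois group `G_m = Gal(ℚ(ζ_m)/ℚ)`. -/
abbrev G (m : ℕ) : Type := Gal(Cyc m/ℚ)

/-- The rational group ring `ℚ[G_m]`. -/
abbrev QG (m : ℕ) : Type := MonoidAlgebra ℚ (G m)

/-- The automorphism `σ_s` of `ℚ(ζ_m)` raising every `m`-th root of unity to its `s`-th power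
(see `sigma_apply`). -/
def sigma (m : ℕ) [NeZero m] (s : ℕ) (hs : s.Coprime m) : G m :=
  (IsCyclotomicExtension.Rat.galEquivZMod m (Cyc m)).symm (ZMod.unitOfCoprime s hs)

lemma sigma_apply (m : ℕ) [NeZero m] (s : ℕ) (hs : s.Coprime m) (x : Cyc m) (hx : x ^ m = 1) :
    sigma m s hs x = x ^ s := by
  rw [IsCyclotomicExtension.Rat.galEquivZMod_apply_of_pow_eq m (Cyc m) _ hx, sigma,
    MulEquiv.apply_symm_apply, ZMod.coe_unitOfCoprime, ZMod.val_natCast]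
  conv_rhs => rw [← Nat.mod_add_div s m, pow_add, pow_mul, hx, one_pow, mul_one]

/-- `θ_m(a) = ∑_{0 < s ≤ m, (s,m) = 1} ⟨-as/m⟩ σ_s⁻¹`. -/
def theta (m : ℕ) [NeZero m] (a : ℤ) : QG m :=
  ∑ s ∈ Finset.Icc 1 m, if hs : s.Coprime m then
    MonoidAlgebra.single (sigma m s hs)⁻¹ (Int.fract (-((a : ℚ) * s) / m)) else 0

/-- The absolute norm element `N_m = ∑_{τ ∈ G_m} τ`. -/
def normElt (m : ℕ) [NeZero m] : QG m := ∑ τ : G m, MonoidAlgebra.single τ 1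

/-- Restriction of automorphisms `Gal(F/ℚ) → Gal(E/ℚ)`, for subfields `E ≤ F` of a field of
characteristic zero, with `E` normal over `ℚ`. -/
def restrictHom {L : Type} [Field L] [CharZero L] {E F : Subfield L}
    (h : E ≤ F) [Normal ℚ E] : Gal(F/ℚ) →* Gal(E/ℚ) :=
  letI : Algebra E F := (Subfield.inclusion h).toAlgebra
  AlgEquiv.restrictNormalHom E

lemma restrictHom_apply {L : Type} [Field L] [CharZero L] {E F : Subfield L}
    (h : E ≤ F) [Normal ℚ E] (σ : Gal(F/ℚ)) (x : E) :
    (restrictHom h σ x : L) = σ (Subfield.inclusion h x) := by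
  let _ : Algebra E F := (Subfield.inclusion h).toAlgebra
  exact congrArg (fun y : F => (y : L)) (AlgEquiv.restrictNormal_commutes σ E x)

/-- Restriction of automorphisms `G_n → G_d`, for `d ∣ n`. -/
def resHom {d n : ℕ} [NeZero d] [NeZero n] (h : d ∣ n) : G n →* G d :=
  restrictHom (cyc_le h)

lemma resHom_apply {d n : ℕ} [NeZero d] [NeZero n] (h : d ∣ n) (σ : G n) (x : Cyc d) :
    (resHom h σ x : ℂ) = σ (Subfield.inclusion (cyc_le h) x) :=
  restrictHom_apply (cyc_le h) σ x

/-- The restriction map `ℚ[G_n] → ℚ[G_d]`, for `d ∣ n`. -/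
def res {d n : ℕ} [NeZero d] [NeZero n] (h : d ∣ n) : QG n →+* QG d :=
  MonoidAlgebra.mapDomainRingHom ℚ (resHom h)

/-- The corestriction map `ℚ[G_d] → ℚ[G_m]`, for `d ∣ m`: the linear map sending `τ` to the sum of
all `σ` that restrict to `τ` (see `cor_single`). -/
def cor {d m : ℕ} [NeZero d] [NeZero m] (h : d ∣ m) : QG d →ₗ[ℚ] QG m where
  toFun x := ∑ σ : G m, MonoidAlgebra.single σ (x.coeff (resHom h σ))
  map_add' x y := by
    simp [MonoidAlgebra.single_add, Finset.sum_add_distrib]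
  map_smul' c x := by
    simp [Finset.smul_sum, MonoidAlgebra.smul_single]

open Classical in
lemma cor_single {d m : ℕ} [NeZero d] [NeZero m] (h : d ∣ m) (τ : G d) :
    cor h (MonoidAlgebra.single τ 1)
      = ∑ σ : G m with resHom h σ = τ, MonoidAlgebra.single σ (1 : ℚ) := by
  rw [Finset.sum_filter]
  refine Finset.sum_congr rfl fun σ _ => ?_
  rw [MonoidAlgebra.coeff_single, Finsupp.single_apply]
  by_cases hσ : resHom h σ = τ
  · rw [if_pos hσ.symm, if_pos hσ]
  · rw [if_neg (Ne.symm hσ), if_neg hσ, MonoidAlgebra.single_zero]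

instance gcd_neZero (m n : ℕ) [NeZero m] : NeZero (m.gcd n) :=
  ⟨Nat.gcd_ne_zero_left (NeZero.ne m)⟩

/-- `θ_n^{(m)}(a) = cor_{ℚ(ζ_m)/ℚ(ζ_d)} (res_{ℚ(ζ_n)/ℚ(ζ_d)} (θ_n(a)))`, `d = (m,n)`. -/
def thetaUp (m n : ℕ) [NeZero m] [NeZero n] (a : ℤ) : QG m :=
  cor (Nat.gcd_dvd_left m n) (res (Nat.gcd_dvd_right m n) (theta n a))

/-- The group `S'_m`, generated by all `θ_n^{(m)}(a)` with `a, n ∈ ℤ`, `n > 0`. -/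
def Sprime (m : ℕ) [NeZero m] : AddSubgroup (QG m) :=
  AddSubgroup.closure {x | ∃ (n : ℕ) (_ : NeZero n) (a : ℤ), x = thetaUp m n a}

/-- `ℤ[G_m]` as a subgroup of `ℚ[G_m]`. -/
def integralGroupRing (m : ℕ) : AddSubgroup (QG m) :=
  (MonoidAlgebra.mapRingHom (G m) (Int.castRingHom ℚ)).range.toAddSubgroup

/-- The Stickelberger ideal `S_m = S'_m ∩ ℤ[G_m]`. -/
def stickelbergerIdeal (m : ℕ) [NeZero m] : AddSubgroup (QG m) :=
  Sprime m ⊓ integralGroupRing m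

/-- An element of the group ring is short if all its coefficients lie in `{0, 1}`. -/
def IsShort {m : ℕ} (x : QG m) : Prop := ∀ σ : G m, x.coeff σ = 0 ∨ x.coeff σ = 1

/-! In what follows, `m = ∏ i, q i` with pairwise coprime prime powers `q i`, indexed by a finite
linearly ordered type. -/

section sets

variable {ι : Type} (m : ℕ) (q : ι → ℕ)

/-- `X_m`: the integers `0 < a < m` with `(a, m / (a,m)) = 1`. -/
def X : Set ℤ := {a | 0 < a ∧ a < m ∧ Int.gcd a ((m : ℤ) / (Int.gcd a m : ℤ)) = 1}

/-- The set `M_m`. -/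
def M [LinearOrder ι] : Set ℤ :=
  {a | a ∈ X m ∧
    (∀ i, ¬ (q i : ℤ) ∣ a → ¬ a ≡ -(Int.gcd a m : ℤ) [ZMOD q i]) ∧
    (¬ a ∣ m → ∀ k, IsGreatest {i | ¬ a ≡ (Int.gcd a m : ℤ) [ZMOD q i]} k →
      Int.fract ((a : ℚ) / ((Int.gcd a m : ℚ) * q k)) < 1 / 2) ∧
    (a ∣ m → Odd (Set.ncard {i | ¬ (q i : ℤ) ∣ a}))}

/-- The set `M'_m`. -/
def M' [LinearOrder ι] : Set ℤ :=
  {a | a ∈ M m q ∧ ∀ i, ¬ ((m / q i : ℕ) : ℤ) ∣ a} ∪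
    ⋃ i, {a | ∃ b : ℕ, 1 ≤ b ∧ b ≤ (q i).totient / 2 ∧ a = ((m / q i * b : ℕ) : ℤ)}

end sets

section alpha

variable {ι : Type} [Fintype ι] (m : ℕ) (q : ι → ℕ)

/-- `J'_b = {i | q_i ∤ b}`. -/
def J' (b : ℤ) : Finset ι := Finset.univ.filter fun i => ¬ (q i : ℤ) ∣ b

/-- `r_b`, the product of those `q_i` that divide `b`. -/
def rad (b : ℤ) : ℕ := ∏ i with (q i : ℤ) ∣ b, q i

/-- The elements `α_m(b)`, for `0 < b < m`. If `|J'_b| > 1`, then `x = -gcdA u v`, `y = -gcdB u v`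
is a solution of `u x + v y = -1`, and `b u x`, `b v y` modulo `m` do not depend on the choice of
the solution (the first is `≡ 0` modulo `u r_b` and `≡ -b` modulo `v`). In the second case
`j` is the only element of `J'_b`, and `q j` is a power of the prime `p_j = (q j).minFac`. The last
value is not used: `J'_b` is nonempty for `0 < b < m`. -/
def alpha [LinearOrder ι] [NeZero m] (b : ℤ) : QG m :=
  if h : (J' q b).Nonempty then
    let j := (J' q b).min' h
    if 1 < (J' q b).card then
      let u := q j
      let v := m / (u * rad q b)
      let x := -Nat.gcdA u v
      let y := -Nat.gcdB u v
      theta m b + theta m (b * u * x) + theta m (b * v * y) - normElt m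
    else if b = ((m / q j : ℕ) : ℤ) then
      2 • theta m ((m / q j * ((q j).totient / 2) : ℕ) : ℤ)
        + theta m ((m / (q j).minFac : ℕ) : ℤ) - normElt m
    else
      theta m (-b) + theta m (b - ((m / q j : ℕ) : ℤ)) + theta m ((m / q j : ℕ) : ℤ) - normElt m
  else 0

end alpha

end ShortStickelberger

end

noncomputable section

namespace ShortStickelberger

set_option linter.unusedSectionVars false

/-! Identify `G m` with the units modulo `m`, that is, with the product of the unit groups modulo
the `q i`. For `x ≠ 0` the element `θ(x)` is one half of the norm element plus an odd element `psi
x`, whose coefficients are values of the sawtooth function; `psi` is an odd distribution. Shortness: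
each `α(b)` has the form `θ(x) + θ(y) + θ(z) - N` with `x + y + z = 0` and `x ≠ 0` modulo `m`, and
the fractional parts of three such classes add up to `1` or `2` (`frac_add_frac_add_frac`).
Generation: summing over fibres of reduction maps shows that `S'` lies in the group generated by the
`θ(x)` and `N/2` (`galRing_mem_unitSprime`). By the distribution relation all `psi x` come from the
conjugates `g ψ_J` of one element for each set `J` of indices, and these satisfy `N_i ψ_J = (1 -
τ_i) ψ_{J \ i}` and `c ψ_J = -ψ_J` with `c = -1`. Norm relations remove the coordinates `-1` of `g`,
and oddness moves the last coordinate different from `1` into the first half of the residues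
(`of_mul_mem_of_isBasic`). For even `|J|` also `g = 1` must go. This needs an Ennola relation,
`prod_halfNorm_mul_mem`: the product of the half norms times `ψ_J` is a combination of elements of
lower level. The Ennola relation comes from a universal system, whose values span lattices with a
product structure. The Tate cohomology of `c` on these lattices vanishes as long as one factor is
free (`tateTrivial_lattice`). This yields a lattice element `x` on which `c` acts by `(-1)^|J|` and
whose leading coefficient is the product of half norms (`exists_eigenvector`). For even `|J|` the
specialization of `x` is both fixed and negated by `c`, so it is zero, and that is the relation. For
a basic class `b` with `|J| > 1`, `α(b)` expresses `psi b` by elements of lower level. For `|J| = 1`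
the elements `α(mb/q_j)` telescope, up to `θ(m/q_j)`. So `S'` lies in the span of the family
together with `N/2` and the `θ(m/q_j)` (`psi_mem_extSpan`), and integrality of a single coefficient
removes these extra generators (`mem_alphaSpan_of_mem_extSpan`). Independence: a sign change injects
the basic vectors into the others, so `M'` has at most `φ(m)/2` elements. Over `ℂ` the family spans
the trivial character and all odd characters, because `B_{1,χ} ≠ 0` for odd primitive `χ`
(`sum_mul_saw_ne_zero`). These are `φ(m)/2 + 1` independent functions, so the family is independent.
-/

section

/-! ### Group rings of products of groups: norms, projections, idempotents and the universal
lattice. -/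

section GroupRing

variable {Γ : Type} [CommGroup Γ]

/-- The subring `ℤ[Γ]` of `ℚ[Γ]`. -/
def intRing (Γ : Type) [CommGroup Γ] : Subring (MonoidAlgebra ℚ Γ) :=
  (MonoidAlgebra.mapRingHom Γ (Int.castRingHom ℚ)).range

lemma mem_range_mapRingHom_iff {Γ : Type} [Group Γ] {x : MonoidAlgebra ℚ Γ} :
    x ∈ (MonoidAlgebra.mapRingHom Γ (Int.castRingHom ℚ)).range ↔ ∀ g, ∃ n : ℤ, x.coeff g = n := by
  constructor
  · rintro ⟨y, rfl⟩ g
    exact ⟨y.coeff g, by simp⟩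
  · intro h
    choose n hn using h
    rw [← MonoidAlgebra.sum_coeff_single x]
    refine sum_mem fun g _ => ⟨MonoidAlgebra.single g (n g), ?_⟩
    simp [hn]

lemma mem_intRing_iff {x : MonoidAlgebra ℚ Γ} : x ∈ intRing Γ ↔ ∀ g, ∃ n : ℤ, x.coeff g = n :=
  mem_range_mapRingHom_iff

/-- The group element `g`, as an element of `ℚ[Γ]`. -/
def of (g : Γ) : MonoidAlgebra ℚ Γ := MonoidAlgebra.single g 1

lemma of_mul (g h : Γ) : of (g * h) = of g * of h := by
  simp [of, MonoidAlgebra.single_mul_single]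

lemma of_one : of (1 : Γ) = 1 := rfl

lemma coeff_of_mul (g h : Γ) (x : MonoidAlgebra ℚ Γ) :
    (of g * x).coeff h = x.coeff (g⁻¹ * h) := by
  rw [of, MonoidAlgebra.coeff_single_mul_apply, one_mul]

lemma of_mem (g : Γ) : of g ∈ intRing Γ := by
  classical
  refine mem_intRing_iff.2 fun h => ?_
  rw [of, MonoidAlgebra.coeff_single, Finsupp.single_apply]
  split_ifs
  · exact ⟨1, by simp⟩
  · exact ⟨0, by simp⟩

lemma prod_of {κ : Type} (s : Finset κ) (g : κ → Γ) : ∏ k ∈ s, of (g k) = of (∏ k ∈ s, g k) := by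
  classical
  induction s using Finset.induction_on with
  | empty => simp [of_one]
  | insert k s hk ih => rw [Finset.prod_insert hk, Finset.prod_insert hk, of_mul, ih]

end GroupRing

variable {ι : Type} [DecidableEq ι] {E : ι → Type} [∀ i, CommGroup (E i)]
  [∀ i, Fintype (E i)] [∀ i, DecidableEq (E i)]

/-- The group ring of a product of groups. -/
abbrev PiRing (E : ι → Type) [∀ i, CommGroup (E i)] : Type := MonoidAlgebra ℚ (∀ i, E i)

/-- The sum of all elements of the `i`-th factor. -/
def coordNorm (E : ι → Type) [∀ i, CommGroup (E i)] [∀ i, Fintype (E i)] (i : ι) : PiRing E :=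
  ∑ u : E i, of (Pi.mulSingle i u)

lemma coordNorm_mem (i : ι) : coordNorm E i ∈ intRing (∀ i, E i) :=
  sum_mem fun _ _ => of_mem _

lemma of_mul_coordNorm {i : ι} (u : E i) :
    of (Pi.mulSingle i u) * coordNorm E i = coordNorm E i := by
  rw [coordNorm, Finset.mul_sum]
  refine Fintype.sum_equiv (Equiv.mulLeft u) _ _ fun v => ?_
  rw [← of_mul, ← Pi.mulSingle_mul, Equiv.coe_mulLeft]

/-- `x` is fixed by the `i`-th factor. -/
def CoordFixed (i : ι) (x : PiRing E) : Prop := ∀ u : E i, of (Pi.mulSingle i u) * x = x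

lemma CoordFixed.coordNorm_mul {i : ι} {x : PiRing E} (hx : CoordFixed i x) :
    coordNorm E i * x = (Fintype.card (E i) : ℚ) • x := by
  rw [coordNorm, Finset.sum_mul, Finset.sum_congr rfl fun u _ => hx u]
  simp [Nat.cast_smul_eq_nsmul]

lemma CoordFixed.mul {i : ι} {x : PiRing E} (hx : CoordFixed i x) (y : PiRing E) :
    CoordFixed i (y * x) := fun u => by
  rw [mul_left_comm, hx u]

lemma coordFixed_coordNorm (i : ι) : CoordFixed i (coordNorm E i) := of_mul_coordNorm

/-- The projection of `ℚ[∏ E i]` to the span of those elements whose `i`-th coordinate lies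
in `s`. -/
def coordProj (i : ι) (s : Finset (E i)) : PiRing E →ₗ[ℚ] PiRing E where
  toFun x := MonoidAlgebra.ofCoeff (x.coeff.filter fun g => g i ∈ s)
  map_add' x y := by
    simp [Finsupp.filter_add]
  map_smul' c x := by
    simp [Finsupp.filter_smul]

lemma coeff_coordProj (i : ι) (s : Finset (E i)) (x : PiRing E) (g : ∀ i, E i) :
    (coordProj i s x).coeff g = if g i ∈ s then x.coeff g else 0 := by
  simp [coordProj, Finsupp.filter_apply]

lemma coordProj_mem {i : ι} (s : Finset (E i)) {x : PiRing E} (hx : x ∈ intRing (∀ i, E i)) :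
    coordProj i s x ∈ intRing (∀ i, E i) := by
  rw [mem_intRing_iff] at hx ⊢
  intro g
  rw [coeff_coordProj]
  split_ifs
  · exact hx g
  · exact ⟨0, by simp⟩

lemma coordProj_of_mul {i : ι} (s : Finset (E i)) {g : ∀ i, E i} (hg : g i = 1) (x : PiRing E) :
    coordProj i s (of g * x) = of g * coordProj i s x := by
  apply MonoidAlgebra.coeff_injective
  ext h
  simp [coeff_coordProj, coeff_of_mul, hg]

lemma coordProj_coordNorm_mul {i j : ι} (hij : i ≠ j) (s : Finset (E i)) (x : PiRing E) :
    coordProj i s (coordNorm E j * x) = coordNorm E j * coordProj i s x := by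
  rw [coordNorm, Finset.sum_mul, Finset.sum_mul, map_sum]
  refine Finset.sum_congr rfl fun u _ => coordProj_of_mul s ?_ x
  simp [hij]

lemma coeff_coordNorm_mul (i : ι) (x : PiRing E) (g : ∀ i, E i) :
    (coordNorm E i * x).coeff g = ∑ u : E i, x.coeff (Function.update g i u) := by
  rw [coordNorm, Finset.sum_mul, MonoidAlgebra.coeff_sum, Finsupp.finsetSum_apply]
  refine Fintype.sum_equiv ((Equiv.inv (E i)).trans (Equiv.mulRight (g i))) _ _ fun u => ?_
  rw [coeff_of_mul]
  congr 1
  ext j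
  by_cases hj : j = i
  · subst hj; simp
  · simp [hj]

lemma CoordFixed.coeff_eq {i : ι} {x : PiRing E} (hx : CoordFixed i x) {g h : ∀ i, E i}
    (hgh : ∀ j ≠ i, g j = h j) : x.coeff g = x.coeff h := by
  have hg : (of (Pi.mulSingle i (g i * (h i)⁻¹)) * x).coeff g = x.coeff h := by
    rw [coeff_of_mul]
    congr 1
    ext j
    by_cases hj : j = i
    · subst hj; simp
    · simp [hj, hgh j hj]
  rwa [hx] at hg

/-- The coefficients of `x` are constant along the cosets of the factor, so the values at
`i`-coordinate `1` determine it. Since `coordProj` preserves integrality, integral fixed elements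
are norms of integral elements. -/
lemma coordNorm_mul_coordProj {i : ι} {x : PiRing E} (hx : CoordFixed i x) :
    coordNorm E i * coordProj i {1} x = x := by
  apply MonoidAlgebra.coeff_injective
  ext g
  rw [coeff_coordNorm_mul, Finset.sum_eq_single 1]
  · rw [coeff_coordProj, if_pos (by simp)]
    exact hx.coeff_eq fun j hj => by simp [hj]
  · intro u _ hu
    rw [coeff_coordProj, if_neg (by simp [hu])]
  · simp

lemma coordProj_coordNorm_coordProj (i : ι) (x : PiRing E) :
    coordProj i {1} (coordNorm E i * coordProj i {1} x) = coordProj i {1} x := by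
  apply MonoidAlgebra.coeff_injective
  ext g
  rw [coeff_coordProj, coeff_coordProj, coeff_coordNorm_mul]
  by_cases hg : g i = 1
  · rw [if_pos (by simpa using hg), if_pos (by simpa using hg), Finset.sum_eq_single 1]
    · rw [coeff_coordProj, if_pos (by simp), ← hg, Function.update_eq_self]
    · intro u _ hu
      rw [coeff_coordProj, if_neg (by simp [hu])]
    · simp
  · simp [hg]

lemma coordProj_coordProj (i : ι) (x : PiRing E) :
    coordProj i {1} (coordProj i {1} x) = coordProj i {1} x := by
  apply MonoidAlgebra.coeff_injective
  ext g
  simp +contextual [coeff_coordProj]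

/-- The idempotent of the trivial character of the `i`-th factor. -/
def coordIdem (E : ι → Type) [∀ i, CommGroup (E i)] [∀ i, Fintype (E i)] (i : ι) : PiRing E :=
  (Fintype.card (E i) : ℚ)⁻¹ • coordNorm E i

lemma coordFixed_coordIdem (i : ι) : CoordFixed i (coordIdem E i) := fun u => by
  rw [coordIdem, mul_smul_comm, of_mul_coordNorm]

lemma CoordFixed.coordIdem_mul {i : ι} {x : PiRing E} (hx : CoordFixed i x) :
    coordIdem E i * x = x := by
  rw [coordIdem, smul_mul_assoc, hx.coordNorm_mul, smul_smul, inv_mul_cancel₀, one_smul]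
  exact_mod_cast Fintype.card_ne_zero

lemma coordFixed_of_one_sub_coordIdem {i : ι} {x : PiRing E} (hx : (1 - coordIdem E i) * x = 0) :
    CoordFixed i x := by
  have h : x = x * coordIdem E i := by linear_combination hx
  rw [h]
  exact (coordFixed_coordIdem i).mul x

/-- `1 - e + f e`, where `e` is the idempotent of the trivial character of the `i`-th factor and
`f = 1 - τ_i`. -/
def rho (τ : ι → ∀ i, E i) (i : ι) : PiRing E :=
  1 - coordIdem E i + (1 - of (τ i)) * coordIdem E i

/-- Together with `one_sub_coordIdem_mul_rho` this explains the shape of `rho`: against the norm it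
produces the factor `1 - τ_i` of the norm relation, and on the complementary part it acts as `1`. -/
lemma coordNorm_mul_rho (τ : ι → ∀ i, E i) (i : ι) :
    coordNorm E i * rho τ i = (1 - of (τ i)) * coordNorm E i := by
  have h := (coordFixed_coordNorm (E := E) i).coordIdem_mul
  rw [rho]
  linear_combination (-of (τ i)) * h

lemma one_sub_coordIdem_mul_rho (τ : ι → ∀ i, E i) (i : ι) :
    (1 - coordIdem E i) * rho τ i = 1 - coordIdem E i := by
  have h := (coordFixed_coordIdem (E := E) i).coordIdem_mul
  rw [rho]
  linear_combination of (τ i) * h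

lemma one_sub_coordIdem_mul_coordNorm (i : ι) : (1 - coordIdem E i) * coordNorm E i = 0 := by
  have h := (coordFixed_coordNorm (E := E) i).coordIdem_mul
  linear_combination -h

/-- The `ℤ[Γ]`-lattice generated by the products of elements `rho j` or `coordNorm j` for `j ∈ J`
with the elements `coordNorm s` for `s ∈ S`. -/
def lattice (τ : ι → ∀ i, E i) (S J : Finset ι) : Submodule ℤ (PiRing E) :=
  (intRing (∀ i, E i)).toAddSubgroup.toIntSubmodule *
    ((∏ j ∈ J, Submodule.span ℤ {rho τ j, coordNorm E j}) *
      ∏ s ∈ S, Submodule.span ℤ {coordNorm E s})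

variable {τ : ι → ∀ i, E i} {S J : Finset ι}

/-- One factor is peeled off the product of spans; the inductions on `J` run through this
decomposition. -/
lemma mem_lattice_insert {j : ι} (hj : j ∉ J) {x : PiRing E} :
    x ∈ lattice τ S (insert j J) ↔
      ∃ y ∈ lattice τ S J, ∃ z ∈ lattice τ S J, x = rho τ j * y + coordNorm E j * z := by
  have h : lattice τ S (insert j J)
      = Submodule.span ℤ {rho τ j} * lattice τ S J ⊔ Submodule.span ℤ {coordNorm E j} *
        lattice τ S J := by
    rw [← Submodule.sup_mul, ← Submodule.span_union, Set.singleton_union]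
    simp only [lattice, Finset.prod_insert hj]
    ac_rfl
  rw [h, Submodule.mem_sup]
  simp only [Submodule.mem_span_singleton_mul]
  constructor
  · rintro ⟨_, ⟨y, hy, rfl⟩, _, ⟨z, hz, rfl⟩, rfl⟩
    exact ⟨y, hy, z, hz, rfl⟩
  · rintro ⟨y, hy, z, hz, rfl⟩
    exact ⟨_, ⟨y, hy, rfl⟩, _, ⟨z, hz, rfl⟩, rfl⟩

lemma mem_lattice_insert_left {s : ι} (hs : s ∉ S) {x : PiRing E} :
    x ∈ lattice τ (insert s S) J ↔ ∃ y ∈ lattice τ S J, x = coordNorm E s * y := by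
  have h : lattice τ (insert s S) J = Submodule.span ℤ {coordNorm E s} * lattice τ S J := by
    simp only [lattice, Finset.prod_insert hs]
    ac_rfl
  rw [h, Submodule.mem_span_singleton_mul]
  simp only [eq_comm]

lemma mul_mem_lattice {r x : PiRing E} (hr : r ∈ intRing (∀ i, E i)) (hx : x ∈ lattice τ S J) :
    r * x ∈ lattice τ S J := by
  rw [lattice] at hx ⊢
  refine Submodule.mul_induction_on hx (fun a ha b hb => ?_) fun a b ha hb => ?_
  · rw [← mul_assoc r a b]
    exact Submodule.mul_mem_mul (show r * a ∈ intRing (∀ i, E i) from mul_mem hr ha) hb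
  · rw [mul_add]
    exact add_mem ha hb

lemma mem_lattice_empty {x : PiRing E} : x ∈ lattice τ ∅ ∅ ↔ x ∈ intRing (∀ i, E i) := by
  simp only [lattice, Finset.prod_empty, mul_one]
  rfl

lemma mem_lattice_empty_right {x : PiRing E} :
    x ∈ lattice τ S ∅ ↔ ∃ r ∈ intRing (∀ i, E i), x = (∏ s ∈ S, coordNorm E s) * r := by
  induction S using Finset.induction_on generalizing x with
  | empty => simp [mem_lattice_empty]
  | insert s S hs ih =>
    rw [mem_lattice_insert_left hs]
    constructor
    · rintro ⟨y, hy, rfl⟩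
      obtain ⟨r, hr, rfl⟩ := ih.1 hy
      exact ⟨r, hr, by rw [Finset.prod_insert hs, mul_assoc]⟩
    · rintro ⟨r, hr, rfl⟩
      exact ⟨_, ih.2 ⟨r, hr, rfl⟩, by rw [Finset.prod_insert hs, mul_assoc]⟩

lemma lattice_mono_left {s : ι} (hs : s ∉ S) : lattice τ (insert s S) J ≤ lattice τ S J := by
  intro x hx
  obtain ⟨y, hy, rfl⟩ := (mem_lattice_insert_left hs).1 hx
  exact mul_mem_lattice (coordNorm_mem s) hy

end

/-! ### Freeness of the lattice and vanishing of its Tate cohomology. -/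

section

variable {ι : Type} [DecidableEq ι] {E : ι → Type} [∀ i, CommGroup (E i)]
  [∀ i, Fintype (E i)] [∀ i, DecidableEq (E i)] {τ : ι → ∀ i, E i} {S J : Finset ι}

lemma map_coordNorm_mul {Θ : PiRing E →ₗ[ℚ] PiRing E} {i : ι}
    (h : ∀ (u : E i) x, Θ (of (Pi.mulSingle i u) * x) = of (Pi.mulSingle i u) * Θ x)
    (x : PiRing E) : Θ (coordNorm E i * x) = coordNorm E i * Θ x := by
  rw [coordNorm, Finset.sum_mul, Finset.sum_mul, map_sum]
  exact Finset.sum_congr rfl fun u _ => h u x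

lemma CoordFixed.eq_zero {i : ι} {x : PiRing E} (hx : CoordFixed i x)
    (h : coordProj i {1} x = 0) : x = 0 := by
  rw [← coordNorm_mul_coordProj hx, h, mul_zero]

/-- The lattice attached to `J` is a free module over the group ring of the remaining factors. -/
lemma exists_lattice_equiv (τ : ι → ∀ i, E i) (J : Finset ι) :
    ∃ Θ : PiRing E →ₗ[ℚ] PiRing E, Function.Injective Θ ∧
      (∀ g : ∀ i, E i, (∀ j ∈ J, g j = 1) → ∀ x, Θ (of g * x) = of g * Θ x) ∧
      ∀ x, x ∈ lattice τ ∅ J ↔ ∃ r ∈ intRing (∀ i, E i), x = Θ r := by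
  induction J using Finset.induction_on with
  | empty =>
    refine ⟨LinearMap.id, Function.injective_id, fun _ _ _ => rfl, fun x => ?_⟩
    rw [mem_lattice_empty]
    simp
  | insert j J hj ih =>
    obtain ⟨Θ, hinj, hcomm, hmem⟩ := ih
    have hsingle (u : E j) (x : PiRing E) :
        Θ (of (Pi.mulSingle j u) * x) = of (Pi.mulSingle j u) * Θ x :=
      hcomm _ (fun i hi => Pi.mulSingle_eq_of_ne (by rintro rfl; exact hj hi) _) x
    have hN := map_coordNorm_mul hsingle
    set P : PiRing E →ₗ[ℚ] PiRing E := coordProj j {1} with hP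
    have hPP (x : PiRing E) : P (P x) = P x := coordProj_coordProj j x
    have hPNP (x : PiRing E) : P (coordNorm E j * P x) = P x := coordProj_coordNorm_coordProj j x
    -- Group elements with `j`-coordinate `1` are sent to the `coordNorm` part, the others to the
    -- `rho` part. Modulo norms from the factor `j`, which `rho τ j` sends into the `coordNorm`
    -- part, the coordinates different from `1` suffice.
    let Θ' : PiRing E →ₗ[ℚ] PiRing E :=
      LinearMap.mulLeft ℚ (rho τ j) ∘ₗ Θ ∘ₗ (LinearMap.id - P)
        + LinearMap.mulLeft ℚ (coordNorm E j) ∘ₗ Θ ∘ₗ P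
    have hΘ' (x : PiRing E) : Θ' x = rho τ j * Θ (x - P x) + coordNorm E j * Θ (P x) := rfl
    refine ⟨Θ', ?_, ?_, ?_⟩
    · rw [injective_iff_map_eq_zero]
      intro r hr
      rw [hΘ'] at hr
      -- Multiplication by `1 - e_j` kills the norm part and replaces `rho τ j` by `1`, so the two
      -- parts of a kernel element vanish separately.
      have h1 : (1 - coordIdem E j) * Θ (r - P r) = 0 := by
        have := congrArg (fun x => (1 - coordIdem E j) * x) hr
        simp only [mul_add, ← mul_assoc, one_sub_coordIdem_mul_rho,
          one_sub_coordIdem_mul_coordNorm, mul_zero, zero_mul, add_zero] at this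
        exact this
      have h2 : CoordFixed j (r - P r) := fun u => hinj (by
        rw [hsingle]; exact coordFixed_of_one_sub_coordIdem h1 u)
      have h3 : r - P r = 0 := h2.eq_zero (by rw [map_sub]; exact sub_eq_zero.2 (hPP r).symm)
      rw [h3, map_zero, mul_zero, zero_add, ← hN] at hr
      have h4 : coordNorm E j * P r = 0 := hinj (hr.trans (map_zero _).symm)
      have h5 : P r = 0 := by rw [← hPNP, h4, map_zero]
      rw [← sub_add_cancel r (P r), h3, h5, add_zero]
    · intro g hg x
      have hgj : g j = 1 := hg j (Finset.mem_insert_self _ _)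
      have hgJ : ∀ i ∈ J, g i = 1 := fun i hi => hg i (Finset.mem_insert_of_mem hi)
      have h1 : P (of g * x) = of g * P x := coordProj_of_mul _ hgj x
      rw [hΘ', hΘ', h1, ← mul_sub, hcomm g hgJ, hcomm g hgJ]
      ring
    · intro x
      rw [mem_lattice_insert hj]
      constructor
      · rintro ⟨y, hy, z, hz, rfl⟩
        obtain ⟨r, hr, rfl⟩ := (hmem y).1 hy
        have hPr : P r ∈ intRing (∀ i, E i) := coordProj_mem _ hr
        -- The component `N_j P r` of `r` contributes `(1 - τ_j) N_j Θ(P r)`, which is moved over to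
        -- the norm part; the remainder `r'` has no coordinate `1` at `j`.
        obtain ⟨s, hs, hs'⟩ := (hmem _).1 (add_mem hz (mul_mem_lattice (sub_mem (one_mem _)
          (of_mem (τ j))) ((hmem (Θ (P r))).2 ⟨_, hPr, rfl⟩)))
        have hNs : coordNorm E j * P (coordNorm E j * s) = coordNorm E j * s :=
          coordNorm_mul_coordProj ((coordFixed_coordNorm j).mul s |> fun h => by rwa [mul_comm])
        set r' := r - coordNorm E j * P r with hr'
        have hPr' : P r' = 0 := by rw [hr', map_sub, hPNP, sub_self]
        refine ⟨r' + P (coordNorm E j * s), add_mem (sub_mem hr (mul_mem (coordNorm_mem j) hPr))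
          (coordProj_mem _ (mul_mem (coordNorm_mem j) hs)), ?_⟩
        rw [hΘ', map_add P, hPr', hPP, zero_add, add_sub_cancel_right, ← hN (P _), hNs, hN, ← hs',
          hr', map_sub, hN]
        linear_combination Θ (P r) * coordNorm_mul_rho τ j
      · rintro ⟨r, hr, rfl⟩
        have hPr : P r ∈ intRing (∀ i, E i) := coordProj_mem _ hr
        exact ⟨_, (hmem _).2 ⟨_, sub_mem hr hPr, rfl⟩, _, (hmem _).2 ⟨_, hPr, rfl⟩, hΘ' r⟩

lemma mem_lattice_iff {x : PiRing E} :
    x ∈ lattice τ S J ↔ ∃ y ∈ lattice τ ∅ J, x = (∏ s ∈ S, coordNorm E s) * y := by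
  induction S using Finset.induction_on generalizing x with
  | empty => simp
  | insert s S hs ih =>
    rw [mem_lattice_insert_left hs]
    constructor
    · rintro ⟨y, hy, rfl⟩
      obtain ⟨r, hr, rfl⟩ := ih.1 hy
      exact ⟨r, hr, by rw [Finset.prod_insert hs, mul_assoc]⟩
    · rintro ⟨r, hr, rfl⟩
      exact ⟨_, ih.2 ⟨r, hr, rfl⟩, by rw [Finset.prod_insert hs, mul_assoc]⟩

lemma map_prod_coordNorm_mul {Θ : PiRing E →ₗ[ℚ] PiRing E}
    (hΘ : ∀ g : ∀ i, E i, (∀ j ∈ J, g j = 1) → ∀ x, Θ (of g * x) = of g * Θ x)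
    (hS : Disjoint S J) (x : PiRing E) :
    Θ ((∏ s ∈ S, coordNorm E s) * x) = (∏ s ∈ S, coordNorm E s) * Θ x := by
  induction S using Finset.induction_on with
  | empty => simp
  | insert s S hs ih =>
    rw [Finset.disjoint_insert_left] at hS
    rw [Finset.prod_insert hs, mul_assoc, mul_assoc, map_coordNorm_mul, ih hS.2]
    exact fun u x => hΘ _ (fun i hi => Pi.mulSingle_eq_of_ne (by rintro rfl; exact hS.1 hi) _) x

lemma coordProj_prod_coordNorm_mul {i : ι} (hi : i ∉ S) (s : Finset (E i)) (x : PiRing E) :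
    coordProj i s ((∏ s ∈ S, coordNorm E s) * x)
      = (∏ s ∈ S, coordNorm E s) * coordProj i s x := by
  induction S using Finset.induction_on with
  | empty => simp
  | insert j S hj ih =>
    rw [Finset.mem_insert, not_or] at hi
    rw [Finset.prod_insert hj, mul_assoc, mul_assoc, coordProj_coordNorm_mul hi.1, ih hi.2]

/-- The elements of the lattice that are fixed by a free factor are norms. -/
lemma exists_of_coordFixed {i : ι} (hS : Disjoint S J) (hiS : i ∉ S) (hiJ : i ∉ J) {x : PiRing E}
    (hx : x ∈ lattice τ S J) (hfix : CoordFixed i x) : x ∈ lattice τ (insert i S) J := by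
  obtain ⟨Θ, hinj, hcomm, hmem⟩ := exists_lattice_equiv τ J
  obtain ⟨y, hy, rfl⟩ := mem_lattice_iff.1 hx
  obtain ⟨r, hr, rfl⟩ := (hmem _).1 hy
  have hsingle (u : E i) (x : PiRing E) :
      Θ (of (Pi.mulSingle i u) * x) = of (Pi.mulSingle i u) * Θ x :=
    hcomm _ (fun j hj => Pi.mulSingle_eq_of_ne (by rintro rfl; exact hiJ hj) _) x
  rw [← map_prod_coordNorm_mul hcomm hS] at hfix ⊢
  have h1 : CoordFixed i ((∏ s ∈ S, coordNorm E s) * r) := fun u => hinj (by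
    rw [hsingle]; exact hfix u)
  rw [← coordNorm_mul_coordProj h1, coordProj_prod_coordNorm_mul hiS, map_coordNorm_mul hsingle,
    map_prod_coordNorm_mul hcomm hS, mem_lattice_insert_left hiS]
  exact ⟨_, mem_lattice_iff.2 ⟨_, (hmem _).2 ⟨_, coordProj_mem _ hr, rfl⟩, rfl⟩, rfl⟩

variable {c : ∀ i, E i} {H : ∀ i, Finset (E i)}

/-- The Tate cohomology of the group generated by the involution `c` vanishes on `X`. -/
def TateTrivial (c : ∀ i, E i) (X : Submodule ℤ (PiRing E)) : Prop :=
  ∀ ε : ℤ, ε * ε = 1 → ∀ x ∈ X, of c * x = ε * x → ∃ w ∈ X, x = (of c + ε) * w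

lemma intCast_mul_self {ε : ℤ} (hε : ε * ε = 1) : (ε : PiRing E) * ε = 1 := by
  exact_mod_cast congrArg (Int.cast (R := PiRing E)) hε

lemma of_mul_self (hc : c * c = 1) : of c * of c = (1 : PiRing E) := by
  rw [← of_mul, hc, of_one]

lemma intCast_mul_mem {X : Submodule ℤ (PiRing E)} (ε : ℤ) {x : PiRing E} (hx : x ∈ X) :
    (ε : PiRing E) * x ∈ X := by
  rw [← zsmul_eq_mul]
  exact X.smul_mem ε hx

lemma of_mul_coordProj {i : ι} (hH : ∀ u, c i * u ∈ H i ↔ u ∉ H i) (hc : c * c = 1)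
    (x : PiRing E) :
    of c * coordProj i (H i) x = of c * x - coordProj i (H i) (of c * x) := by
  apply MonoidAlgebra.coeff_injective
  ext g
  have hcc : c i * c i = 1 := congrFun hc i
  have hci : (c i)⁻¹ = c i := inv_eq_of_mul_eq_one_left hcc
  have hg := hH (g i)
  by_cases hgi : g i ∈ H i <;>
    simp [coeff_of_mul, coeff_coordProj, hci, hg, hgi]

/-- `H i` represents the orbits of `c i` on the `i`-th factor. Hence `x` is its part over `H i` plus
its part over the complement, and `c` exchanges the two up to the sign `ε`. -/
lemma eq_mul_coordProj {i : ι} (hH : ∀ u, c i * u ∈ H i ↔ u ∉ H i) (hc : c * c = 1) {ε : ℤ}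
    (hε : ε * ε = 1) {x : PiRing E} (hx : of c * x = ε * x) :
    x = (of c + ε) * (ε * coordProj i (H i) x) := by
  have h1 := of_mul_coordProj hH hc x
  have h2 : coordProj i (H i) (ε * x) = ε * coordProj i (H i) x := by
    rw [← zsmul_eq_mul, map_zsmul, zsmul_eq_mul]
  have h3 := intCast_mul_self (E := E) hε
  rw [hx, h2] at h1
  linear_combination (-(ε : PiRing E)) * h1 - x * h3

/-- Without `rho` factors the lattice is a norm multiple of the integral group ring, and projection
to half of the free factor `i` solves the equation. The inductive step is a dévissage of `rho_j w +
N_j v`: the obstruction `(c - ε) w` is fixed by the factor `j`, hence lies in the lattice with `j`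
moved from `J` to `S`, where the assertion is already known. -/
lemma tateTrivial_lattice {i : ι} (hH : ∀ u, c i * u ∈ H i ↔ u ∉ H i) (hc : c * c = 1)
    (hS : Disjoint S J) (hiS : i ∉ S) (hiJ : i ∉ J) : TateTrivial c (lattice τ S J) := by
  induction J using Finset.induction_on generalizing S with
  | empty =>
    intro ε hε x hx hcx
    refine ⟨_, ?_, eq_mul_coordProj hH hc hε hcx⟩
    obtain ⟨r, hr, rfl⟩ := mem_lattice_empty_right.1 hx
    rw [coordProj_prod_coordNorm_mul hiS]
    exact intCast_mul_mem ε (mem_lattice_empty_right.2 ⟨_, coordProj_mem _ hr, rfl⟩)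
  | insert j J hj ih =>
    rw [Finset.disjoint_insert_right] at hS
    rw [Finset.mem_insert, not_or] at hiJ
    intro ε hε x hx hcx
    obtain ⟨w, hw, v, hv, rfl⟩ := (mem_lattice_insert hj).1 hx
    have h0 := ih hS.2 hiS hiJ.2
    have hS' : Disjoint (insert j S) J := by
      rw [Finset.disjoint_insert_left]
      exact ⟨hj, hS.2⟩
    have h1 := ih hS' (by rw [Finset.mem_insert, not_or]; exact ⟨hiJ.1, hiS⟩) hiJ.2
    have h2 := of_mul_self hc
    have h3 := intCast_mul_self (E := E) hε
    have hcw : (of c - (ε : PiRing E)) * w ∈ lattice τ S J := by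
      rw [sub_mul]
      exact sub_mem (mul_mem_lattice (of_mem c) hw) (intCast_mul_mem ε hw)
    have hfix : CoordFixed j ((of c - (ε : PiRing E)) * w) := by
      refine coordFixed_of_one_sub_coordIdem ?_
      linear_combination (1 - coordIdem E j) * hcx
        - (of c - (ε : PiRing E)) * w * one_sub_coordIdem_mul_rho τ j
        - (of c - (ε : PiRing E)) * v * one_sub_coordIdem_mul_coordNorm (E := E) j
    have hmem := exists_of_coordFixed hS.2 hS.1 hj hcw hfix
    -- `(c - ε) w` has eigenvalue `-ε`, so it equals `(c - ε) a` with `a` a norm from `j`;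
    -- correcting `w` by `a` makes it an `ε`-eigenvector.
    obtain ⟨a, ha, ha'⟩ := h1 (-ε) (by linarith) _ hmem (by
      push_cast
      linear_combination w * h2 - w * h3)
    obtain ⟨b, hb, hb'⟩ := h0 ε hε (w - a) (sub_mem hw (lattice_mono_left hS.1 ha)) (by
      push_cast at ha'
      linear_combination ha')
    obtain ⟨y, hy, rfl⟩ := (mem_lattice_insert_left hS.1).1 ha
    have hNv : coordNorm E j * (v + (1 - of (τ j)) * y) ∈ lattice τ (insert j S) J :=
      (mem_lattice_insert_left hS.1).2 ⟨_, add_mem hv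
        (mul_mem_lattice (sub_mem (one_mem _) (of_mem _)) hy), rfl⟩
    obtain ⟨d, hd, hd'⟩ := h1 ε hε _ hNv (by
      push_cast at ha'
      linear_combination hcx - rho τ j * (of c - (ε : PiRing E)) * hb'
        - (of c - (ε : PiRing E)) * y * coordNorm_mul_rho τ j + rho τ j * b * (h3 - h2))
    obtain ⟨z, hz, rfl⟩ := (mem_lattice_insert_left hS.1).1 hd
    refine ⟨rho τ j * b + coordNorm E j * z, (mem_lattice_insert hj).2 ⟨b, hb, z, hz, rfl⟩, ?_⟩
    linear_combination hd' + rho τ j * hb' + y * coordNorm_mul_rho τ j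

end

/-! ### Eigenvectors in the lattice and the Ennola relation. -/

section

variable {ι : Type} [DecidableEq ι] {E : ι → Type} [∀ i, CommGroup (E i)]
  [∀ i, Fintype (E i)] [∀ i, DecidableEq (E i)] {τ : ι → ∀ i, E i} {S J : Finset ι}
  {c : ∀ i, E i} {H : ∀ i, Finset (E i)}

/-- The sum of the elements of a subset of the `i`-th factor. -/
def halfNorm (H : ∀ i, Finset (E i)) (i : ι) : PiRing E := ∑ u ∈ H i, of (Pi.mulSingle i u)

/-- The product of the idempotents `1 - e_j`. -/
def primIdem (E : ι → Type) [∀ i, CommGroup (E i)] [∀ i, Fintype (E i)] (J : Finset ι) :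
    PiRing E := ∏ j ∈ J, (1 - coordIdem E j)

lemma primIdem_insert {j : ι} (hj : j ∉ J) :
    primIdem E (insert j J) = (1 - coordIdem E j) * primIdem E J :=
  Finset.prod_insert hj

/-- The idempotent replaces every `rho τ j` by `1` and kills every `coordNorm E j` with `j ∈ J`, so
only the leading coefficient survives. -/
lemma exists_primIdem_mul {y : PiRing E} (hy : y ∈ lattice τ S J) :
    ∃ r ∈ intRing (∀ i, E i),
      primIdem E J * y = primIdem E J * ((∏ s ∈ S, coordNorm E s) * r) := by
  induction J using Finset.induction_on generalizing y with
  | empty =>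
    obtain ⟨r, hr, rfl⟩ := mem_lattice_empty_right.1 hy
    exact ⟨r, hr, rfl⟩
  | insert j J hj ih =>
    obtain ⟨w, hw, v, -, rfl⟩ := (mem_lattice_insert hj).1 hy
    obtain ⟨r, hr, hr'⟩ := ih hw
    refine ⟨r, hr, ?_⟩
    rw [primIdem_insert hj]
    linear_combination (1 - coordIdem E j) * hr'
      + primIdem E J * w * one_sub_coordIdem_mul_rho τ j
      + primIdem E J * v * one_sub_coordIdem_mul_coordNorm (E := E) j

lemma coordProj_primIdem_mul {i : ι} (hi : i ∉ J) (s : Finset (E i)) (x : PiRing E) :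
    coordProj i s (primIdem E J * x) = primIdem E J * coordProj i s x := by
  induction J using Finset.induction_on with
  | empty => simp [primIdem]
  | insert j J hj ih =>
    rw [Finset.mem_insert, not_or] at hi
    rw [primIdem_insert hj, mul_assoc, mul_assoc, sub_mul, sub_mul, one_mul, one_mul, map_sub,
      coordIdem, smul_mul_assoc, smul_mul_assoc, map_smul, coordProj_coordNorm_mul hi.1, ih hi.2]

/-- An integral version of the statement that the kernel of `primIdem` is generated by norms. One
factor at a time, the projection to coordinate `1` supplies an integral coefficient `P r` such that
`r - N_i P r` is already killed by the smaller idempotent. -/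
lemma exists_of_primIdem_mul_eq_zero {r : PiRing E} (hr : r ∈ intRing (∀ i, E i))
    (hS : Disjoint S J) (h : primIdem E J * ((∏ s ∈ S, coordNorm E s) * r) = 0) :
    ∃ a : ι → PiRing E, (∀ j, a j ∈ intRing (∀ i, E i)) ∧
      (∏ s ∈ S, coordNorm E s) * r
        = ∑ j ∈ J, coordNorm E j * ((∏ s ∈ S, coordNorm E s) * a j) := by
  induction J using Finset.induction_on generalizing r with
  | empty =>
    refine ⟨fun _ => 0, fun _ => zero_mem _, ?_⟩
    simpa [primIdem] using h
  | insert i J hi ih =>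
    rw [Finset.disjoint_insert_right] at hS
    rw [primIdem_insert hi, mul_assoc] at h
    have hfix := coordFixed_of_one_sub_coordIdem h
    set P : PiRing E →ₗ[ℚ] PiRing E := coordProj i {1}
    have hPr : P r ∈ intRing (∀ i, E i) := coordProj_mem _ hr
    have hfix' : CoordFixed i
        (primIdem E J * ((∏ s ∈ S, coordNorm E s) * (r - coordNorm E i * P r))) := by
      intro u
      have h1 := hfix u
      have h2 := of_mul_coordNorm (E := E) u
      linear_combination h1 - primIdem E J * (∏ s ∈ S, coordNorm E s) * P r * h2
    have hzero := hfix'.eq_zero (by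
      rw [coordProj_primIdem_mul hi, coordProj_prod_coordNorm_mul hS.1, map_sub,
        coordProj_coordNorm_coordProj, sub_self, mul_zero, mul_zero])
    obtain ⟨a, ha, ha'⟩ := ih (sub_mem hr (mul_mem (coordNorm_mem i) hPr)) hS.2 hzero
    refine ⟨Function.update a i (P r), fun j => ?_, ?_⟩
    · by_cases hj : j = i
      · subst hj; simpa using hPr
      · simpa [hj] using ha j
    · rw [Finset.sum_insert hi, Function.update_self]
      have : ∑ j ∈ J, coordNorm E j * ((∏ s ∈ S, coordNorm E s) * Function.update a i (P r) j)
          = ∑ j ∈ J, coordNorm E j * ((∏ s ∈ S, coordNorm E s) * a j) :=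
        Finset.sum_congr rfl fun j hj => by
          rw [Function.update_of_ne (by rintro rfl; exact hi hj)]
      rw [this]
      linear_combination ha'

/-- The part of the lattice that comes from proper subsets of `J`. -/
def lowerLattice (τ : ι → ∀ i, E i) (S J : Finset ι) : Submodule ℤ (PiRing E) :=
  ⨆ j ∈ J, lattice τ (insert j S) (J.erase j)

lemma lattice_le_lowerLattice {j : ι} (hj : j ∈ J) :
    lattice τ (insert j S) (J.erase j) ≤ lowerLattice τ S J :=
  le_iSup₂_of_le j hj le_rfl

/-- When the product of spans is expanded, only the term with `rho τ j` for all `j ∈ J` contains no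
norm from `J`. -/
lemma exists_sub_mem_lowerLattice (hS : Disjoint S J) {y : PiRing E} (hy : y ∈ lattice τ S J) :
    ∃ r ∈ intRing (∀ i, E i),
      y - r * ((∏ j ∈ J, rho τ j) * ∏ s ∈ S, coordNorm E s) ∈ lowerLattice τ S J := by
  induction J using Finset.induction_on generalizing y with
  | empty =>
    obtain ⟨r, hr, rfl⟩ := mem_lattice_empty_right.1 hy
    refine ⟨r, hr, ?_⟩
    rw [Finset.prod_empty, one_mul, mul_comm, sub_self]
    exact zero_mem _
  | insert j J hj ih =>
    rw [Finset.disjoint_insert_right] at hS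
    obtain ⟨w, hw, v, hv, rfl⟩ := (mem_lattice_insert hj).1 hy
    obtain ⟨r, hr, hr'⟩ := ih hS.2 hw
    refine ⟨r, hr, ?_⟩
    rw [Finset.prod_insert hj]
    have h1 : coordNorm E j * v ∈ lowerLattice τ S (insert j J) := by
      refine lattice_le_lowerLattice (Finset.mem_insert_self j J) ?_
      rw [Finset.erase_insert hj, mem_lattice_insert_left hS.1]
      exact ⟨v, hv, rfl⟩
    have h2 : ∀ l ∈ lowerLattice τ S J, rho τ j * l ∈ lowerLattice τ S (insert j J) := by
      intro l hl
      have : lowerLattice τ S J ≤ (lowerLattice τ S (insert j J)).comap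
          (LinearMap.mulLeft ℤ (rho τ j)) := by
        refine iSup₂_le fun k hk x hx => ?_
        have hkj : j ≠ k := by rintro rfl; exact hj hk
        refine lattice_le_lowerLattice (Finset.mem_insert_of_mem hk) ?_
        rw [Finset.erase_insert_of_ne hkj, mem_lattice_insert (by simp [hj])]
        exact ⟨x, hx, 0, zero_mem _, by simp⟩
      exact this hl
    have := add_mem (h2 _ hr') h1
    convert this using 1
    ring

section

variable [Fintype ι]

/-- The group acts trivially on the Tate cohomology of the full lattice. For a coordinate in `J`,
write `x = rho_i y + N_i z`. Then `(1 - u) x = rho_i (1 - u) y`, and `(1 - u) y` is an eigenvector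
in a lattice in which `i` is free. Coordinates outside `J` act trivially on `x` itself. -/
lemma exists_of_mul_lattice (hH : ∀ i u, c i * u ∈ H i ↔ u ∉ H i) (hc : c * c = 1)
    {x : PiRing E} {ε : ℤ} (hε : ε * ε = 1) (hx : x ∈ lattice τ Jᶜ J) (hcx : of c * x = ε * x)
    (g : ∀ i, E i) : ∃ w ∈ lattice τ Jᶜ J, (1 - of g) * x = (of c + ε) * w := by
  have hsingle (i : ι) (u : E i) :
      ∃ w ∈ lattice τ Jᶜ J, (1 - of (Pi.mulSingle i u)) * x = (of c + ε) * w := by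
    by_cases hi : i ∈ J
    · have hJ : J = insert i (J.erase i) := (Finset.insert_erase hi).symm
      have hiJ : i ∉ J.erase i := Finset.notMem_erase i J
      have hiS : i ∉ Jᶜ := by simpa using hi
      have hS : Disjoint Jᶜ (J.erase i) :=
        disjoint_compl_left.mono_right (Finset.erase_subset i J)
      generalize Jᶜ = S at *
      generalize J.erase i = J' at *
      subst hJ
      obtain ⟨y, hy, z, hz, rfl⟩ := (mem_lattice_insert hiJ).1 hx
      have hfix : CoordFixed i ((of c - (ε : PiRing E)) * y) := by
        refine coordFixed_of_one_sub_coordIdem ?_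
        linear_combination (1 - coordIdem E i) * hcx
          - (of c - (ε : PiRing E)) * y * one_sub_coordIdem_mul_rho τ i
          - (of c - (ε : PiRing E)) * z * one_sub_coordIdem_mul_coordNorm (E := E) i
      obtain ⟨w, hw, hw'⟩ := tateTrivial_lattice (hH i) hc hS hiS hiJ ε hε
        ((1 - of (Pi.mulSingle i u)) * y)
        (mul_mem_lattice (sub_mem (one_mem _) (of_mem _)) hy)
        (by linear_combination -hfix u)
      refine ⟨rho τ i * w, (mem_lattice_insert hiJ).2 ⟨w, hw, 0, zero_mem _, by simp⟩, ?_⟩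
      linear_combination rho τ i * hw' - z * of_mul_coordNorm (E := E) u
    · have hiS : i ∈ Jᶜ := by simpa using hi
      rw [← Finset.insert_erase hiS, mem_lattice_insert_left (Finset.notMem_erase _ _)] at hx
      obtain ⟨y, -, rfl⟩ := hx
      refine ⟨0, zero_mem _, ?_⟩
      linear_combination - y * of_mul_coordNorm (E := E) u
  rw [← Finset.univ_prod_mulSingle g]
  induction (Finset.univ : Finset ι) using Finset.induction_on with
  | empty => exact ⟨0, zero_mem _, by simp [of_one]⟩
  | insert i s hi ih =>
    obtain ⟨w, hw, hw'⟩ := ih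
    obtain ⟨v, hv, hv'⟩ := hsingle i (g i)
    refine ⟨of (Pi.mulSingle i (g i)) * w + v, add_mem (mul_mem_lattice (of_mem _) hw) hv, ?_⟩
    rw [Finset.prod_insert hi, of_mul]
    linear_combination of (Pi.mulSingle i (g i)) * hw' + hv'

lemma coordNorm_eq_halfNorm (hH : ∀ i u, c i * u ∈ H i ↔ u ∉ H i) (hc : c * c = 1) (i : ι) :
    coordNorm E i = (1 + of (Pi.mulSingle i (c i))) * halfNorm H i := by
  have hci : c i * c i = 1 := congrFun hc i
  have h1 : of (Pi.mulSingle i (c i)) * halfNorm H i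
      = ∑ u ∈ (H i)ᶜ, of (Pi.mulSingle i u) := by
    rw [halfNorm, Finset.mul_sum]
    refine Finset.sum_bij' (fun u _ => c i * u) (fun u _ => c i * u) ?_ ?_ ?_ ?_ ?_
    · intro u hu
      rw [Finset.mem_compl, hH, not_not]
      exact hu
    · intro u hu
      rw [hH]
      simpa using hu
    · intro u _
      rw [← mul_assoc, hci, one_mul]
    · intro u _
      rw [← mul_assoc, hci, one_mul]
    · intro u _
      rw [← of_mul, ← Pi.mulSingle_mul]
  rw [add_mul, one_mul, h1, halfNorm, Finset.sum_add_sum_compl, coordNorm]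

lemma halfNorm_mem (i : ι) : halfNorm H i ∈ intRing (∀ i, E i) :=
  sum_mem fun _ _ => of_mem _

/-- Split `c` into its coordinates. Those in `S` fix the norms. Those in `J` act by `-1`, because
`(1 + c_j) h_j = N_j` is killed by `1 - e_j`. Only the coordinate `i` remains. -/
lemma of_mul_primIdem_mul (hH : ∀ i u, c i * u ∈ H i ↔ u ∉ H i) (hc : c * c = 1) {i : ι}
    (hiS : i ∉ S) (hi : insert i S = Jᶜ) :
    of c * ((∏ s ∈ S, coordNorm E s) * (primIdem E J * ∏ j ∈ J, halfNorm H j))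
      = of (Pi.mulSingle i (c i)) * ((-1) ^ J.card *
        ((∏ s ∈ S, coordNorm E s) * (primIdem E J * ∏ j ∈ J, halfNorm H j))) := by
  have h1 : of c = of (Pi.mulSingle i (c i)) * (∏ s ∈ S, of (Pi.mulSingle s (c s)))
      * ∏ j ∈ J, of (Pi.mulSingle j (c j)) := by
    rw [← Finset.prod_insert hiS (f := fun s => (of (Pi.mulSingle s (c s)) : PiRing E)), hi,
      Finset.prod_compl_mul_prod, prod_of, Finset.univ_prod_mulSingle]
  have h2 : (∏ s ∈ S, of (Pi.mulSingle s (c s))) * ∏ s ∈ S, coordNorm E s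
      = ∏ s ∈ S, coordNorm E s := by
    rw [← Finset.prod_mul_distrib]
    exact Finset.prod_congr rfl fun s _ => of_mul_coordNorm _
  have h3 : (∏ j ∈ J, of (Pi.mulSingle j (c j))) * (primIdem E J * ∏ j ∈ J, halfNorm H j)
      = (-1) ^ J.card * (primIdem E J * ∏ j ∈ J, halfNorm H j) := by
    rw [primIdem, ← Finset.prod_mul_distrib, ← Finset.prod_mul_distrib, ← Finset.prod_const,
      ← Finset.prod_mul_distrib]
    refine Finset.prod_congr rfl fun j _ => ?_
    linear_combination one_sub_coordIdem_mul_coordNorm (E := E) j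
      - (1 - coordIdem E j) * coordNorm_eq_halfNorm hH hc j
  rw [h1]
  linear_combination of (Pi.mulSingle i (c i)) * (∏ j ∈ J, of (Pi.mulSingle j (c j)))
    * (primIdem E J * ∏ j ∈ J, halfNorm H j) * h2
    + of (Pi.mulSingle i (c i)) * (∏ s ∈ S, coordNorm E s) * h3

/-- The lattice contains an element that is an eigenvector of the involution `c` and whose leading
term is the product of the half norms. -/
lemma exists_eigenvector (hH : ∀ i u, c i * u ∈ H i ↔ u ∉ H i) (hc : c * c = 1) (J : Finset ι) :
    ∃ x ∈ lattice τ Jᶜ J, of c * x = (((-1) ^ J.card : ℤ) : PiRing E) * x ∧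
      ∃ s ∈ intRing (∀ i, E i), primIdem E J * x = primIdem E J * ((∏ s ∈ Jᶜ, coordNorm E s) *
        (∏ j ∈ J, halfNorm H j + (of c + (((-1) ^ J.card : ℤ) : PiRing E)) * s)) := by
  induction J using Finset.induction_on with
  | empty =>
    refine ⟨∏ s : ι, coordNorm E s, ?_, ?_, 0, zero_mem _, ?_⟩
    · rw [mem_lattice_empty_right]
      exact ⟨1, one_mem _, by simp⟩
    · rw [← Finset.univ_prod_mulSingle c, ← prod_of, ← Finset.prod_mul_distrib]
      simp [of_mul_coordNorm]
    · simp
  | insert i J hi ih =>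
    obtain ⟨b, hb, hcb, s, hs, hs'⟩ := ih
    have hcard : (-1) ^ (insert i J).card = -((-1) ^ J.card : ℤ) := by
      rw [Finset.card_insert_of_notMem hi, pow_succ]
      ring
    rw [hcard]
    obtain ⟨v, hv, hv'⟩ := exists_of_mul_lattice hH hc (by rw [← mul_pow]; simp) hb hcb (τ i)
    have hJc : Jᶜ = insert i (insert i J)ᶜ := by
      ext j
      by_cases hj : j = i
      · subst hj; simpa using hi
      · simp [hj]
    have hiS : i ∉ (insert i J)ᶜ := by simp
    have hS : Disjoint (insert i J)ᶜ J :=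
      disjoint_compl_left.mono_right (Finset.subset_insert i J)
    have hkey := of_mul_primIdem_mul hH hc hiS hJc.symm
    have hε : ((-1) ^ J.card : ℤ) * (-1) ^ J.card = 1 := by rw [← mul_pow]; simp
    have hpow : ((-1) ^ J.card : PiRing E) = (((-1) ^ J.card : ℤ) : PiRing E) := by push_cast; rfl
    rw [hpow] at hkey
    rw [hJc, Finset.prod_insert hiS] at hs'
    rw [hJc] at hb hv
    rw [Finset.prod_insert hi]
    generalize ((-1) ^ J.card : ℤ) = ε at *
    generalize (insert i J)ᶜ = S at *
    -- In the larger lattice without the norm at `i` the factor `i` is free, so the old eigenvector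
    -- becomes `(c + ε) w`.
    obtain ⟨w, hw, rfl⟩ := tateTrivial_lattice (hH i) hc hS hiS hi ε hε b
      (lattice_mono_left hiS hb) hcb
    obtain ⟨r, hr, hr'⟩ := exists_primIdem_mul hw
    obtain ⟨b', -, hb'⟩ := (mem_lattice_insert_left hiS).1 hb
    obtain ⟨v', hv'', rfl⟩ := (mem_lattice_insert_left hiS).1 hv
    have h2 := of_mul_self (E := E) hc
    have h3 := intCast_mul_self (E := E) hε
    have hN := coordNorm_eq_halfNorm hH hc i
    set π := primIdem E J
    set N := ∏ s ∈ S, coordNorm E s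
    set h := ∏ j ∈ J, halfNorm H j
    -- `r₀` is the deviation of the leading coefficient of `w` from the expected one. Its image `D`
    -- is a `-ε`-eigenvector, hence a multiple of `c - ε`, and this multiple provides the new `s`.
    set r₀ := r - ε * (halfNorm H i * h) - coordNorm E i * s with hr₀
    set D := π * (N * r₀) with hD
    have hr₀' : r₀ ∈ intRing (∀ i, E i) := sub_mem (sub_mem hr (mul_mem (intCast_mem _ _)
      (mul_mem (halfNorm_mem i) (prod_mem fun _ _ => halfNorm_mem _)))) (mul_mem (coordNorm_mem i) hs)
    have hcD : of c * D = ((-ε : ℤ) : PiRing E) * D := by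
      push_cast
      rw [hD, hr₀]
      linear_combination hs' - (of c + (ε : PiRing E)) * hr' - ε * halfNorm H i * hkey
        + π * N * h * hN - (1 + of (Pi.mulSingle i (c i))) * halfNorm H i * π * N * h * h3
    have hD' := eq_mul_coordProj (hH i) hc (by linarith) hcD
    rw [coordProj_primIdem_mul hi, coordProj_prod_coordNorm_mul hiS] at hD'
    push_cast at hD'
    -- Both `rho_i w` and `N_i v'` are mapped by `c + ε` to `(1 - τ_i) b`, where `b = (c + ε) w`; so
    -- their difference has eigenvalue `-ε`.
    refine ⟨ε * (rho τ i * w - coordNorm E i * v'), ?_, ?_, -coordProj i (H i) r₀,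
      neg_mem (coordProj_mem _ hr₀'), ?_⟩
    · refine intCast_mul_mem ε ((mem_lattice_insert hi).2 ⟨w, hw, -v', neg_mem hv'', ?_⟩)
      ring
    · push_cast
      linear_combination ε * rho τ i * hb' + ε * b' * coordNorm_mul_rho τ i + ε * hv'
        - ε * (1 - of (τ i)) * hb'
    · rw [primIdem_insert hi]
      push_cast
      linear_combination ε * π * w * one_sub_coordIdem_mul_rho τ i
        - (ε * π * v' - ε * π * N * s) * one_sub_coordIdem_mul_coordNorm (E := E) i
        + ε * (1 - coordIdem E i) * hr' + ε * (1 - coordIdem E i) * hD'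
        + (1 - coordIdem E i) * π * N * halfNorm H i * h * h3
        - (1 - coordIdem E i) * (of c - (ε : PiRing E)) * π * N * coordProj i (H i) r₀ * h3

section Ennola

variable {ψ : Finset ι → PiRing E}

/-- A system satisfying the norm relations is the image of the universal one. -/
lemma exists_universal (h1 : ∀ K i, i ∉ K → CoordFixed i (ψ K))
    (h2 : ∀ K, ∀ i ∈ K, coordNorm E i * ψ K = (1 - of (τ i)) * ψ (K.erase i)) :
    ∃ ω : PiRing E, ∀ K, ψ K = ((∏ j ∈ K, rho τ j) * ∏ s ∈ Kᶜ, coordNorm E s) * ω := by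
  have key (T : Finset ι) : ∃ φ : Finset ι → PiRing E,
      (∀ K, ψ K = (∏ i ∈ T, if i ∈ K then rho τ i else coordNorm E i) * φ (K \ T)) ∧
      (∀ K i, i ∉ T → i ∉ K → CoordFixed i (φ K)) ∧
      (∀ K i, i ∉ T → i ∈ K → coordNorm E i * φ K = (1 - of (τ i)) * φ (K.erase i)) := by
    induction T using Finset.induction_on with
    | empty => exact ⟨ψ, by simp, fun K i _ => h1 K i, fun K i _ => h2 K i⟩
    | insert i T hi ih =>
      obtain ⟨φ, hφ, hφ1, hφ2⟩ := ih
      -- Two values are glued into one: multiplication by `rho τ i` recovers the value with `i`, by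
      -- the norm relation, and multiplication by `coordNorm E i` recovers the value without `i`.
      refine ⟨fun L => (1 - coordIdem E i) * φ (insert i L)
        + (Fintype.card (E i) : ℚ)⁻¹ • φ (L.erase i), fun K => ?_, fun K j hjT hjK => ?_,
        fun K j hjT hjK => ?_⟩
      · have hL : i ∉ K \ insert i T := by simp
        have hfix := hφ1 _ i hi hL
        have hcard : (Fintype.card (E i) : ℚ)⁻¹ * Fintype.card (E i) = 1 :=
          inv_mul_cancel₀ (by exact_mod_cast Fintype.card_ne_zero)
        simp only
        rw [hφ K, Finset.prod_insert hi, Finset.erase_eq_of_notMem hL, mul_comm (ite _ _ _),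
          mul_assoc]
        congr 1
        by_cases hiK : i ∈ K
        · have hK : K \ T = insert i (K \ insert i T) := by
            ext j
            by_cases hj : j = i
            · subst hj; simp [hiK, hi]
            · simp [hj]
          have h3 := hφ2 (insert i (K \ insert i T)) i hi (Finset.mem_insert_self _ _)
          rw [Finset.erase_insert hL] at h3
          rw [if_pos hiK, hK]
          set x := φ (K \ insert i T)
          set y := φ (insert i (K \ insert i T))
          have h4 : coordIdem E i * y
              = (1 - of (τ i)) * ((Fintype.card (E i) : ℚ)⁻¹ • x) := by
            rw [coordIdem, smul_mul_assoc, h3, mul_smul_comm]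
          have h5 : coordIdem E i * ((Fintype.card (E i) : ℚ)⁻¹ • x)
              = (Fintype.card (E i) : ℚ)⁻¹ • x := by
            rw [mul_smul_comm, hfix.coordIdem_mul]
          have h6 := one_sub_coordIdem_mul_rho τ i
          rw [mul_add, ← mul_assoc, mul_comm (rho τ i), h6, rho]
          linear_combination h4 + of (τ i) * h5
        · have hK : K \ T = K \ insert i T := by
            ext j
            by_cases hj : j = i
            · subst hj; simp [hiK]
            · simp [hj]
          rw [if_neg hiK, hK]
          set x := φ (K \ insert i T)
          rw [mul_add, ← mul_assoc, mul_comm (coordNorm E i), one_sub_coordIdem_mul_coordNorm,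
            zero_mul, zero_add, mul_smul_comm, hfix.coordNorm_mul, smul_smul, hcard, one_smul]
      · rw [Finset.mem_insert, not_or] at hjT
        intro u
        have h3 := hφ1 (insert i K) j hjT.2 (by simp [hjT.1, hjK]) u
        have h4 := hφ1 (K.erase i) j hjT.2 (by simp [hjK]) u
        simp only
        rw [mul_add, mul_left_comm, h3, mul_smul_comm, h4]
      · rw [Finset.mem_insert, not_or] at hjT
        have h3 := hφ2 (insert i K) j hjT.2 (by simp [hjK])
        have h4 := hφ2 (K.erase i) j hjT.2 (by simp [hjK, hjT.1])
        rw [Finset.erase_insert_of_ne (Ne.symm hjT.1)] at h3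
        rw [Finset.erase_right_comm] at h4
        simp only
        rw [mul_add, mul_left_comm, h3, mul_smul_comm, h4, ← mul_smul_comm]
        ring
  obtain ⟨φ, hφ, -, -⟩ := key Finset.univ
  refine ⟨φ ∅, fun K => ?_⟩
  rw [hφ K, Finset.prod_ite, Finset.sdiff_eq_empty_iff_subset.2 (Finset.subset_univ K)]
  simp only [Finset.filter_mem_eq_inter, Finset.univ_inter, ← Finset.compl_filter]

/-- The subgroup generated by the conjugates of the `ψ K` for `K ⊂ J`. -/
def lowerSpan (ψ : Finset ι → PiRing E) (J : Finset ι) : Submodule ℤ (PiRing E) :=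
  Submodule.span ℤ {x | ∃ K ⊂ J, ∃ g, x = of g * ψ K}

lemma mul_mem_span {X : Submodule ℤ (PiRing E)} {x : PiRing E} (h : ∀ g, of g * x ∈ X)
    {r : PiRing E} (hr : r ∈ intRing (∀ i, E i)) : r * x ∈ X := by
  obtain ⟨n, hn⟩ := Classical.skolem.1 (mem_intRing_iff.1 hr)
  rw [← MonoidAlgebra.sum_coeff_single r, Finsupp.sum, Finset.sum_mul]
  refine sum_mem fun g _ => ?_
  have : MonoidAlgebra.single g (r.coeff g) = n g • of g := by
    rw [hn, of, MonoidAlgebra.smul_single]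
    simp
  rw [this, smul_mul_assoc]
  exact X.smul_mem _ (h g)

lemma mul_mem_of_lattice {ω : PiRing E}
    (hω : ∀ K, ψ K = ((∏ j ∈ K, rho τ j) * ∏ s ∈ Kᶜ, coordNorm E s) * ω) (J : Finset ι)
    {X : Submodule ℤ (PiRing E)} (hX : ∀ K ⊆ J, ∀ g, of g * ψ K ∈ X) {x : PiRing E}
    (hx : x ∈ lattice τ Jᶜ J) : x * ω ∈ X := by
  induction J using Finset.strongInduction generalizing x with
  | H J ih =>
    obtain ⟨r, hr, hr'⟩ := exists_sub_mem_lowerLattice disjoint_compl_left hx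
    have h1 : ∀ l ∈ lowerLattice τ Jᶜ J, l * ω ∈ X := by
      intro l hl
      have : lowerLattice τ Jᶜ J ≤ X.comap (LinearMap.mulRight ℤ ω) := by
        refine iSup₂_le fun k hk x hx => ?_
        rw [← Finset.compl_erase] at hx
        exact ih _ (Finset.erase_ssubset hk)
          (fun K hK => hX K (hK.trans (Finset.erase_subset _ _))) hx
      exact this hl
    have := add_mem (h1 _ hr') (mul_mem_span (hX J subset_rfl) hr)
    convert this using 1
    rw [hω J]
    ring

/-- The Ennola relation. The eigenvector attached to `J` specializes to zero, and comparing leading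
coefficients shows that its specialization is the product of the half norms times `ψ J`, up to lower
terms and multiples of `(c + 1) ψ J = 0`. -/
theorem prod_halfNorm_mul_mem (hH : ∀ i u, c i * u ∈ H i ↔ u ∉ H i) (hc : c * c = 1)
    (h1 : ∀ K i, i ∉ K → CoordFixed i (ψ K))
    (h2 : ∀ K, ∀ i ∈ K, coordNorm E i * ψ K = (1 - of (τ i)) * ψ (K.erase i))
    (h3 : ∀ K, of c * ψ K = -ψ K) (hJ : Even J.card) :
    (∏ j ∈ J, halfNorm H j) * ψ J ∈ lowerSpan ψ J := by
  obtain ⟨ω, hω⟩ := exists_universal h1 h2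
  obtain ⟨x, hx, hcx, s, hs, hs'⟩ := exists_eigenvector (τ := τ) hH hc J
  rw [hJ.neg_one_pow] at hcx hs'
  push_cast at hcx hs'
  -- For even `|J|` the lattice element is fixed by `c`, whereas every specialization is negated by
  -- `c`.
  have hxω : x * ω = 0 := by
    have hneg : of c * (x * ω) = -(x * ω) := by
      have : x * ω ∈ LinearMap.ker (LinearMap.mulLeft ℤ (of c) + LinearMap.id) := by
        refine mul_mem_of_lattice hω J (fun K _ g => ?_) hx
        rw [LinearMap.mem_ker, LinearMap.add_apply, LinearMap.mulLeft_apply, LinearMap.id_apply]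
        linear_combination of g * h3 K
      rw [LinearMap.mem_ker, LinearMap.add_apply, LinearMap.mulLeft_apply, LinearMap.id_apply]
        at this
      linear_combination this
    have h4 : (2 : ℚ) • (x * ω) = 0 := by
      rw [two_smul]
      linear_combination hneg - ω * hcx
    exact (smul_eq_zero.1 h4).resolve_left two_ne_zero
  obtain ⟨r, hr, hr'⟩ := exists_sub_mem_lowerLattice disjoint_compl_left hx
  have hlow : ∀ j ∈ J, ∀ l ∈ lattice τ (insert j Jᶜ) (J.erase j), l * ω ∈ lowerSpan ψ J := by
    intro j hj l hl
    rw [← Finset.compl_erase] at hl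
    refine mul_mem_of_lattice hω _ (fun K hK g => ?_) hl
    exact Submodule.subset_span ⟨K, hK.trans_ssubset (Finset.erase_ssubset hj), g, rfl⟩
  have hlow' : ∀ l ∈ lowerLattice τ Jᶜ J, l * ω ∈ lowerSpan ψ J := by
    intro l hl
    have : lowerLattice τ Jᶜ J ≤ (lowerSpan ψ J).comap (LinearMap.mulRight ℤ ω) :=
      iSup₂_le fun k hk x hx => hlow k hk x hx
    exact this hl
  have hπlow : ∀ l ∈ lowerLattice τ Jᶜ J, primIdem E J * l = 0 := by
    intro l hl
    have : lowerLattice τ Jᶜ J ≤ LinearMap.ker (LinearMap.mulLeft ℤ (primIdem E J)) := by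
      refine iSup₂_le fun k hk x hx => ?_
      obtain ⟨y, -, rfl⟩ := (mem_lattice_insert_left (by simpa using hk)).1 hx
      rw [LinearMap.mem_ker, LinearMap.mulLeft_apply, ← Finset.insert_erase hk,
        primIdem_insert (Finset.notMem_erase _ _)]
      linear_combination primIdem E (J.erase k) * y * one_sub_coordIdem_mul_coordNorm (E := E) k
    exact this hl
  have hπρ : primIdem E J * ∏ j ∈ J, rho τ j = primIdem E J := by
    rw [primIdem, ← Finset.prod_mul_distrib]
    exact Finset.prod_congr rfl fun j _ => one_sub_coordIdem_mul_rho τ j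
  set N := ∏ s ∈ Jᶜ, coordNorm E s
  set h := ∏ j ∈ J, halfNorm H j
  have hh : h ∈ intRing (∀ i, E i) := prod_mem fun _ _ => halfNorm_mem _
  -- The leading coefficient of `x` is computed in two ways: by reduction modulo the lower lattice,
  -- and by `exists_eigenvector`. They agree after multiplication by `primIdem`, so their difference
  -- is a sum of norms.
  have hzero : primIdem E J * (N * (r - (h + (of c + 1) * s))) = 0 := by
    linear_combination hs' - hπlow _ hr' - r * N * hπρ
  obtain ⟨a, ha, ha'⟩ := exists_of_primIdem_mul_eq_zero (sub_mem hr (add_mem hh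
    (mul_mem (add_mem (of_mem c) (one_mem _)) hs))) disjoint_compl_left hzero
  have hsum : (∏ j ∈ J, rho τ j) * (N * (r - (h + (of c + 1) * s))) * ω ∈ lowerSpan ψ J := by
    rw [ha', Finset.mul_sum, Finset.sum_mul]
    refine sum_mem fun j hj => ?_
    have h4 (g : ∀ i, E i) : of g * ψ (J.erase j) ∈ lowerSpan ψ J :=
      Submodule.subset_span ⟨J.erase j, Finset.erase_ssubset hj, g, rfl⟩
    have h5 := mul_mem_span h4 (mul_mem (ha j) (sub_mem (one_mem _) (of_mem (τ j))))
    have h6 := h2 J j hj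
    rw [hω J] at h6
    convert h5 using 1
    linear_combination a j * h6
  have h6 := add_mem (hlow' _ hr') hsum
  have h7 := h3 J
  rw [hω J] at h7 ⊢
  rw [← neg_mem_iff]
  convert h6 using 1
  linear_combination (-1) * hxω + s * h7

end Ennola

end

end

/-! ### Generation of all conjugates by the basic ones. -/

section

section Generation

variable {ι : Type} [Fintype ι] [LinearOrder ι] {E : ι → Type} [∀ i, CommGroup (E i)]
  [∀ i, Fintype (E i)] [∀ i, DecidableEq (E i)] {τ : ι → ∀ i, E i}
  {c : ∀ i, E i} {H : ∀ i, Finset (E i)} {ψ : Finset ι → PiRing E}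

/-- No coordinate of `g` in `J` equals that of `c`, and the last nontrivial coordinate lies in `H`;
if there is no such coordinate then `J` has an odd number of elements. -/
def IsBasic (c : ∀ i, E i) (H : ∀ i, Finset (E i)) (J : Finset ι) (g : ∀ i, E i) : Prop :=
  (∀ i ∈ J, g i ≠ c i) ∧
    ((∃ k ∈ J, g k ≠ 1 ∧ g k ∈ H k ∧ ∀ i ∈ J, k < i → g i = 1) ∨
      ((∀ i ∈ J, g i = 1) ∧ Odd J.card))

lemma of_mul_eq_of_mul (h1 : ∀ K i, i ∉ K → CoordFixed i (ψ K)) {J : Finset ι} {g h : ∀ i, E i}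
    (hgh : ∀ i ∈ J, g i = h i) : of g * ψ J = of h * ψ J := by
  have key : of (h⁻¹ * g) * ψ J = ψ J := by
    rw [← Finset.univ_prod_mulSingle (h⁻¹ * g), ← prod_of]
    refine Finset.prod_induction _ (fun x => x * ψ J = ψ J) (fun x y hx hy => ?_) (one_mul _)
      fun i _ => ?_
    · rw [mul_assoc, hy, hx]
    · by_cases hi : i ∈ J
      · simp [hgh i hi, of_one]
      · exact h1 J i hi _
  rw [← mul_inv_cancel_left h g, of_mul, mul_assoc, key]

/-- The norm relation modulo lower levels: letting one coordinate in `J` run through its whole group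
gives zero. -/
lemma sum_update_mem (h2 : ∀ K, ∀ i ∈ K, coordNorm E i * ψ K = (1 - of (τ i)) * ψ (K.erase i))
    {X : Submodule ℤ (PiRing E)} {J : Finset ι} (hlow : ∀ K ⊂ J, ∀ h, of h * ψ K ∈ X) {i : ι}
    (hi : i ∈ J) (g : ∀ i, E i) : ∑ u : E i, of (Function.update g i u) * ψ J ∈ X := by
  have h (u : E i) : of (Function.update g i u) * ψ J
      = of (Pi.mulSingle i u) * (of (Function.update g i 1) * ψ J) := by
    rw [← mul_assoc, ← of_mul]
    congr 2
    ext j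
    by_cases hj : j = i
    · subst hj; simp
    · simp [hj]
  rw [Finset.sum_congr rfl fun u _ => h u, ← Finset.sum_mul, ← coordNorm, mul_left_comm, h2 J i hi,
    sub_mul, one_mul, mul_sub, ← mul_assoc, ← of_mul]
  exact sub_mem (hlow _ (Finset.erase_ssubset hi) _) (hlow _ (Finset.erase_ssubset hi) _)

/-- A coordinate equal to `c i` is replaced, modulo lower levels, by minus the sum over all other
values. The remaining coordinates do not move, so the number of coordinates equal to `c i` drops. -/
lemma mem_of_forall_ne (h2 : ∀ K, ∀ i ∈ K, coordNorm E i * ψ K = (1 - of (τ i)) * ψ (K.erase i))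
    {X : Submodule ℤ (PiRing E)} {J : Finset ι} (hlow : ∀ K ⊂ J, ∀ h, of h * ψ K ∈ X)
    (g : ∀ i, E i)
    (hg : ∀ g' : ∀ i, E i, (∀ i ∈ J, g' i ≠ c i) → (∀ i ∈ J, g i ≠ c i → g' i = g i) →
      of g' * ψ J ∈ X) : of g * ψ J ∈ X := by
  induction hn : (J.filter fun i => g i = c i).card using Nat.strong_induction_on generalizing g with
  | _ n ih =>
    by_cases hc : ∃ i ∈ J, g i = c i
    · obtain ⟨i, hi, hgi⟩ := hc
      have hsum := sum_update_mem h2 hlow hi g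
      rw [← Finset.add_sum_erase _ _ (Finset.mem_univ (c i)), ← hgi, Function.update_eq_self] at hsum
      refine (Submodule.add_mem_iff_left X (sum_mem fun u hu => ?_)).1 hsum
      have hu : u ≠ c i := by rw [← hgi]; exact (Finset.mem_erase.1 hu).1
      refine ih _ ?_ _ (fun g' hg1 hg2 => hg g' hg1 fun j hj hgj => ?_) rfl
      · rw [← hn]
        refine Finset.card_lt_card ⟨fun j hj => ?_, fun h => ?_⟩
        · rw [Finset.mem_filter] at hj ⊢
          refine ⟨hj.1, ?_⟩
          by_cases hji : j = i
          · subst hji; exact hgi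
          · simpa [hji] using hj.2
        · have := h (Finset.mem_filter.2 ⟨hi, hgi⟩)
          rw [Finset.mem_filter, Function.update_self] at this
          exact hu this.2
      · have hji : j ≠ i := by rintro rfl; exact hgj hgi
        rw [hg2 j hj (by simpa [hji] using hgj)]
        simp [hji]
    · push Not at hc
      exact hg g hc fun _ _ _ => rfl

/-- A subgroup that contains the basic conjugates contains all conjugates. -/
theorem of_mul_mem_of_isBasic (hH : ∀ i u, c i * u ∈ H i ↔ u ∉ H i) (hH1 : ∀ i, 1 ∈ H i)
    (hc : c * c = 1) (h1 : ∀ K i, i ∉ K → CoordFixed i (ψ K))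
    (h2 : ∀ K, ∀ i ∈ K, coordNorm E i * ψ K = (1 - of (τ i)) * ψ (K.erase i))
    (h3 : ∀ K, of c * ψ K = -ψ K) {X : Submodule ℤ (PiRing E)}
    (hX : ∀ J g, IsBasic c H J g → (∀ K ⊂ J, ∀ h, of h * ψ K ∈ X) → of g * ψ J ∈ X)
    (J : Finset ι) (g : ∀ i, E i) : of g * ψ J ∈ X := by
  induction J using Finset.strongInduction generalizing g with
  | H J hlow =>
    have hcc (i : ι) : c i * c i = 1 := congrFun hc i
    have hneg (g : ∀ i, E i) (h : of (c * g) * ψ J ∈ X) : of g * ψ J ∈ X := by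
      rw [← neg_mem_iff]
      convert h using 1
      rw [of_mul]
      linear_combination -of g * h3 J
    have hcH (i : ι) : c i ∉ H i := fun h => by
      have := (hH i 1).1 (by rwa [mul_one])
      exact this (hH1 i)
    -- The induction runs downwards on `k`: new nontrivial coordinates may appear beyond `k`, and
    -- those cases are already settled.
    have hlast (k : ι) (hk : k ∈ J) (g : ∀ i, E i) (hg1 : g k ≠ 1) (hgc : g k ≠ c k) :
        of g * ψ J ∈ X := by
      induction k using (wellFounded_gt (α := ι)).induction generalizing g with
      | _ k ih =>
        have haux (g : ∀ i, E i) (hg1 : g k ≠ 1) (hgk : g k ∈ H k) (hgc : ∀ i ∈ J, g i ≠ c i) :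
            of g * ψ J ∈ X := by
          by_cases hex : ∃ i ∈ J, k < i ∧ g i ≠ 1
          · obtain ⟨i, hi, hki, hgi⟩ := hex
            exact ih i hki hi g hgi (hgc i hi)
          · push Not at hex
            exact hX J g ⟨hgc, Or.inl ⟨k, hk, hg1, hgk, hex⟩⟩ hlow
        refine mem_of_forall_ne (c := c) h2 hlow g fun g' hg'c hg' => ?_
        have hk' := hg' k hk hgc
        rw [← hk'] at hg1 hgc
        by_cases hgk : g' k ∈ H k
        · exact haux g' hg1 hgk hg'c
        -- Multiplication by `c` brings the `k`-th coordinate into `H k`. Coordinates that thereby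
        -- become `c i` are expanded once more, which leaves the `k`-th coordinate alone.
        · refine hneg g' (mem_of_forall_ne (c := c) h2 hlow _ fun g'' hg''c hg'' => ?_)
          have hne : (c * g') k ≠ c k := by simpa using hg1
          have hk'' := hg'' k hk hne
          refine haux g'' ?_ ?_ hg''c
          · rw [hk'', Pi.mul_apply]
            intro h
            exact hgc (mul_left_cancel (h.trans (hcc k).symm))
          · rw [hk'', Pi.mul_apply, hH]
            exact hgk
    have hone : of (1 : ∀ i, E i) * ψ J ∈ X := by
      rcases Nat.even_or_odd J.card with hJ | hJ
      -- Expanding the half norms gives the sum of all conjugates with coordinates in the `H i`.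
      -- Every term other than that of `1` has a coordinate different from both `1` and `c i`, since
      -- `c i ∉ H i`.
      · have h4 : (∏ j ∈ J, halfNorm H j) * ψ J ∈ X := by
          refine (Submodule.span_le.2 ?_ : lowerSpan ψ J ≤ X)
            (prod_halfNorm_mul_mem hH hc h1 h2 h3 hJ)
          rintro _ ⟨K, hK, g, rfl⟩
          exact hlow K hK g
        let t (i : ι) : Finset (E i) := if i ∈ J then H i else {1}
        have h5 : ∏ j ∈ J, halfNorm H j = ∑ x ∈ Fintype.piFinset t, of x := by
          have : ∏ j ∈ J, halfNorm H j = ∏ j, ∑ u ∈ t j, of (Pi.mulSingle j u) := by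
            rw [← Finset.prod_subset (Finset.subset_univ J)]
            · refine Finset.prod_congr rfl fun j hj => ?_
              simp only [t, if_pos hj, halfNorm]
            · intro j _ hj
              simp only [t, if_neg hj, Finset.sum_singleton, Pi.mulSingle_one, of_one]
          rw [this, Finset.prod_univ_sum]
          refine Finset.sum_congr rfl fun x _ => ?_
          rw [prod_of, Finset.univ_prod_mulSingle]
        have ht : (1 : ∀ i, E i) ∈ Fintype.piFinset t := by
          rw [Fintype.mem_piFinset]
          intro i
          simp only [t]
          split_ifs
          · exact hH1 i
          · simp
        rw [h5, Finset.sum_mul, ← Finset.add_sum_erase _ _ ht] at h4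
        refine (Submodule.add_mem_iff_left X (sum_mem fun x hx => ?_)).1 h4
        rw [Finset.mem_erase, Fintype.mem_piFinset] at hx
        obtain ⟨i, hi⟩ := Function.ne_iff.1 hx.1
        have hxi := hx.2 i
        by_cases hiJ : i ∈ J
        · simp only [t, if_pos hiJ] at hxi
          exact hlast i hiJ x hi fun h => hcH i (h ▸ hxi)
        · simp only [t, if_neg hiJ, Finset.mem_singleton] at hxi
          exact absurd hxi hi
      · exact hX J 1 ⟨fun i _ h => hcH i (h ▸ hH1 i), Or.inr ⟨fun _ _ => rfl, hJ⟩⟩ hlow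
    refine mem_of_forall_ne (c := c) h2 hlow g fun g' hg'c _ => ?_
    by_cases hex : ∃ k ∈ J, g' k ≠ 1
    · obtain ⟨k, hk, hgk⟩ := hex
      exact hlast k hk g' hgk (hg'c k hk)
    · push Not at hex
      rw [of_mul_eq_of_mul h1 (h := 1) hex]
      exact hone

end Generation

end

/-! ### The sawtooth function, the elements `psi` and the distribution relation. -/

section

section Sawtooth

variable {m : ℕ} [NeZero m]

/-- The fractional part of `x / m`. -/
def frac (x : ZMod m) : ℚ := (x.val : ℚ) / m

lemma fract_eq_frac (k : ℤ) : Int.fract ((k : ℚ) / m) = frac (k : ZMod m) := by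
  rw [Int.fract_div_intCast_eq_div_intCast_mod, frac, ← ZMod.val_intCast, Int.cast_natCast]

lemma frac_zero : frac (0 : ZMod m) = 0 := by simp [frac]

lemma cast_modulus_ne_zero : (m : ℚ) ≠ 0 := by exact_mod_cast NeZero.ne m

lemma frac_neg {x : ZMod m} (hx : x ≠ 0) : frac (-x) = 1 - frac x := by
  rw [frac, frac, ZMod.neg_val, if_neg hx, Nat.cast_sub (ZMod.val_lt x).le]
  field_simp [cast_modulus_ne_zero (m := m)]

/-- Three classes with sum zero, not all zero, have fractional parts with sum `1` or `2`. -/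
lemma frac_add_frac_add_frac {x y z : ZMod m} (h : x + y + z = 0) (hx : x ≠ 0) :
    frac x + frac y + frac z - 1 = 0 ∨ frac x + frac y + frac z - 1 = 1 := by
  have hm := cast_modulus_ne_zero (m := m)
  have h1 : m ∣ x.val + y.val + z.val := by
    rw [← ZMod.natCast_eq_zero_iff]
    simpa using h
  obtain ⟨k, hk⟩ := h1
  have hpos : 0 < x.val := Nat.pos_of_ne_zero fun h0 => hx ((ZMod.val_eq_zero x).1 h0)
  have hlt : x.val + y.val + z.val < m * 3 := by
    have := ZMod.val_lt x
    have := ZMod.val_lt y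
    have := ZMod.val_lt z
    omega
  have hk3 : k < 3 := by
    rw [hk] at hlt
    exact lt_of_mul_lt_mul_left hlt (Nat.zero_le m)
  have hk0 : k ≠ 0 := by rintro rfl; omega
  have hsum : frac x + frac y + frac z = k := by
    rw [frac, frac, frac, ← add_div, ← add_div, div_eq_iff hm]
    exact_mod_cast hk.trans (mul_comm _ _)
  rw [hsum]
  interval_cases k
  · exact absurd rfl hk0
  · left; norm_num
  · right; norm_num

/-- The sawtooth function. -/
def saw (x : ZMod m) : ℚ := if x = 0 then 0 else frac x - 1 / 2

/-- With `k = m / N` and `r` the residue of `z` modulo `k`, the fibre consists of the classes `r + j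
k`, `j < N`, and the sum is an arithmetic progression. Putting the value `0` instead of `-1/2` at
zero raises both sides by `1/2` when `r = 0` and changes nothing otherwise. -/
lemma sum_saw {N : ℕ} (hN : N ∣ m) (z : ZMod m) :
    ∑ w with (N : ZMod m) * w = N * z, saw w = saw (N * z : ZMod m) := by
  obtain ⟨k, hk⟩ := hN
  have hm0 := NeZero.ne m
  have hk0 : 0 < k := Nat.pos_of_ne_zero fun h => hm0 (by rw [hk, h, mul_zero])
  have hN0 : 0 < N := Nat.pos_of_ne_zero fun h => hm0 (by rw [hk, h, zero_mul])
  set r := z.val % k with hr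
  have hrk : r < k := Nat.mod_lt _ hk0
  have hlt {j : ℕ} (hj : j < N) : r + j * k < m := by
    rw [hk]
    calc r + j * k < k + j * k := by omega
      _ = (j + 1) * k := by ring
      _ ≤ N * k := Nat.mul_le_mul_right _ hj
  have hNz : (N : ZMod m) * z = ((N * r : ℕ) : ZMod m) := by
    conv_lhs => rw [← ZMod.natCast_zmod_val z, ← Nat.mod_add_div z.val k]
    have hmz : ((N : ZMod m) * k) = 0 := by
      rw [← Nat.cast_mul, ← hk, ZMod.natCast_self]
    push_cast
    linear_combination ((z.val / k : ℕ) : ZMod m) * hmz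
  have hNr : N * r < m := by rw [hk]; exact Nat.mul_lt_mul_of_pos_left hrk hN0
  have hsum : ∑ w with (N : ZMod m) * w = N * z, saw w
      = ∑ j ∈ Finset.range N, saw ((r + j * k : ℕ) : ZMod m) := by
    symm
    refine Finset.sum_bij (fun j _ => ((r + j * k : ℕ) : ZMod m)) ?_ ?_ ?_ fun _ _ => rfl
    · intro j _
      rw [Finset.mem_filter, hNz]
      refine ⟨Finset.mem_univ _, ?_⟩
      have hmz : ((N : ZMod m) * k) = 0 := by
        rw [← Nat.cast_mul, ← hk, ZMod.natCast_self]
      push_cast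
      linear_combination (j : ZMod m) * hmz
    · intro i hi j hj hij
      rw [Finset.mem_range] at hi hj
      rw [ZMod.natCast_eq_natCast_iff', Nat.mod_eq_of_lt (hlt hi), Nat.mod_eq_of_lt (hlt hj)] at hij
      exact Nat.eq_of_mul_eq_mul_right hk0 (by omega)
    · intro w hw
      rw [Finset.mem_filter] at hw
      have h1 : w.val % k = r := by
        have h2 : ((N * w.val : ℕ) : ZMod m) = ((N * z.val : ℕ) : ZMod m) := by
          push_cast
          rw [ZMod.natCast_zmod_val, ZMod.natCast_zmod_val]
          exact hw.2
        rw [ZMod.natCast_eq_natCast_iff'] at h2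
        have h3 : N * w.val ≡ N * z.val [MOD N * k] := by rw [← hk]; exact h2
        exact Nat.ModEq.mul_left_cancel' hN0.ne' h3
      refine ⟨w.val / k, ?_, ?_⟩
      · rw [Finset.mem_range, Nat.div_lt_iff_lt_mul hk0, ← hk]
        exact ZMod.val_lt w
      · rw [← h1, mul_comm, Nat.mod_add_div, ZMod.natCast_zmod_val]
  have hval {j : ℕ} (hj : j < N) : ((r + j * k : ℕ) : ZMod m).val = r + j * k :=
    ZMod.val_cast_of_lt (hlt hj)
  have hsaw {j : ℕ} (hj : j < N) : saw ((r + j * k : ℕ) : ZMod m)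
      = ((r + j * k : ℕ) : ℚ) / m - 1 / 2 + if r = 0 ∧ j = 0 then 1 / 2 else 0 := by
    have h0 : ((r + j * k : ℕ) : ZMod m) = 0 ↔ r + j * k = 0 := by
      rw [← ZMod.val_eq_zero, hval hj]
    rw [saw, frac, hval hj]
    simp only [h0]
    have : r + j * k = 0 ↔ r = 0 ∧ j = 0 := by
      rw [add_eq_zero, mul_eq_zero]
      simp [hk0.ne']
    by_cases h : r + j * k = 0
    · rw [if_pos h, if_pos (this.1 h), h]
      norm_num
    · rw [if_neg h, if_neg (fun h' => h (this.2 h')), add_zero]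
  have hNr0 : ((N * r : ℕ) : ZMod m) = 0 ↔ N * r = 0 := by
    rw [← ZMod.val_eq_zero, ZMod.val_cast_of_lt hNr]
  rw [hsum, Finset.sum_congr rfl fun j hj => hsaw (Finset.mem_range.1 hj), hNz, saw,
    frac, ZMod.val_cast_of_lt hNr, Finset.sum_add_distrib,
    Finset.sum_sub_distrib, ← Finset.sum_div, ← Nat.cast_sum, Finset.sum_add_distrib,
    ← Finset.sum_mul, Finset.sum_const, Finset.sum_const, Finset.card_range]
  have hgauss : ((∑ j ∈ Finset.range N, j : ℕ) : ℚ) = N * (N - 1) / 2 := by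
    have h := Finset.sum_range_id_mul_two N
    have h' : (((∑ j ∈ Finset.range N, j) * 2 : ℕ) : ℚ) = ((N * (N - 1) : ℕ) : ℚ) := by rw [h]
    rw [Nat.cast_mul, Nat.cast_mul, Nat.cast_sub hN0] at h'
    push_cast at h' ⊢
    linarith
  have hk0' : (k : ℚ) ≠ 0 := by exact_mod_cast hk0.ne'
  have hN0' : (N : ℚ) ≠ 0 := by exact_mod_cast hN0.ne'
  have hmq : (m : ℚ) = N * k := by exact_mod_cast hk
  rw [Nat.cast_add, Nat.cast_mul, hgauss, hmq]
  by_cases hr0 : r = 0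
  · have h1 : ∑ j ∈ Finset.range N, (if r = 0 ∧ j = 0 then (1 / 2 : ℚ) else 0) = 1 / 2 := by
      rw [Finset.sum_eq_single_of_mem 0 (Finset.mem_range.2 hN0)]
      · simp [hr0]
      · intro j _ hj
        simp [hj]
    rw [h1, if_pos (hNr0.2 (by rw [hr0, mul_zero])), hr0]
    simp only [smul_zero, Nat.cast_zero, zero_add, nsmul_eq_mul]
    field_simp
    ring
  · have h1 : ∑ j ∈ Finset.range N, (if r = 0 ∧ j = 0 then (1 / 2 : ℚ) else 0) = 0 :=
      Finset.sum_eq_zero fun j _ => by simp [hr0]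
    rw [h1, if_neg (fun h => (mul_pos hN0 (Nat.pos_of_ne_zero hr0)).ne' (hNr0.1 h))]
    simp only [nsmul_eq_mul, smul_eq_mul]
    push_cast
    field_simp
    ring

end Sawtooth

section UnitRing

variable (m : ℕ) [NeZero m]

/-- The rational group ring of `(ℤ/m)ˣ`. -/
abbrev UnitRing (m : ℕ) : Type := MonoidAlgebra ℚ (ZMod m)ˣ

variable {m}

/-- The element of the group ring with given coefficients. -/
def ofFun (f : (ZMod m)ˣ → ℚ) : UnitRing m :=
  MonoidAlgebra.ofCoeff (Finsupp.equivFunOnFinite.symm f)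

lemma coeff_ofFun (f : (ZMod m)ˣ → ℚ) (u : (ZMod m)ˣ) : (ofFun f).coeff u = f u := rfl

lemma unitRing_ext {x y : UnitRing m} (h : ∀ u, x.coeff u = y.coeff u) : x = y :=
  MonoidAlgebra.coeff_injective (Finsupp.ext h)

/-- The element `θ_m(x)`, in the group ring of `(ℤ/m)ˣ`. -/
def unitTheta (x : ZMod m) : UnitRing m := ofFun fun u => frac (-(x * (u⁻¹ : (ZMod m)ˣ)) : ZMod m)

variable (m) in
/-- The norm element of the group ring of `(ℤ/m)ˣ`. -/
def unitNorm : UnitRing m := ofFun fun _ => 1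

variable (m) in
/-- One half of the norm element. -/
def halfUnitNorm : UnitRing m := (1 / 2 : ℚ) • unitNorm m

lemma two_smul_halfUnitNorm : halfUnitNorm m + halfUnitNorm m = unitNorm m := by
  rw [halfUnitNorm, ← add_smul]
  norm_num

lemma coeff_unitTheta (x : ZMod m) (u : (ZMod m)ˣ) :
    (unitTheta x).coeff u = frac (-(x * (u⁻¹ : (ZMod m)ˣ)) : ZMod m) := rfl

lemma coeff_unitNorm (u : (ZMod m)ˣ) : (unitNorm m).coeff u = 1 := rfl

lemma coeff_halfUnitNorm (u : (ZMod m)ˣ) : (halfUnitNorm m).coeff u = 1 / 2 := by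
  simp [halfUnitNorm, coeff_unitNorm]

/-- The odd part of `θ_m(x)`. -/
def psi (x : ZMod m) : UnitRing m := ofFun fun u => saw (-(x * (u⁻¹ : (ZMod m)ˣ)) : ZMod m)

lemma coeff_psi (x : ZMod m) (u : (ZMod m)ˣ) :
    (psi x).coeff u = saw (-(x * (u⁻¹ : (ZMod m)ˣ)) : ZMod m) := rfl

lemma unitTheta_zero : unitTheta (0 : ZMod m) = 0 :=
  unitRing_ext fun u => by simp [coeff_unitTheta, frac_zero]

lemma psi_zero : psi (0 : ZMod m) = 0 :=
  unitRing_ext fun u => by simp [coeff_psi, saw]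

lemma unitTheta_eq {x : ZMod m} (hx : x ≠ 0) : unitTheta x = psi x + halfUnitNorm m :=
  unitRing_ext fun u => by
    rw [MonoidAlgebra.coeff_add, Finsupp.add_apply, coeff_unitTheta, coeff_psi, coeff_halfUnitNorm,
      saw, if_neg (by simpa using hx)]
    ring

lemma psi_neg (x : ZMod m) : psi (-x) = -psi x := by
  refine unitRing_ext fun u => ?_
  rw [MonoidAlgebra.coeff_neg, Finsupp.neg_apply, coeff_psi, coeff_psi, neg_mul, saw, saw]
  by_cases hx : x * (u⁻¹ : (ZMod m)ˣ) = 0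
  · rw [hx]; simp
  · rw [if_neg (by simpa using hx), if_neg (by simpa using hx), neg_neg, frac_neg hx]
    ring

lemma unitTheta_add_neg {x : ZMod m} (hx : x ≠ 0) :
    unitTheta x + unitTheta (-x) = unitNorm m := by
  rw [unitTheta_eq hx, unitTheta_eq (neg_ne_zero.2 hx), psi_neg, ← two_smul_halfUnitNorm]
  ring

lemma of_mul_psi (u : (ZMod m)ˣ) (x : ZMod m) : of u * psi x = psi (u * x : ZMod m) := by
  refine unitRing_ext fun v => ?_
  rw [coeff_of_mul, coeff_psi, coeff_psi]
  congr 2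
  push_cast [mul_inv_rev, inv_inv]
  ring

/-- The distribution relation. -/
lemma sum_psi {N : ℕ} (hN : N ∣ m) (x : ZMod m) :
    ∑ w with (N : ZMod m) * w = N * x, psi w = psi (N * x : ZMod m) := by
  refine unitRing_ext fun u => ?_
  rw [MonoidAlgebra.coeff_sum, Finsupp.finsetSum_apply, coeff_psi]
  have h := sum_saw hN (-(x * (u⁻¹ : (ZMod m)ˣ)) : ZMod m)
  rw [mul_neg, ← mul_assoc] at h
  rw [← h]
  refine Finset.sum_bij (fun w _ => -(w * (u⁻¹ : (ZMod m)ˣ))) ?_ ?_ ?_ fun _ _ => rfl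
  · intro w hw
    rw [Finset.mem_filter] at hw ⊢
    refine ⟨Finset.mem_univ _, ?_⟩
    rw [mul_neg, ← mul_assoc, hw.2]
  · intro w _ w' _ hww
    exact (Units.mul_left_inj _).1 (neg_injective hww)
  · intro w hw
    rw [Finset.mem_filter] at hw
    refine ⟨-(w * u), ?_, by simp⟩
    rw [Finset.mem_filter]
    refine ⟨Finset.mem_univ _, ?_⟩
    rw [mul_neg, ← mul_assoc, hw.2]
    linear_combination (N : ZMod m) * x * u.inv_mul

end UnitRing

end

/-! ### Chinese remainder coordinates and the norm relations. -/

section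

lemma exists_eq_pow {q : ℕ} (hq : IsPrimePow q) :
    q.minFac.Prime ∧ ∃ e, 0 < e ∧ q = q.minFac ^ e := by
  obtain ⟨p, e, hp, he, rfl⟩ := hq
  have hp' := hp.nat_prime
  rw [hp'.pow_minFac he.ne']
  exact ⟨hp', e, he, rfl⟩

lemma coprime_iff_not_minFac_dvd {q : ℕ} (hq : IsPrimePow q) (n : ℕ) :
    n.Coprime q ↔ ¬ q.minFac ∣ n := by
  obtain ⟨hp, e, he, hqe⟩ := exists_eq_pow hq
  conv_lhs => rw [hqe]
  rw [Nat.coprime_pow_right_iff he, Nat.coprime_comm, hp.coprime_iff_not_dvd]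

/-- It exhibits the non-units modulo a prime power as a fibre of multiplication by `q / p`, so that
sums over units become differences of two distribution relations. -/
lemma not_isUnit_iff {q : ℕ} [NeZero q] (hq : IsPrimePow q) (x : ZMod q) :
    ¬ IsUnit x ↔ ((q / q.minFac : ℕ) : ZMod q) * x = 0 := by
  have hpq : q.minFac ∣ q := q.minFac_dvd
  have h1 : IsUnit x ↔ ¬ q.minFac ∣ x.val := by
    conv_lhs => rw [← ZMod.natCast_zmod_val x]
    rw [ZMod.isUnit_iff_coprime, coprime_iff_not_minFac_dvd hq]
  rw [h1, not_not]
  conv_rhs => rw [← ZMod.natCast_zmod_val x]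
  rw [← Nat.cast_mul, ZMod.natCast_eq_zero_iff]
  have h2 : q / q.minFac * q.minFac = q := Nat.div_mul_cancel hpq
  conv_rhs => lhs; rw [← h2]
  exact (Nat.mul_dvd_mul_iff_left (Nat.div_pos (Nat.minFac_le (NeZero.pos q))
    q.minFac_pos)).symm

section Coordinates

variable {ι : Type} [Fintype ι] [LinearOrder ι] {m : ℕ} [NeZero m] {q : ι → ℕ}
  [∀ i, NeZero (q i)]

/-- The Chinese remainder isomorphism. -/
def crt (hcop : Pairwise fun i j => (q i).Coprime (q j)) (hprod : m = ∏ i, q i) :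
    ZMod m ≃+* ∀ i, ZMod (q i) :=
  (ZMod.ringEquivCongr hprod).trans (ZMod.prodEquivPi q hcop)

variable (hcop : Pairwise fun i j => (q i).Coprime (q j)) (hprod : m = ∏ i, q i)

/-- The isomorphism of unit groups induced by the Chinese remainder isomorphism. -/
def unitsCrt : (ZMod m)ˣ ≃* ∀ i, (ZMod (q i))ˣ :=
  (Units.mapEquiv (crt hcop hprod).toMulEquiv).trans MulEquiv.piUnits

/-- The isomorphism of group rings induced by the Chinese remainder isomorphism. -/
def ringCrt : UnitRing m ≃ₐ[ℚ] PiRing fun i => (ZMod (q i))ˣ :=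
  MonoidAlgebra.domCongr ℚ ℚ (unitsCrt hcop hprod)

lemma ringCrt_of (u : (ZMod m)ˣ) :
    ringCrt hcop hprod (of u) = of (unitsCrt hcop hprod u) :=
  MonoidAlgebra.domCongr_single _ _ _

/-- The odd element attached to a vector of residue classes. -/
def psiVec (a : ∀ i, ZMod (q i)) : UnitRing m := psi ((crt hcop hprod).symm a)

lemma of_mul_psiVec (g : ∀ i, (ZMod (q i))ˣ) (a : ∀ i, ZMod (q i)) :
    of g * ringCrt hcop hprod (psiVec hcop hprod a)
      = ringCrt hcop hprod (psiVec hcop hprod fun i => g i * a i) := by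
  obtain ⟨u, rfl⟩ := (unitsCrt hcop hprod).surjective g
  rw [← ringCrt_of, ← map_mul, psiVec, of_mul_psi, psiVec]
  congr 2
  apply (crt hcop hprod).injective
  rw [map_mul, RingEquiv.apply_symm_apply, RingEquiv.apply_symm_apply]
  rfl

lemma sum_psiVec {N : ℕ} (hN : N ∣ m) (a : ∀ i, ZMod (q i)) :
    ∑ w with (N : ∀ i, ZMod (q i)) * w = N * a, psiVec hcop hprod w
      = psiVec hcop hprod (N * a) := by
  have h := sum_psi hN ((crt hcop hprod).symm a)
  rw [psiVec, map_mul, map_natCast, ← h]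
  refine Finset.sum_equiv (crt hcop hprod).symm.toEquiv (fun w => ?_) fun w _ => rfl
  simp only [Finset.mem_filter, Finset.mem_univ, true_and, RingEquiv.toEquiv_eq_coe,
    EquivLike.coe_coe]
  rw [← (crt hcop hprod).symm.injective.eq_iff, map_mul, map_mul, map_natCast]

include hprod in
lemma dvd_modulus (i : ι) : q i ∣ m := hprod ▸ Finset.dvd_prod_of_mem q (Finset.mem_univ i)

include hcop in
lemma isUnit_natCast_of_dvd {i j : ι} (hij : i ≠ j) {N : ℕ} (hN : N ∣ q i) :
    IsUnit (N : ZMod (q j)) :=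
  (ZMod.isUnit_iff_coprime _ _).2 ((hcop hij).coprime_dvd_left hN)

lemma sum_psiVec_update {i : ι} {N : ℕ} (hN : N ∣ q i) (a : ∀ i, ZMod (q i)) :
    ∑ x with (N : ZMod (q i)) * x = N * a i, psiVec hcop hprod (Function.update a i x)
      = psiVec hcop hprod (N * a) := by
  rw [← sum_psiVec hcop hprod (hN.trans (dvd_modulus hprod i))]
  refine Finset.sum_bij (fun x _ => Function.update a i x) ?_ ?_ ?_ fun _ _ => rfl
  · intro x hx
    rw [Finset.mem_filter] at hx ⊢
    refine ⟨Finset.mem_univ _, ?_⟩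
    ext j
    by_cases hj : j = i
    · subst hj; simpa using hx.2
    · simp [hj]
  · intro x _ y _ hxy
    exact Function.update_injective a i hxy
  · intro w hw
    rw [Finset.mem_filter] at hw
    refine ⟨w i, ?_, ?_⟩
    · rw [Finset.mem_filter]
      exact ⟨Finset.mem_univ _, congrFun hw.2 i⟩
    · ext j
      by_cases hj : j = i
      · subst hj; simp
      · rw [Function.update_of_ne hj]
        exact (isUnit_natCast_of_dvd hcop (Ne.symm hj) hN).mul_left_cancel (congrFun hw.2 j).symm

/-- All residues in the coordinate `i` form the fibre for `N = q i`. The non-units form the fibre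
for `N = q i / p_i`, through the vector whose coordinate `i` is zero. -/
lemma sum_units_psiVec (hq : ∀ i, IsPrimePow (q i)) (i : ι) (a : ∀ i, ZMod (q i)) :
    ∑ u : (ZMod (q i))ˣ, psiVec hcop hprod (Function.update a i u)
      = psiVec hcop hprod ((q i : ∀ i, ZMod (q i)) * a)
        - psiVec hcop hprod (((q i / (q i).minFac : ℕ) : ∀ i, ZMod (q i)) *
          Function.update a i 0) := by
  classical
  have h1 := sum_psiVec_update hcop hprod (dvd_refl (q i)) a
  have h2 := sum_psiVec_update hcop hprod (Nat.div_dvd_of_dvd (q i).minFac_dvd)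
    (Function.update a i 0)
  simp only [Function.update_idem, Function.update_self, mul_zero,
    ← not_isUnit_iff (hq i)] at h2
  simp only [ZMod.natCast_self, zero_mul, Finset.filter_true] at h1
  rw [← h1, ← h2, eq_sub_iff_add_eq, ← Finset.sum_filter_add_sum_filter_not Finset.univ
    (fun x : ZMod (q i) => IsUnit x)]
  congr 1
  refine Finset.sum_bij (fun u _ => (u : ZMod (q i))) ?_ ?_ ?_ fun _ _ => rfl
  · intro u _
    simp
  · intro u _ v _ huv
    exact Units.ext huv
  · intro x hx
    rw [Finset.mem_filter] at hx
    exact ⟨hx.2.unit, Finset.mem_univ _, rfl⟩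

variable (q) in
/-- The vector of residue classes of `m / m_K`, where `m_K` is the product of `q i`, `i ∈ K`. -/
def baseVec (K : Finset ι) : ∀ i, ZMod (q i) := fun _ => ((∏ j ∈ Kᶜ, q j : ℕ) : ZMod _)

lemma baseVec_of_notMem {K : Finset ι} {i : ι} (hi : i ∉ K) : baseVec q K i = 0 := by
  rw [baseVec, ZMod.natCast_eq_zero_iff]
  exact Finset.dvd_prod_of_mem q (by simpa using hi)

include hcop in
lemma isUnit_baseVec {K : Finset ι} {i : ι} (hi : i ∈ K) : IsUnit (baseVec q K i) := by
  rw [baseVec, ZMod.isUnit_iff_coprime]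
  refine Nat.Coprime.prod_left fun j hj => hcop ?_
  rintro rfl
  simp [hi] at hj

lemma natCast_mul_baseVec {K : Finset ι} {i : ι} (hi : i ∈ K) :
    (q i : ∀ i, ZMod (q i)) * baseVec q K = baseVec q (K.erase i) := by
  ext j
  rw [Pi.mul_apply, Pi.natCast_apply, baseVec, baseVec, Finset.compl_erase,
    Finset.prod_insert (by simpa using hi), Nat.cast_mul]

include hcop in
lemma exists_tau : ∃ τ : ι → ∀ i, (ZMod (q i))ˣ, ∀ i,
    ∀ j ≠ i, (τ i j : ZMod (q j)) * (q i).minFac = 1 := by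
  have h (i j : ι) : ∃ u : (ZMod (q j))ˣ, j ≠ i → (u : ZMod (q j)) * (q i).minFac = 1 := by
    by_cases hij : i = j
    · exact ⟨1, fun h => absurd hij.symm h⟩
    · refine ⟨(isUnit_natCast_of_dvd hcop hij (q i).minFac_dvd).unit⁻¹, fun _ => ?_⟩
      exact IsUnit.val_inv_mul _
  choose τ hτ using h
  exact ⟨τ, hτ⟩

/-- The system of odd elements, in the group ring of the product of the unit groups. -/
def psiSys (K : Finset ι) : PiRing fun i => (ZMod (q i))ˣ :=
  ringCrt hcop hprod (psiVec hcop hprod (baseVec q K))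

lemma coordFixed_psiSys {K : Finset ι} {i : ι} (hi : i ∉ K) :
    CoordFixed i (psiSys hcop hprod K) := by
  intro u
  rw [psiSys, of_mul_psiVec]
  congr 2
  ext j
  by_cases hj : j = i
  · subst hj; simp [baseVec_of_notMem hi]
  · simp [hj]

lemma of_neg_one_mul_psiSys (K : Finset ι) :
    of (-1 : ∀ i, (ZMod (q i))ˣ) * psiSys hcop hprod K = -psiSys hcop hprod K := by
  rw [psiSys, of_mul_psiVec, ← map_neg, psiVec, psiVec, ← psi_neg, ← map_neg]
  congr 3
  ext j
  simp

/-- Here `τ_i` acts as the inverse of `p_i` away from `i`, so it turns the factor `q i` into `q i /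
p_i`. Its coordinate at `i` is immaterial because `baseVec q (K.erase i)` vanishes there. -/
lemma coordNorm_mul_psiSys (hq : ∀ i, IsPrimePow (q i)) {τ : ι → ∀ i, (ZMod (q i))ˣ}
    (hτ : ∀ i, ∀ j ≠ i, (τ i j : ZMod (q j)) * (q i).minFac = 1) {K : Finset ι} {i : ι}
    (hi : i ∈ K) : coordNorm (fun i => (ZMod (q i))ˣ) i * psiSys hcop hprod K
      = (1 - of (τ i)) * psiSys hcop hprod (K.erase i) := by
  have h1 : coordNorm (fun i => (ZMod (q i))ˣ) i * psiSys hcop hprod K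
      = ringCrt hcop hprod (∑ u : (ZMod (q i))ˣ,
        psiVec hcop hprod (Function.update (baseVec q K) i u)) := by
    rw [coordNorm, Finset.sum_mul, map_sum]
    refine Fintype.sum_equiv (Equiv.mulRight (isUnit_baseVec hcop hi).unit) _ _ fun u => ?_
    rw [psiSys, of_mul_psiVec]
    congr 2
    ext j
    by_cases hj : j = i
    · subst hj; simp
    · simp [hj]
  rw [h1, sum_units_psiVec hcop hprod hq, map_sub, natCast_mul_baseVec hi, sub_mul, one_mul, psiSys,
    of_mul_psiVec]
  congr 3
  ext j
  rw [Pi.mul_apply, Pi.natCast_apply]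
  by_cases hj : j = i
  · subst hj; simp [baseVec_of_notMem]
  · rw [Function.update_of_ne hj, ← natCast_mul_baseVec hi, Pi.mul_apply, Pi.natCast_apply]
    have h2 : ((q i : ℕ) : ZMod (q j)) = ((q i / (q i).minFac : ℕ) : ZMod (q j)) *
        (q i).minFac := by
      rw [← Nat.cast_mul, Nat.div_mul_cancel (q i).minFac_dvd]
    rw [h2]
    linear_combination (-((q i / (q i).minFac : ℕ) : ZMod (q j)) * baseVec q K j) * hτ i j hj

/-- A vector whose coordinates are zero or units is a conjugate of some `baseVec`. If a coordinate
is nonzero and not a unit, then `a = p b`, and the distribution relation writes `psiVec a` as the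
sum over the `w` with `p w = a`, whose additive orders are `p` times larger. The induction is on the
distance of the order from the size of the group. -/
lemma psiVec_mem_of_forall (hq : ∀ i, IsPrimePow (q i)) {X : Submodule ℤ (UnitRing m)}
    (hX : ∀ (K : Finset ι) (g : ∀ i, (ZMod (q i))ˣ),
      psiVec hcop hprod (fun i => g i * baseVec q K i) ∈ X) (a : ∀ i, ZMod (q i)) :
    psiVec hcop hprod a ∈ X := by
  classical
  have hfin : 0 < Nat.card (∀ i, ZMod (q i)) := Nat.card_pos
  induction hn : Nat.card (∀ i, ZMod (q i)) - addOrderOf a using Nat.strong_induction_on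
    generalizing a with
  | _ n ih =>
    by_cases hex : ∃ i, a i ≠ 0 ∧ ¬ IsUnit (a i)
    · obtain ⟨i, hai, hnu⟩ := hex
      have hp := (exists_eq_pow (hq i)).1
      have hpq := (q i).minFac_dvd
      set p := (q i).minFac with hpdef
      have hb : ∃ b : ∀ i, ZMod (q i), (p : ∀ i, ZMod (q i)) * b = a := by
        have (j : ι) : ∃ x : ZMod (q j), (p : ZMod (q j)) * x = a j := by
          by_cases hij : i = j
          · subst hij
            have h1 : ¬ (a i).val.Coprime (q i) := by
              rwa [← ZMod.isUnit_iff_coprime, ZMod.natCast_zmod_val]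
            have h2 : p ∣ (a i).val := by
              rwa [coprime_iff_not_minFac_dvd (hq i), not_not] at h1
            obtain ⟨k, hk⟩ := h2
            refine ⟨k, ?_⟩
            rw [← Nat.cast_mul, ← hk, ZMod.natCast_zmod_val]
          · obtain ⟨u, hu⟩ := isUnit_natCast_of_dvd hcop hij hpq
            refine ⟨(u⁻¹ : (ZMod (q j))ˣ) * a j, ?_⟩
            rw [← hu, Units.mul_inv_cancel_left]
        choose b hb using this
        exact ⟨b, funext hb⟩
      obtain ⟨b, rfl⟩ := hb
      rw [← sum_psiVec hcop hprod (hpq.trans (dvd_modulus hprod i))]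
      refine sum_mem fun w hw => ?_
      rw [Finset.mem_filter] at hw
      refine ih _ ?_ w rfl
      -- Otherwise the order of `w` would be invertible modulo `q i`, so `w i = 0` and hence `a i =
      -- 0`.
      have hpw : p ∣ addOrderOf w := by
        by_contra h
        have h1 : (addOrderOf w : ZMod (q i)) * w i = 0 := by
          have := congrFun (addOrderOf_nsmul_eq_zero w) i
          rwa [Pi.smul_apply, nsmul_eq_mul] at this
        have h2 : IsUnit (addOrderOf w : ZMod (q i)) := by
          rwa [ZMod.isUnit_iff_coprime, coprime_iff_not_minFac_dvd (hq i)]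
        have h3 : w i = 0 := (h2.mul_right_eq_zero).1 h1
        apply hai
        rw [← hw.2, Pi.mul_apply, h3, mul_zero]
      have hord : addOrderOf ((p : ∀ i, ZMod (q i)) * b) = addOrderOf w / p := by
        rw [← hw.2, ← nsmul_eq_mul, addOrderOf_nsmul, Nat.gcd_eq_right hpw]
      have hw0 : 0 < addOrderOf w := addOrderOf_pos w
      have hlt : addOrderOf w / p < addOrderOf w := Nat.div_lt_self hw0 hp.one_lt
      have hle : addOrderOf w ≤ Nat.card (∀ i, ZMod (q i)) := Nat.le_of_dvd hfin (addOrderOf_dvd_natCard w)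
      rw [← hn, hord]
      omega
    · push Not at hex
      let K : Finset ι := Finset.univ.filter fun i => a i ≠ 0
      have hg (i : ι) : ∃ u : (ZMod (q i))ˣ, a i = u * baseVec q K i := by
        by_cases hi : a i = 0
        · refine ⟨1, ?_⟩
          rw [hi, baseVec_of_notMem (by simp [K, hi]), mul_zero]
        · refine ⟨(hex i hi).unit * (isUnit_baseVec hcop (K := K) (i := i) (by simp [K, hi])).unit⁻¹,
            ?_⟩
          rw [Units.val_mul, mul_assoc, IsUnit.val_inv_mul, mul_one, IsUnit.unit_spec]
      choose g hg using hg
      rw [show a = fun i => g i * baseVec q K i from funext hg]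
      exact hX K g

variable (q) in
/-- The residue classes in the first half. -/
def firstHalf (i : ι) : Finset (ZMod (q i))ˣ :=
  Finset.univ.filter fun u => 2 * (u : ZMod (q i)).val < q i

/-- No unit lies at `q i / 2`: it would divide `q i` and be coprime to it, hence equal `1`, so that
`q i = 2`. -/
lemma neg_mem_firstHalf (hq2 : ∀ i, 2 < q i) (i : ι) (u : (ZMod (q i))ˣ) :
    (-1 : ∀ i, (ZMod (q i))ˣ) i * u ∈ firstHalf q i ↔ u ∉ firstHalf q i := by
  have : Fact (1 < q i) := ⟨by linarith [hq2 i]⟩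
  have hu : (u : ZMod (q i)) ≠ 0 := u.ne_zero
  have hcop : (u : ZMod (q i)).val.Coprime (q i) := ZMod.val_coe_unit_coprime u
  have hlt := ZMod.val_lt (u : ZMod (q i))
  have hne : 2 * (u : ZMod (q i)).val ≠ q i := by
    intro h
    have h1 : (u : ZMod (q i)).val ∣ q i := Dvd.intro_left 2 h
    have h2 : (u : ZMod (q i)).val = 1 := Nat.Coprime.eq_one_of_dvd hcop h1
    have := hq2 i
    omega
  simp only [firstHalf, Finset.mem_filter, Finset.mem_univ, true_and, Pi.neg_apply, Pi.one_apply,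
    neg_mul, one_mul, Units.val_neg]
  rw [ZMod.neg_val, if_neg hu]
  omega

lemma one_mem_firstHalf (hq2 : ∀ i, 2 < q i) (i : ι) : 1 ∈ firstHalf q i := by
  have : Fact (1 < q i) := ⟨by linarith [hq2 i]⟩
  simp only [firstHalf, Finset.mem_filter, Finset.mem_univ, true_and, Units.val_one, ZMod.val_one]
  linarith [hq2 i]

/-- A subgroup that contains the odd elements attached to the basic classes, provided that it
contains those of lower level, contains all of them. -/
theorem psi_mem_of_isBasic (hq : ∀ i, IsPrimePow (q i)) (hq2 : ∀ i, 2 < q i)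
    {X : Submodule ℤ (UnitRing m)}
    (hX : ∀ (J : Finset ι) (g : ∀ i, (ZMod (q i))ˣ), IsBasic (-1) (firstHalf q) J g →
      (∀ K ⊂ J, ∀ h : ∀ i, (ZMod (q i))ˣ, psiVec hcop hprod (fun i => h i * baseVec q K i) ∈ X) →
      psiVec hcop hprod (fun i => g i * baseVec q J i) ∈ X) (x : ZMod m) : psi x ∈ X := by
  obtain ⟨τ, hτ⟩ := exists_tau hcop
  have hmem (K : Finset ι) (g : ∀ i, (ZMod (q i))ˣ) :
      of g * psiSys hcop hprod K ∈ X.map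
        ((ringCrt hcop hprod).toLinearMap.restrictScalars ℤ) ↔
        psiVec hcop hprod (fun i => g i * baseVec q K i) ∈ X := by
    rw [psiSys, of_mul_psiVec, Submodule.mem_map]
    constructor
    · rintro ⟨y, hy, hy'⟩
      rwa [← (ringCrt hcop hprod).injective hy']
    · intro h
      exact ⟨_, h, rfl⟩
  have key := of_mul_mem_of_isBasic (neg_mem_firstHalf hq2) (one_mem_firstHalf hq2) (by simp)
    (fun K i => coordFixed_psiSys hcop hprod)
    (fun K i hi => coordNorm_mul_psiSys hcop hprod hq hτ hi)
    (of_neg_one_mul_psiSys hcop hprod)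
    (X := X.map ((ringCrt hcop hprod).toLinearMap.restrictScalars ℤ))
    (fun J g hJ hlow => (hmem J g).2 (hX J g hJ fun K hK h => (hmem K h).1 (hlow K hK h)))
  have := psiVec_mem_of_forall hcop hprod hq (fun K g => (hmem K g).1 (key K g)) (crt hcop hprod x)
  rwa [psiVec, RingEquiv.symm_apply_apply] at this

end Coordinates

end

/-! ### Sums over fibres of reduction maps. -/

section

section Distribution

lemma frac_eq_saw {m : ℕ} [NeZero m] (x : ZMod m) :
    frac x = saw x + 1 / 2 - if x = 0 then 1 / 2 else 0 := by
  rw [saw]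
  by_cases hx : x = 0
  · rw [if_pos hx, if_pos hx, hx, frac_zero]
    ring
  · rw [if_neg hx, if_neg hx]
    ring

/-- This is `sum_saw` for fractional parts. The corrections at zero on the two sides cancel, and the
constants `1/2` leave an integral multiple of `1/2`. -/
lemma sum_frac {m : ℕ} [NeZero m] {N : ℕ} (hN : N ∣ m) (z : ZMod m) :
    ∑ w with (N : ZMod m) * w = 0, frac (z + w) = frac (N * z : ZMod m)
      + (((Finset.univ.filter fun w : ZMod m => (N : ZMod m) * w = 0).card - 1 : ℤ) : ℚ)
        * (1 / 2) := by
  have h1 : ∑ w with (N : ZMod m) * w = 0, saw (z + w) = saw (N * z : ZMod m) := by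
    rw [← sum_saw hN z]
    refine Finset.sum_equiv (Equiv.addLeft z) (fun w => ?_) fun _ _ => rfl
    simp [mul_add]
  have h2 : ∑ w with (N : ZMod m) * w = 0, (if z + w = 0 then (1 / 2 : ℚ) else 0)
      = if (N : ZMod m) * z = 0 then 1 / 2 else 0 := by
    have (w : ZMod m) : z + w = 0 ↔ w = -z := by rw [add_comm, eq_neg_iff_add_eq_zero]
    simp only [this, Finset.sum_ite_eq', Finset.mem_filter, Finset.mem_univ, true_and, mul_neg,
      neg_eq_zero]
  simp only [frac_eq_saw, Finset.sum_sub_distrib, Finset.sum_add_distrib, h1, h2, Finset.sum_const,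
    nsmul_eq_mul]
  push_cast
  ring

lemma frac_mul {n d k : ℕ} [NeZero n] [NeZero d] (h : n = k * d) (a : ℤ) :
    frac ((k * a : ℤ) : ZMod n) = frac (a : ZMod d) := by
  rw [← fract_eq_frac, ← fract_eq_frac, h]
  have hk : (k : ℚ) ≠ 0 := by
    rintro hk
    have : k = 0 := by exact_mod_cast hk
    exact NeZero.ne n (by rw [h, this, zero_mul])
  push_cast
  rw [mul_div_mul_left _ _ hk]

/-- The functions on `(ℤ/d)ˣ` generated by `w ↦ ⟨-b w / d⟩` and the constant `1 / 2`. -/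
def fracSpan (d : ℕ) [NeZero d] : AddSubgroup ((ZMod d)ˣ → ℚ) :=
  AddSubgroup.closure ({f | ∃ b : ℤ, f = fun w : (ZMod d)ˣ => frac (-(b * w) : ZMod d)} ∪
    {fun _ => 1 / 2})

lemma frac_mem_fracSpan {d : ℕ} [NeZero d] (b : ℤ) :
    (fun w : (ZMod d)ˣ => frac (-(b * w) : ZMod d)) ∈ fracSpan d :=
  AddSubgroup.subset_closure (Or.inl ⟨b, rfl⟩)

lemma half_mem_fracSpan {d : ℕ} [NeZero d] : (fun _ : (ZMod d)ˣ => (1 / 2 : ℚ)) ∈ fracSpan d :=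
  AddSubgroup.subset_closure (Or.inr rfl)

/-- Summation over the fibres of the reduction map. -/
def fiberSum {d n : ℕ} [NeZero n] (h : d ∣ n) : ((ZMod n)ˣ → ℚ) →+ ((ZMod d)ˣ → ℚ) where
  toFun f w := ∑ v with ZMod.unitsMap h v = w, f v
  map_zero' := by ext; simp
  map_add' f g := by ext; simp [Finset.sum_add_distrib]

lemma fiberSum_apply {d n : ℕ} [NeZero n] (h : d ∣ n) (f : (ZMod n)ˣ → ℚ) (w : (ZMod d)ˣ) :
    fiberSum h f w = ∑ v with ZMod.unitsMap h v = w, f v := rfl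

lemma fiberSum_fiberSum {d k n : ℕ} [NeZero n] [NeZero k] (h : d ∣ k) (h' : k ∣ n)
    (f : (ZMod n)ˣ → ℚ) : fiberSum h (fiberSum h' f) = fiberSum (h.trans h') f := by
  ext w
  simp only [fiberSum_apply]
  rw [← Finset.sum_fiberwise_of_maps_to (t := Finset.univ.filter fun v => ZMod.unitsMap h v = w)
    (g := ZMod.unitsMap h')]
  · refine Finset.sum_congr rfl fun v hv => Finset.sum_congr ?_ fun _ _ => rfl
    ext u
    simp only [Finset.mem_filter, Finset.mem_univ, true_and] at hv ⊢
    constructor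
    · rintro rfl
      refine ⟨?_, rfl⟩
      rw [← hv, ← MonoidHom.comp_apply, ZMod.unitsMap_comp]
    · exact fun hu => hu.2
  · intro u hu
    simp only [Finset.mem_filter, Finset.mem_univ, true_and] at hu ⊢
    rw [← hu, ← MonoidHom.comp_apply, ZMod.unitsMap_comp]

lemma castHom_eq_iff {n d p : ℕ} [NeZero n] (hn : n = p * d) (hd : d ∣ n) (x y : ZMod n) :
    ZMod.castHom hd (ZMod d) x = ZMod.castHom hd (ZMod d) y ↔ (p : ZMod n) * (x - y) = 0 := by
  have hp : 0 < p := Nat.pos_of_ne_zero fun h => NeZero.ne n (by rw [hn, h, zero_mul])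
  obtain ⟨a, rfl⟩ := ZMod.intCast_surjective x
  obtain ⟨b, rfl⟩ := ZMod.intCast_surjective y
  rw [map_intCast, map_intCast, ← sub_eq_zero, ← Int.cast_sub, ← Int.cast_sub,
    ZMod.intCast_zmod_eq_zero_iff_dvd, ← Int.cast_natCast (R := ZMod n), ← Int.cast_mul,
    ZMod.intCast_zmod_eq_zero_iff_dvd, hn, Nat.cast_mul,
    mul_dvd_mul_iff_left (by exact_mod_cast hp.ne')]

/-- The sum over all lifts. -/
lemma exists_sum_lifts {n d p : ℕ} [NeZero n] [NeZero d] (hp : p.Prime) (hn : n = p * d)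
    (hd : d ∣ n) (a : ℤ) : ∃ f ∈ fracSpan d, ∀ w : (ZMod d)ˣ,
      ∑ y with ZMod.castHom hd (ZMod d) y = w, frac (-(a * y) : ZMod n) = f w := by
  have hlift (w : (ZMod d)ˣ) : ∃ k : ℤ, ((k : ℤ) : ZMod d) = w := ZMod.intCast_surjective _
  have hsum (w : (ZMod d)ˣ) (k : ℤ) (hk : (k : ZMod d) = w) :
      ∑ y with ZMod.castHom hd (ZMod d) y = w, frac (-(a * y) : ZMod n)
        = ∑ t with (p : ZMod n) * t = 0, frac (-(a * k) + (-(a * t)) : ZMod n) := by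
    rw [← hk, ← map_intCast (ZMod.castHom hd (ZMod d))]
    refine Finset.sum_equiv (Equiv.subRight (k : ZMod n)) (fun y => ?_) fun y _ => ?_
    · rw [Finset.mem_filter, Finset.mem_filter, castHom_eq_iff hn]
      simp
    · congr 1
      rw [Equiv.subRight_apply]
      ring
  by_cases hpa : (p : ℤ) ∣ a
  -- If `p` divides `a`, the fractional part depends only on the class modulo `d`, so all lifts
  -- contribute equally.
  · obtain ⟨b, rfl⟩ := hpa
    set κ := (Finset.univ.filter fun t : ZMod n => (p : ZMod n) * t = 0).card
    refine ⟨κ • fun w : (ZMod d)ˣ => frac (-(b * w) : ZMod d), nsmul_mem (frac_mem_fracSpan b) _,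
      fun w => ?_⟩
    obtain ⟨k, hk⟩ := hlift w
    have h1 : ∀ t ∈ Finset.univ.filter (fun t : ZMod n => (p : ZMod n) * t = 0),
        frac (-(((p * b : ℤ) : ZMod n) * k) + -(((p * b : ℤ) : ZMod n) * t) : ZMod n)
          = frac (-(b * w) : ZMod d) := by
      intro t ht
      rw [Finset.mem_filter] at ht
      have h2 : (-(((p * b : ℤ) : ZMod n) * k) + -(((p * b : ℤ) : ZMod n) * t) : ZMod n)
          = ((p * (-(b * k)) : ℤ) : ZMod n) := by
        push_cast
        linear_combination (-(b : ZMod n)) * ht.2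
      rw [h2, frac_mul hn, ← hk]
      push_cast
      rfl
    rw [hsum w k hk, Finset.sum_congr rfl h1, Finset.sum_const]
    rfl
  -- Otherwise multiplication by `a` permutes the kernel of multiplication by `p`, and `sum_frac`
  -- applies.
  · refine ⟨(fun w : (ZMod d)ˣ => frac (-(a * w) : ZMod d)) + 
        ((Finset.univ.filter fun w : ZMod n => (p : ZMod n) * w = 0).card - 1 : ℤ) •
          fun _ => (1 / 2 : ℚ), add_mem (frac_mem_fracSpan a) (zsmul_mem half_mem_fracSpan _), fun w => ?_⟩
    obtain ⟨k, hk⟩ := hlift w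
    rw [hsum w k hk]
    have hcop : IsCoprime (p : ℤ) a := by
      rw [Int.isCoprime_iff_gcd_eq_one]
      exact (Nat.Coprime.symm (hp.coprime_iff_not_dvd.2 fun h =>
        hpa (Int.natCast_dvd.2 h)).symm)
    obtain ⟨x, y, hxy⟩ := hcop
    have hxy' : (x : ZMod n) * p + y * a = 1 := by exact_mod_cast congrArg (Int.cast (R := ZMod n)) hxy
    have h3 : ∑ t with (p : ZMod n) * t = 0, frac (-(a * k) + (-(a * t)) : ZMod n)
        = ∑ t with (p : ZMod n) * t = 0, frac (-(a * k) + t : ZMod n) := by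
      refine Finset.sum_bij' (fun t _ => -(a * t)) (fun t _ => -(y * t)) ?_ ?_ ?_ ?_ fun _ _ => rfl
      · intro t ht
        rw [Finset.mem_filter] at ht ⊢
        exact ⟨Finset.mem_univ _, by linear_combination (-(a : ZMod n)) * ht.2⟩
      · intro t ht
        rw [Finset.mem_filter] at ht ⊢
        exact ⟨Finset.mem_univ _, by linear_combination (-(y : ZMod n)) * ht.2⟩
      · intro t ht
        rw [Finset.mem_filter] at ht
        linear_combination t * hxy' - x * ht.2
      · intro t ht
        rw [Finset.mem_filter] at ht
        linear_combination t * hxy' - x * ht.2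
    rw [h3, sum_frac ⟨d, hn⟩]
    have h4 : ((p : ZMod n) * -(a * k)) = ((p * (-(a * k)) : ℤ) : ZMod n) := by push_cast; rfl
    rw [h4, frac_mul hn, Pi.add_apply, ← hk]
    push_cast
    simp

/-- The sum over unit lifts is the sum over all lifts minus the non-units. If `p` divides `d`, every
lift of a unit is a unit. -/
lemma fiberSum_frac_mem {n d p : ℕ} [NeZero n] [NeZero d] (hp : p.Prime) (hn : n = p * d)
    (hd : d ∣ n) (a : ℤ) :
    fiberSum hd (fun v : (ZMod n)ˣ => frac (-(a * v) : ZMod n)) ∈ fracSpan d := by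
  classical
  obtain ⟨f, hf, hf'⟩ := exists_sum_lifts hp hn hd a
  have hunits (w : (ZMod d)ˣ) : fiberSum hd (fun v : (ZMod n)ˣ => frac (-(a * v) : ZMod n)) w
      = ∑ y with ZMod.castHom hd (ZMod d) y = w ∧ IsUnit y, frac (-(a * y) : ZMod n) := by
    rw [fiberSum_apply]
    refine Finset.sum_bij (fun v _ => (v : ZMod n)) ?_ ?_ ?_ fun _ _ => rfl
    · intro v hv
      rw [Finset.mem_filter] at hv ⊢
      exact ⟨Finset.mem_univ _, by rw [← hv.2]; rfl, v.isUnit⟩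
    · intro v _ v' _ h
      exact Units.ext h
    · intro y hy
      rw [Finset.mem_filter] at hy
      refine ⟨hy.2.2.unit, ?_, rfl⟩
      rw [Finset.mem_filter]
      exact ⟨Finset.mem_univ _, Units.ext hy.2.1⟩
  have hcop (w : (ZMod d)ˣ) (y : ZMod n) (hy : ZMod.castHom hd (ZMod d) y = w) :
      y.val.Coprime d := by
    rw [← ZMod.isUnit_iff_coprime, ← map_natCast (ZMod.castHom hd (ZMod d)), ZMod.natCast_zmod_val,
      hy]
    exact w.isUnit
  have hunit (w : (ZMod d)ˣ) (y : ZMod n) (hy : ZMod.castHom hd (ZMod d) y = w) :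
      IsUnit y ↔ y.val.Coprime p := by
    conv_lhs => rw [← ZMod.natCast_zmod_val y]
    rw [ZMod.isUnit_iff_coprime]
    have : y.val.Coprime n ↔ y.val.Coprime (p * d) := by rw [← hn]
    rw [this, Nat.coprime_mul_iff_right]
    exact and_iff_left (hcop w y hy)
  by_cases hpd : p ∣ d
  · convert hf using 1
    ext w
    rw [hunits, ← hf']
    refine Finset.sum_congr ?_ fun _ _ => rfl
    ext y
    simp only [Finset.mem_filter, Finset.mem_univ, true_and, and_iff_left_iff_imp]
    intro hy
    exact (hunit w y hy).2 ((hcop w y hy).coprime_dvd_right hpd)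
  -- Exactly one lift of `w` is divisible by `p`, namely `p` times a lift of `p⁻¹ w`; it contributes
  -- a fractional part of level `d`.
  · have hpd' : p.Coprime d := hp.coprime_iff_not_dvd.2 hpd
    let P := ZMod.unitOfCoprime p hpd'
    obtain ⟨b, hb⟩ := ZMod.intCast_surjective ((P⁻¹ : (ZMod d)ˣ) : ZMod d)
    have hP : ((P⁻¹ : (ZMod d)ˣ) : ZMod d) * p = 1 := P.inv_mul
    convert sub_mem hf (frac_mem_fracSpan (d := d) (a * b)) using 1
    ext w
    rw [hunits, Pi.sub_apply, ← hf', eq_sub_iff_add_eq,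
      ← Finset.sum_filter_add_sum_filter_not (Finset.univ.filter fun y =>
        ZMod.castHom hd (ZMod d) y = w) (fun y => IsUnit y), Finset.filter_filter]
    congr 1
    obtain ⟨k, hk⟩ := ZMod.intCast_surjective (w : ZMod d)
    have h1 : (Finset.univ.filter fun y => ZMod.castHom hd (ZMod d) y = w).filter
        (fun y => ¬ IsUnit y) = {((p * (b * k) : ℤ) : ZMod n)} := by
      have h2 : ZMod.castHom hd (ZMod d) ((p * (b * k) : ℤ) : ZMod n) = w := by
        rw [map_intCast]
        push_cast
        rw [hb, hk]
        linear_combination (w : ZMod d) * hP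
      ext y
      simp only [Finset.mem_filter, Finset.mem_univ, true_and, Finset.mem_singleton]
      constructor
      · rintro ⟨hy, hy'⟩
        rw [hunit w y hy, Nat.coprime_comm, hp.coprime_iff_not_dvd, not_not] at hy'
        obtain ⟨l, hl⟩ := hy'
        have h3 : y = ((p * l : ℤ) : ZMod n) := by
          rw [← ZMod.natCast_zmod_val y, hl]
          push_cast
          rfl
        subst h3
        rw [← h2, map_intCast, map_intCast] at hy
        push_cast at hy
        have h4 : ((l : ℤ) : ZMod d) = ((b * k : ℤ) : ZMod d) := by
          push_cast
          linear_combination ((P⁻¹ : (ZMod d)ˣ) : ZMod d) * hy - ((l : ZMod d) - b * k) * hP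
        rw [ZMod.intCast_eq_intCast_iff_dvd_sub] at h4 ⊢
        obtain ⟨c, hc⟩ := h4
        refine ⟨c, ?_⟩
        rw [← mul_sub, hc, hn]
        push_cast
        ring
      · rintro rfl
        refine ⟨h2, ?_⟩
        rw [hunit w _ h2, Nat.coprime_comm, hp.coprime_iff_not_dvd, not_not]
        have h5 : (p : ℤ) ∣ (((p * (b * k) : ℤ) : ZMod n).val : ℤ) := by
          rw [ZMod.val_intCast, hn]
          push_cast
          rw [Int.mul_emod_mul_of_pos _ _ (by exact_mod_cast hp.pos)]
          exact dvd_mul_right _ _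
        exact_mod_cast h5
    rw [h1, Finset.sum_singleton]
    have h6 : (-(a * ((p * (b * k) : ℤ) : ZMod n)) : ZMod n)
        = ((p * (-(a * b * k)) : ℤ) : ZMod n) := by
      push_cast
      ring
    rw [h6, frac_mul hn, ← hk]
    push_cast
    rfl

lemma fiberSum_mem_of_prime {n d p : ℕ} [NeZero n] [NeZero d] (hp : p.Prime) (hn : n = p * d)
    (hd : d ∣ n) {f : (ZMod n)ˣ → ℚ} (hf : f ∈ fracSpan n) : fiberSum hd f ∈ fracSpan d := by
  have : fracSpan n ≤ (fracSpan d).comap (fiberSum hd) := by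
    rw [fracSpan, AddSubgroup.closure_le]
    rintro f (⟨a, rfl⟩ | rfl)
    · exact fiberSum_frac_mem hp hn hd a
    · rw [SetLike.mem_coe, AddSubgroup.mem_comap]
      convert nsmul_mem (half_mem_fracSpan (d := d))
        (Finset.univ.filter fun v => ZMod.unitsMap hd v = 1).card using 1
      ext w
      rw [fiberSum_apply, Finset.sum_const, Pi.smul_apply]
      congr 1
      refine MonoidHom.card_fiber_eq_of_mem_range _ ?_ ⟨1, map_one _⟩
      exact ZMod.unitsMap_surjective hd w
  exact this hf

lemma fiberSum_mem {n d : ℕ} [i : NeZero n] [NeZero d] (hd : d ∣ n) {f : (ZMod n)ˣ → ℚ}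
    (hf : f ∈ fracSpan n) : fiberSum hd f ∈ fracSpan d := by
  revert i hd f
  induction n using Nat.strong_induction_on with
  | _ n ih =>
    intro i hd f hf
    by_cases h : n = d
    · subst h
      convert hf using 1
      ext w
      rw [fiberSum_apply, ZMod.unitsMap_self]
      simp [Finset.filter_eq']
    · obtain ⟨k, hk⟩ := hd
      have hk1 : k ≠ 1 := by rintro rfl; exact h (by rw [hk, mul_one])
      obtain ⟨p, hp, l, rfl⟩ := Nat.exists_prime_and_dvd hk1
      have hn : n = p * (d * l) := by rw [hk]; ring
      have hl : NeZero (d * l) := ⟨fun h => NeZero.ne n (by rw [hn, h, mul_zero])⟩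
      have hlt : d * l < n := by
        rw [hn]
        exact lt_mul_of_one_lt_left (NeZero.pos (d * l)) hp.one_lt
      have hdvd : d * l ∣ n := ⟨p, by rw [hn, mul_comm]⟩
      have := ih (d * l) hlt (dvd_mul_right d l) (fiberSum_mem_of_prime hp hn hdvd hf)
      rwa [fiberSum_fiberSum] at this

end Distribution

end

/-! ### Transport to the units modulo `m`, and generators of `S'`. -/

section

section Transport

/-- The Galois group of `ℚ(ζ_m)` is `(ℤ/m)ˣ`. -/
def galEquiv (m : ℕ) [NeZero m] : G m ≃* (ZMod m)ˣ :=
  IsCyclotomicExtension.Rat.galEquivZMod m (Cyc m)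

/-- The isomorphism of group rings induced by `galEquiv`. -/
def galRing (m : ℕ) [NeZero m] : QG m ≃ₐ[ℚ] UnitRing m :=
  MonoidAlgebra.domCongr ℚ ℚ (galEquiv m)

lemma coeff_galRing {m : ℕ} [NeZero m] (x : QG m) (u : (ZMod m)ˣ) :
    (galRing m x).coeff u = x.coeff ((galEquiv m).symm u) :=
  MonoidAlgebra.coeff_domCongr ..

lemma galEquiv_resHom {d n : ℕ} [NeZero d] [NeZero n] (h : d ∣ n) (σ : G n) :
    galEquiv d (resHom h σ) = ZMod.unitsMap h (galEquiv n σ) := by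
  let _ : Algebra (Cyc d) (Cyc n) := (Subfield.inclusion (cyc_le h)).toAlgebra
  exact IsCyclotomicExtension.Rat.galEquivZMod_restrictNormal_apply n (Cyc n) (Cyc d) h σ

lemma galRing_normElt (m : ℕ) [NeZero m] : galRing m (normElt m) = unitNorm m := by
  classical
  refine unitRing_ext fun u => ?_
  rw [coeff_galRing, normElt, coeff_unitNorm, MonoidAlgebra.coeff_sum, Finsupp.finsetSum_apply]
  simp [MonoidAlgebra.coeff_single, Finsupp.single_apply]

lemma galRing_theta (m : ℕ) [NeZero m] (a : ℤ) : galRing m (theta m a) = unitTheta (a : ZMod m) := by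
  classical
  refine unitRing_ext fun u => ?_
  rw [coeff_galRing, theta, coeff_unitTheta, MonoidAlgebra.coeff_sum, Finsupp.finsetSum_apply]
  have hmem (s : ℕ) (hs : s.Coprime m) : (sigma m s hs)⁻¹ = (galEquiv m).symm u ↔
      (s : ZMod m) = (u⁻¹ : (ZMod m)ˣ) := by
    rw [MulEquiv.eq_symm_apply, map_inv, inv_eq_iff_eq_inv, sigma, ← galEquiv,
      MulEquiv.apply_symm_apply, ← Units.val_inj, ZMod.coe_unitOfCoprime]
  -- The representative of a unit is zero only when `m = 1`; there the summation index is `s = m`.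
  have hval : ∃ s ∈ Finset.Icc 1 m, (s : ZMod m) = (u⁻¹ : (ZMod m)ˣ) := by
    by_cases h : ((u⁻¹ : (ZMod m)ˣ) : ZMod m).val = 0
    · refine ⟨m, Finset.mem_Icc.2 ⟨NeZero.pos m, le_rfl⟩, ?_⟩
      rw [(ZMod.val_eq_zero _).1 h, ZMod.natCast_self]
    · exact ⟨_, Finset.mem_Icc.2 ⟨Nat.pos_of_ne_zero h, (ZMod.val_lt _).le⟩, ZMod.natCast_zmod_val _⟩
  obtain ⟨s, hs, hsu⟩ := hval
  have hsc : s.Coprime m := by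
    rw [← ZMod.isUnit_iff_coprime, hsu]
    exact Units.isUnit _
  rw [Finset.sum_eq_single_of_mem s hs]
  · rw [dif_pos hsc, MonoidAlgebra.coeff_single, (hmem s hsc).2 hsu, Finsupp.single_eq_same]
    have := fract_eq_frac (m := m) (-(a * s))
    push_cast at this
    rw [this, hsu]
  · intro b hb hbs
    split_ifs with hbc
    · rw [MonoidAlgebra.coeff_single, Finsupp.single_apply, if_neg]
      rw [hmem, ← hsu]
      intro h
      refine hbs ?_
      rw [ZMod.natCast_eq_natCast_iff'] at h
      rw [Finset.mem_Icc] at hs hb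
      rcases hs.2.eq_or_lt with rfl | hs' <;> rcases hb.2.eq_or_lt with rfl | hb'
      · rfl
      · rw [Nat.mod_self, Nat.mod_eq_of_lt hb'] at h
        omega
      · rw [Nat.mod_self, Nat.mod_eq_of_lt hs'] at h
        omega
      · rwa [Nat.mod_eq_of_lt hb', Nat.mod_eq_of_lt hs'] at h
    · simp

lemma coeff_thetaUp (m n : ℕ) [NeZero m] [NeZero n] (a : ℤ) (σ : G m) :
    (thetaUp m n a).coeff σ
      = (res (Nat.gcd_dvd_right m n) (theta n a)).coeff (resHom (Nat.gcd_dvd_left m n) σ) := by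
  classical
  change MonoidAlgebra.coeff (∑ τ : G m, _) σ = _
  rw [MonoidAlgebra.coeff_sum, Finsupp.finsetSum_apply]
  simp [MonoidAlgebra.coeff_single, Finsupp.single_apply]

lemma galRing_res {d n : ℕ} [NeZero d] [NeZero n] (h : d ∣ n) (x : QG n) (w : (ZMod d)ˣ) :
    (galRing d (res h x)).coeff w = fiberSum h (fun v => (galRing n x).coeff v) w := by
  classical
  induction x using MonoidAlgebra.induction_linear with
  | zero => simp [fiberSum_apply]
  | add x y hx hy =>
    rw [map_add, map_add, MonoidAlgebra.coeff_add, Finsupp.add_apply, hx, hy, fiberSum_apply,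
      fiberSum_apply, fiberSum_apply, ← Finset.sum_add_distrib]
    refine Finset.sum_congr rfl fun v _ => ?_
    rw [map_add, MonoidAlgebra.coeff_add, Finsupp.add_apply]
  | single σ r =>
    rw [coeff_galRing, res, MonoidAlgebra.mapDomainRingHom_apply,
      MonoidAlgebra.mapDomain_single, MonoidAlgebra.coeff_single, Finsupp.single_apply, fiberSum_apply, MulEquiv.eq_symm_apply, galEquiv_resHom]
    have (v : (ZMod n)ˣ) : (galRing n (MonoidAlgebra.single σ r)).coeff v
        = if v = galEquiv n σ then r else 0 := by
      rw [coeff_galRing, MonoidAlgebra.coeff_single, Finsupp.single_apply, MulEquiv.eq_symm_apply]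
      by_cases hv : v = galEquiv n σ
      · rw [if_pos hv, if_pos hv.symm]
      · rw [if_neg hv, if_neg (Ne.symm hv)]
    simp only [this, Finset.sum_ite_eq', Finset.mem_filter, Finset.mem_univ, true_and]
    congr

/-- The group generated by the elements `unitTheta x` and `halfUnitNorm m`. -/
def unitSprime (m : ℕ) [NeZero m] : Submodule ℤ (UnitRing m) :=
  Submodule.span ℤ (Set.range unitTheta ∪ {halfUnitNorm m})

lemma unitTheta_mem_unitSprime {m : ℕ} [NeZero m] (x : ZMod m) : unitTheta x ∈ unitSprime m :=
  Submodule.subset_span (Or.inl ⟨x, rfl⟩)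

lemma halfUnitNorm_mem_unitSprime {m : ℕ} [NeZero m] : halfUnitNorm m ∈ unitSprime m :=
  Submodule.subset_span (Or.inr rfl)

/-- Pullback of functions along the inverse of the reduction map. -/
def pullback {d m : ℕ} [NeZero m] (h : d ∣ m) : ((ZMod d)ˣ → ℚ) →+ UnitRing m where
  toFun f := ofFun fun u => f (ZMod.unitsMap h u⁻¹)
  map_zero' := unitRing_ext fun u => by rw [coeff_ofFun]; rfl
  map_add' f g := unitRing_ext fun u => by
    rw [MonoidAlgebra.coeff_add, Finsupp.add_apply]; rfl

lemma pullback_frac {d m : ℕ} [NeZero d] [NeZero m] (h : d ∣ m) (b : ℤ) :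
    pullback h (fun w : (ZMod d)ˣ => frac (-(b * w) : ZMod d))
      = unitTheta (((m / d : ℕ) * b : ℤ) : ZMod m) := by
  refine unitRing_ext fun u => ?_
  obtain ⟨k, hk⟩ := ZMod.intCast_surjective ((u⁻¹ : (ZMod m)ˣ) : ZMod m)
  have h1 : (ZMod.unitsMap h u⁻¹ : ZMod d) = k := by
    rw [← map_intCast (ZMod.castHom h (ZMod d)), hk]
    rfl
  change frac _ = _
  rw [coeff_unitTheta, h1, ← hk]
  have := frac_mul (n := m) (d := d) (Nat.div_mul_cancel h).symm (-(b * k))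
  push_cast at this ⊢
  rw [← this]
  ring_nf

lemma pullback_half {d m : ℕ} [NeZero d] [NeZero m] (h : d ∣ m) :
    pullback h (fun _ => 1 / 2) = halfUnitNorm m :=
  unitRing_ext fun u => by rw [coeff_halfUnitNorm]; rfl

lemma pullback_mem {d m : ℕ} [NeZero d] [NeZero m] (h : d ∣ m) {f : (ZMod d)ˣ → ℚ}
    (hf : f ∈ fracSpan d) : pullback h f ∈ unitSprime m := by
  have : fracSpan d ≤ (unitSprime m).toAddSubgroup.comap (pullback h) := by
    rw [fracSpan, AddSubgroup.closure_le]
    rintro f (⟨b, rfl⟩ | rfl)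
    · rw [SetLike.mem_coe, AddSubgroup.mem_comap, pullback_frac]
      exact unitTheta_mem_unitSprime _
    · rw [SetLike.mem_coe, AddSubgroup.mem_comap, pullback_half]
      exact halfUnitNorm_mem_unitSprime
  exact this hf

lemma galRing_thetaUp (m n : ℕ) [NeZero m] [NeZero n] (a : ℤ) :
    galRing m (thetaUp m n a) = pullback (Nat.gcd_dvd_left m n)
      (fiberSum (Nat.gcd_dvd_right m n) fun v : (ZMod n)ˣ => frac (-(a * v) : ZMod n)) := by
  refine unitRing_ext fun u => ?_
  rw [coeff_galRing, coeff_thetaUp]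
  have h1 := galRing_res (Nat.gcd_dvd_right m n) (theta n a)
    (ZMod.unitsMap (Nat.gcd_dvd_left m n) u)
  have h2 : (galEquiv (m.gcd n)).symm (ZMod.unitsMap (Nat.gcd_dvd_left m n) u)
      = resHom (Nat.gcd_dvd_left m n) ((galEquiv m).symm u) := by
    rw [MulEquiv.symm_apply_eq, galEquiv_resHom, MulEquiv.apply_symm_apply]
  rw [coeff_galRing, h2] at h1
  rw [h1]
  change _ = fiberSum _ _ _
  rw [fiberSum_apply, fiberSum_apply]
  -- The coefficients of `θ` are attached to `σ_s⁻¹`, which accounts for the inversion here and in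
  -- `pullback`.
  refine Finset.sum_equiv (Equiv.inv _) (fun v => ?_) fun v _ => ?_
  · simp
  · rw [galRing_theta, coeff_unitTheta]
    rfl

/-- Restriction sums over fibres and stays in `fracSpan` by `fiberSum_mem`. Corestriction is the
pullback, and it sends level `d` to arguments divisible by `m / d`. So all levels `n` reduce to
level `m` and `N/2`. -/
lemma galRing_mem_unitSprime {m : ℕ} [NeZero m] {x : QG m} (hx : x ∈ Sprime m) :
    galRing m x ∈ unitSprime m := by
  have : Sprime m ≤ (unitSprime m).toAddSubgroup.comap (galRing m : QG m →+ UnitRing m) := by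
    rw [Sprime, AddSubgroup.closure_le]
    rintro x ⟨n, hn, a, rfl⟩
    rw [SetLike.mem_coe, AddSubgroup.mem_comap]
    change galRing m (thetaUp m n a) ∈ unitSprime m
    rw [galRing_thetaUp]
    exact pullback_mem _ (fiberSum_mem _ (frac_mem_fracSpan a))
  exact this hx

lemma theta_mem_Sprime (m : ℕ) [NeZero m] (a : ℤ) : theta m a ∈ Sprime m := by
  refine AddSubgroup.subset_closure ⟨m, inferInstance, a, (galRing m).injective ?_⟩
  rw [galRing_thetaUp, galRing_theta]
  have h (d : ℕ) (hd : d = m) (h : d ∣ m) : unitTheta (a : ZMod m) = pullback h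
      (fiberSum h fun v : (ZMod m)ˣ => frac (-(a * v) : ZMod m)) := by
    subst hd
    refine unitRing_ext fun u => ?_
    change _ = fiberSum _ _ _
    rw [fiberSum_apply, ZMod.unitsMap_self, coeff_unitTheta]
    simp [Finset.filter_eq']
  exact h _ (Nat.gcd_self m) _

lemma normElt_mem_Sprime {m : ℕ} [NeZero m] (hm : 1 < m) : normElt m ∈ Sprime m := by
  have : Fact (1 < m) := ⟨hm⟩
  have h : normElt m = theta m 1 + theta m (-1) := (galRing m).injective <| by
    rw [map_add, galRing_theta, galRing_theta, galRing_normElt, Int.cast_neg,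
      unitTheta_add_neg (by simp)]
  rw [h]
  exact add_mem (theta_mem_Sprime m _) (theta_mem_Sprime m _)

lemma mem_integralGroupRing_iff {m : ℕ} [NeZero m] {x : QG m} :
    x ∈ integralGroupRing m ↔ ∀ u, ∃ n : ℤ, (galRing m x).coeff u = n := by
  change x ∈ (MonoidAlgebra.mapRingHom (G m) (Int.castRingHom ℚ)).range ↔ _
  rw [mem_range_mapRingHom_iff, (galEquiv m).symm.surjective.forall]
  simp only [coeff_galRing]

end Transport

end

/-! ### Nonvanishing of the Bernoulli sums of odd primitive characters. -/

section

section Analytic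

open Complex Filter Topology HurwitzZeta Asymptotics

variable {w : ℂ}

lemma re_lt_one_of_norm_eq_one (hw : ‖w‖ = 1) (hw1 : w ≠ 1) : w.re < 1 := by
  refine lt_of_le_of_ne (hw ▸ re_le_norm w) fun h => hw1 ?_
  have h1 : w.re ^ 2 + w.im ^ 2 = 1 := by
    have := Complex.sq_norm w
    rw [hw, normSq_apply] at this
    linarith
  rw [h] at h1
  have h2 : w.im = 0 := by
    have : w.im ^ 2 = 0 := by linarith
    exact pow_eq_zero_iff two_ne_zero |>.1 this
  exact Complex.ext h h2

lemma one_sub_mul_exp_mem_slitPlane (hw : ‖w‖ = 1) (hw1 : w ≠ 1) {t : ℝ} (ht : 0 ≤ t) :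
    1 - w * Real.exp (-t) ∈ slitPlane := by
  refine Or.inl ?_
  have h1 := re_lt_one_of_norm_eq_one hw hw1
  have h2 : Real.exp (-t) ≤ 1 := Real.exp_le_one_iff.2 (by linarith)
  have h3 := Real.exp_pos (-t)
  rw [sub_re, one_re, re_mul_ofReal]
  nlinarith

/-- The generating function `∑ wⁿ e⁻ⁿᵗ`. -/
def geomKernel (w : ℂ) (t : ℝ) : ℂ := w * Real.exp (-t) / (1 - w * Real.exp (-t))

lemma continuousAt_geomKernel (hw : ‖w‖ = 1) (hw1 : w ≠ 1) {t : ℝ} (ht : 0 ≤ t) :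
    ContinuousAt (geomKernel w) t := by
  have := slitPlane_ne_zero (one_sub_mul_exp_mem_slitPlane hw hw1 ht)
  unfold geomKernel
  fun_prop (disch := assumption)

lemma tendsto_ofReal_exp_neg : Tendsto (fun t : ℝ => (Real.exp (-t) : ℂ)) atTop (𝓝 0) := by
  have := (continuous_ofReal.tendsto 0).comp (Real.tendsto_exp_neg_atTop_nhds_zero)
  rwa [ofReal_zero] at this

lemma geomKernel_isBigO_top :
    geomKernel w =O[atTop] fun t : ℝ => Real.exp (-1 * t) := by
  have h1 : Tendsto (fun t : ℝ => w / (1 - w * Real.exp (-t))) atTop (𝓝 (w / (1 - w * 0))) := by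
    refine Tendsto.div tendsto_const_nhds
      (tendsto_const_nhds.sub (tendsto_const_nhds.mul tendsto_ofReal_exp_neg)) (by simp)
  have h2 : (fun t : ℝ => (Real.exp (-t) : ℂ)) =O[atTop] fun t : ℝ => Real.exp (-1 * t) :=
    IsBigO.of_bound 1 (Eventually.of_forall fun t => by
      rw [norm_real, neg_one_mul, one_mul])
  refine ((h1.isBigO_one ℝ).mul h2).congr (fun t => ?_) fun t => one_mul _
  rw [geomKernel]
  ring

lemma geomKernel_isBigO_zero (hw : ‖w‖ = 1) (hw1 : w ≠ 1) :
    geomKernel w =O[𝓝[>] 0] fun t : ℝ => t ^ (-(0 : ℝ)) := by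
  have h := (continuousAt_geomKernel hw hw1 le_rfl).continuousWithinAt (s := Set.Ioi 0)
  simpa using h.tendsto.isBigO_one ℝ

lemma locallyIntegrableOn_geomKernel (hw : ‖w‖ = 1) (hw1 : w ≠ 1) :
    MeasureTheory.LocallyIntegrableOn (geomKernel w) (Set.Ioi 0) := by
  refine ContinuousOn.locallyIntegrableOn (fun t ht => ?_) measurableSet_Ioi
  exact (continuousAt_geomKernel hw hw1 (Set.mem_Ioi.1 ht).le).continuousWithinAt

/-- At `s = 1` the integrand is the derivative of `log (1 - w e⁻ᵗ)`, which tends to `0` at infinity.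
-/
lemma mellin_geomKernel_one (hw : ‖w‖ = 1) (hw1 : w ≠ 1) :
    mellin (geomKernel w) 1 = -log (1 - w) := by
  have hint := mellinConvergent_of_isBigO_rpow_exp (s := 1) one_pos
    (locallyIntegrableOn_geomKernel hw hw1) geomKernel_isBigO_top
    (geomKernel_isBigO_zero hw hw1) (by simp)
  rw [MellinConvergent] at hint
  simp only [sub_self, cpow_zero, one_smul] at hint
  rw [mellin]
  simp only [sub_self, cpow_zero, one_smul]
  have hderiv (t : ℝ) (ht : t ∈ Set.Ici (0 : ℝ)) :
      HasDerivAt (fun t : ℝ => log (1 - w * Real.exp (-t))) (geomKernel w t) t := by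
    have h1 := one_sub_mul_exp_mem_slitPlane hw hw1 (Set.mem_Ici.1 ht)
    have h2 : HasDerivAt (fun t : ℝ => (Real.exp (-t) : ℂ)) (-Real.exp (-t) : ℝ) t := by
      have : HasDerivAt (fun t : ℝ => Real.exp (-t)) (-Real.exp (-t)) t := by
        simpa using (hasDerivAt_neg t).exp
      exact this.ofReal_comp
    have h3 := ((h2.const_mul w).const_sub 1).clog_real h1
    convert h3 using 1
    rw [geomKernel, ofReal_neg, mul_neg, neg_neg]
  have hlim : Tendsto (fun t : ℝ => log (1 - w * Real.exp (-t))) atTop (𝓝 0) := by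
    have h1 : Tendsto (fun t : ℝ => 1 - w * Real.exp (-t)) atTop (𝓝 (1 - w * 0)) :=
      tendsto_const_nhds.sub (tendsto_const_nhds.mul tendsto_ofReal_exp_neg)
    have h2 := h1.clog (by simp)
    rwa [mul_zero, sub_zero, log_one] at h2
  rw [MeasureTheory.integral_Ioi_of_hasDerivAt_of_tendsto' hderiv hint hlim]
  simp

lemma mellin_geomKernel (a : ℝ) {s : ℂ} (hs : 1 < s.re) :
    mellin (geomKernel (cexp (2 * Real.pi * I * a))) s = Gamma s * expZeta a s := by
  set w := cexp (2 * Real.pi * I * a) with hw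
  have hnorm : ‖w‖ = 1 := by
    rw [hw, show 2 * Real.pi * I * a = ((2 * Real.pi * a : ℝ) : ℂ) * I by push_cast; ring,
      norm_exp_ofReal_mul_I]
  have h1 := hasSum_mellin (a := fun n : ℕ => w ^ (n + 1)) (p := fun n => (n + 1 : ℝ))
    (F := geomKernel w) (s := s) (fun n => Or.inr (by positivity)) (by linarith) ?_ ?_
  · have h2 := hasSum_expZeta_of_one_lt_re a hs
    rw [← hasSum_nat_add_iff' 1] at h2
    have h3 := h2.mul_left (Gamma s)
    rw [Finset.sum_range_one, Nat.cast_zero, zero_cpow (ne_zero_of_one_lt_re hs), div_zero,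
      sub_zero] at h3
    refine h1.unique (h3.congr_fun fun n => ?_)
    rw [hw, ← Complex.exp_nat_mul, mul_div_assoc]
    push_cast
    ring_nf
  · intro t ht
    have ht' : (0 : ℝ) < t := ht
    have h2 : ‖w * Real.exp (-t)‖ < 1 := by
      rw [norm_mul, hnorm, one_mul, norm_real, Real.norm_of_nonneg (Real.exp_pos _).le]
      exact Real.exp_lt_one_iff.2 (by linarith)
    have h3 := (hasSum_geometric_of_norm_lt_one h2).mul_left (w * Real.exp (-t))
    rw [← div_eq_mul_inv] at h3
    refine h3.congr_fun fun n => ?_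
    rw [← pow_succ', mul_pow, ← ofReal_pow, ← Real.exp_nat_mul]
    push_cast
    ring_nf
  · have := (Real.summable_one_div_nat_rpow (p := s.re)).2 hs
    rw [← summable_nat_add_iff 1] at this
    refine this.congr fun n => ?_
    rw [norm_pow, hnorm, one_pow]
    push_cast
    rfl

/-- The identity of `mellin_geomKernel` holds for `s > 1`, where the series converges absolutely.
Both sides are continuous at `1`, so it persists there. -/
lemma expZeta_one {a : ℝ} (hw1 : cexp (2 * Real.pi * I * a) ≠ 1) (ha : (a : UnitAddCircle) ≠ 0) :
    expZeta a 1 = -log (1 - cexp (2 * Real.pi * I * a)) := by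
  have hnorm : ‖cexp (2 * Real.pi * I * a)‖ = 1 := by
    rw [show 2 * Real.pi * I * a = ((2 * Real.pi * a : ℝ) : ℂ) * I by push_cast; ring,
      norm_exp_ofReal_mul_I]
  rw [← mellin_geomKernel_one hnorm hw1]
  have hc1 : ContinuousAt (mellin (geomKernel (cexp (2 * Real.pi * I * a)))) 1 :=
    (mellin_differentiableAt_of_isBigO_rpow_exp one_pos (locallyIntegrableOn_geomKernel hnorm hw1)
      geomKernel_isBigO_top (geomKernel_isBigO_zero hnorm hw1) (by simp)).continuousAt
  have hc2 : ContinuousAt (fun s => Gamma s * expZeta a s) 1 := by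
    refine ContinuousAt.mul (continuousAt_Gamma_one)
      (differentiable_expZeta_of_ne_zero ha).continuous.continuousAt
  have ht : Tendsto (fun x : ℝ => (x : ℂ)) (𝓝[>] 1) (𝓝 1) := by
    have := (continuous_ofReal.tendsto 1).mono_left (nhdsWithin_le_nhds (s := Set.Ioi 1))
    simpa using this
  have h1 := hc1.tendsto.comp ht
  have h2 := hc2.tendsto.comp ht
  have h3 := tendsto_nhds_unique_of_eventuallyEq h1 h2 (by
    filter_upwards [self_mem_nhdsWithin] with x hx
    exact mellin_geomKernel a (by simpa using hx))
  rw [h3, Gamma_one, one_mul]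

lemma one_sub_exp {a : ℝ} (ha0 : 0 < a) (ha1 : a < 1) (ε : ℝ) (hε : ε = 1 ∨ ε = -1) :
    1 - cexp (2 * Real.pi * I * (ε * a : ℝ))
      = cexp (Real.log (2 * Real.sin (Real.pi * a)) + (ε * (Real.pi * a - Real.pi / 2) : ℝ) * I) := by
  have hs : 0 < Real.sin (Real.pi * a) := Real.sin_pos_of_pos_of_lt_pi
    (mul_pos Real.pi_pos ha0) (by nlinarith [Real.pi_pos])
  rw [Complex.exp_add, ← ofReal_exp, Real.exp_log (by positivity)]
  have h1 : cexp (2 * Real.pi * I * (ε * a : ℝ)) = cexp ((2 * (Real.pi * (ε * a)) : ℝ) * I) := by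
    push_cast
    ring_nf
  rw [h1, Complex.exp_mul_I, Complex.exp_mul_I, ← ofReal_cos, ← ofReal_sin, ← ofReal_cos,
    ← ofReal_sin, Real.cos_two_mul, Real.sin_two_mul]
  have hsq : (Real.sin (Real.pi * a) : ℂ) ^ 2 + (Real.cos (Real.pi * a) : ℂ) ^ 2 = 1 := by
    exact_mod_cast Real.sin_sq_add_cos_sq (Real.pi * a)
  rcases hε with rfl | rfl
  · rw [one_mul, one_mul, Real.cos_sub_pi_div_two, Real.sin_sub_pi_div_two]
    generalize Real.sin (Real.pi * a) = S, Real.cos (Real.pi * a) = C at *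
    push_cast
    linear_combination (-2) * hsq
  · have h2 : Real.pi * (-1 * a) = -(Real.pi * a) := by ring
    have h3 : -1 * (Real.pi * a - Real.pi / 2) = Real.pi / 2 - Real.pi * a := by ring
    rw [h2, h3, Real.cos_pi_div_two_sub, Real.sin_pi_div_two_sub, Real.cos_neg, Real.sin_neg]
    generalize Real.sin (Real.pi * a) = S, Real.cos (Real.pi * a) = C at *
    push_cast
    linear_combination (-2) * hsq

lemma log_one_sub_exp {a : ℝ} (ha0 : 0 < a) (ha1 : a < 1) (ε : ℝ) (hε : ε = 1 ∨ ε = -1) :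
    log (1 - cexp (2 * Real.pi * I * (ε * a : ℝ)))
      = Real.log (2 * Real.sin (Real.pi * a)) + (ε * (Real.pi * a - Real.pi / 2) : ℝ) * I := by
  have hp := Real.pi_pos
  rw [one_sub_exp ha0 ha1 ε hε, log_exp]
  · rw [add_im, ofReal_im, zero_add, im_ofReal_mul, I_im, mul_one]
    rcases hε with rfl | rfl <;> nlinarith
  · rw [add_im, ofReal_im, zero_add, im_ofReal_mul, I_im, mul_one]
    rcases hε with rfl | rfl <;> nlinarith

/-- The Fourier series of the sawtooth: the numbers `1 - exp(±2πia)` have equal modulus and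
arguments `±(πa - π/2)`, so the difference of their logarithms is linear in `a`. -/
lemma sinZeta_one {a : ℝ} (ha0 : 0 < a) (ha1 : a < 1) :
    sinZeta a 1 = (Real.pi * (1 / 2 - a) : ℝ) := by
  have hne (ε : ℝ) (hε : ε = 1 ∨ ε = -1) : cexp (2 * Real.pi * I * (ε * a : ℝ)) ≠ 1 := by
    intro h
    have := one_sub_exp ha0 ha1 ε hε
    rw [h, sub_self] at this
    exact Complex.exp_ne_zero _ this.symm
  have ha : (a : UnitAddCircle) ≠ 0 := by
    rw [Ne, AddCircle.coe_eq_zero_iff]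
    rintro ⟨n, hn⟩
    rw [zsmul_eq_mul, mul_one] at hn
    rw [← hn] at ha0 ha1
    have h1 : 0 < n := by exact_mod_cast ha0
    have h2 : n < 1 := by exact_mod_cast ha1
    omega
  rw [sinZeta_eq, ← AddCircle.coe_neg]
  have h1 := expZeta_one (hne 1 (Or.inl rfl)) (by simpa using ha)
  have h2 := expZeta_one (hne (-1) (Or.inr rfl)) (by simpa using ha)
  rw [log_one_sub_exp ha0 ha1 _ (Or.inl rfl), one_mul] at h1
  rw [log_one_sub_exp ha0 ha1 _ (Or.inr rfl), neg_one_mul] at h2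
  rw [h1, h2]
  push_cast
  field_simp
  ring

lemma sinZeta_toAddCircle {N : ℕ} [NeZero N] (x : ZMod N) :
    sinZeta (ZMod.toAddCircle x) 1 = -(Real.pi * (saw x : ℚ) : ℂ) := by
  by_cases hx : x = 0
  · subst hx
    have h := sinZeta_neg 0 1
    rw [neg_zero] at h
    rw [map_zero, saw, if_pos rfl]
    simpa using self_eq_neg.1 h
  · have hN : (0 : ℝ) < N := by exact_mod_cast NeZero.pos N
    have hv : 0 < x.val := Nat.pos_of_ne_zero ((ZMod.val_ne_zero x).2 hx)
    have hv' : x.val < N := ZMod.val_lt x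
    rw [ZMod.toAddCircle_apply, sinZeta_one (div_pos (by exact_mod_cast hv) hN)
      ((div_lt_one hN).2 (by exact_mod_cast hv')), saw, if_neg hx, frac]
    push_cast
    ring

/-- The sum is `B_{1,χ}`. By the Fourier series of the sawtooth and oddness, its vanishing would
make the L-function of the Fourier transform of `χ` vanish at `1`. For primitive `χ` this transform
is a multiple of `χ⁻¹` by a Gauss sum up to sign; neither the Gauss sum nor `L(1, χ⁻¹)` vanishes. -/
lemma sum_mul_saw_ne_zero {N : ℕ} [NeZero N] {χ : DirichletCharacter ℂ N} (hχ : χ.IsPrimitive)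
    (hodd : χ.Odd) : ∑ j, χ j * (saw j : ℚ) ≠ 0 := by
  intro h0
  have hne : χ ≠ 1 := by
    rintro rfl
    have h := hodd
    rw [DirichletCharacter.Odd, MulChar.one_apply (isUnit_one.neg)] at h
    norm_num at h
  have h00 : χ 0 = 0 := by
    have := DirichletCharacter.Odd.eval_neg χ 0 hodd
    rw [neg_zero] at this
    exact self_eq_neg.1 this
  have h1 := ZMod.LFunction_dft χ (s := 1) (Or.inl h00)
  have h2 : ∑ j : ZMod N, χ j * expZeta (ZMod.toAddCircle (-j)) 1
      = -I * ∑ j : ZMod N, χ j * sinZeta (ZMod.toAddCircle j) 1 := by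
    have h3 : ∑ j : ZMod N, χ j * expZeta (ZMod.toAddCircle (-j)) 1
        = -∑ j : ZMod N, χ j * expZeta (ZMod.toAddCircle j) 1 := by
      rw [← Finset.sum_neg_distrib]
      refine Fintype.sum_equiv (Equiv.neg _) _ _ fun j => ?_
      rw [Equiv.neg_apply, DirichletCharacter.Odd.eval_neg χ _ hodd]
      ring
    have h4 : ∑ j : ZMod N, χ j * sinZeta (ZMod.toAddCircle j) 1
        = (∑ j : ZMod N, χ j * expZeta (ZMod.toAddCircle j) 1
          - ∑ j : ZMod N, χ j * expZeta (ZMod.toAddCircle (-j)) 1) / (2 * I) := by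
      rw [← Finset.sum_sub_distrib, Finset.sum_div]
      refine Finset.sum_congr rfl fun j _ => ?_
      rw [sinZeta_eq, map_neg]
      ring
    rw [h4, h3]
    field_simp
    ring
  have h5 : ∑ j : ZMod N, χ j * sinZeta (ZMod.toAddCircle j) 1 = 0 := by
    have : ∑ j : ZMod N, χ j * sinZeta (ZMod.toAddCircle j) 1
        = -Real.pi * ∑ j, χ j * (saw j : ℚ) := by
      rw [Finset.mul_sum]
      refine Finset.sum_congr rfl fun j _ => ?_
      rw [sinZeta_toAddCircle]
      ring
    rw [this, h0, mul_zero]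
  rw [h2, h5, mul_zero] at h1
  have h6 : ZMod.LFunction (ZMod.dft χ) 1
      = -gaussSum χ ZMod.stdAddChar * DirichletCharacter.LFunction χ⁻¹ 1 := by
    have hinv : χ⁻¹.Odd := by
      rw [DirichletCharacter.Odd, MulChar.inv_apply_eq_inv', hodd]
      norm_num
    rw [DirichletCharacter.LFunction, ZMod.LFunction, ZMod.LFunction, mul_left_comm]
    congr 1
    rw [Finset.mul_sum]
    refine Finset.sum_congr rfl fun j _ => ?_
    rw [hχ.fourierTransform_eq_inv_mul_gaussSum, DirichletCharacter.Odd.eval_neg _ _ hinv]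
    ring
  rw [h6] at h1
  rcases mul_eq_zero.1 h1 with h7 | h7
  · have h8 : ZMod.dft (χ : ZMod N → ℂ) = 0 := by
      ext k
      rw [hχ.fourierTransform_eq_inv_mul_gaussSum, neg_eq_zero.1 h7, mul_zero]
      rfl
    have h9 : (χ : ZMod N → ℂ) = 0 := by simpa using h8
    have := congrFun h9 1
    rw [map_one] at this
    exact one_ne_zero this
  · exact DirichletCharacter.LFunction_apply_one_ne_zero (inv_ne_one.2 hne) h7

end Analytic

end

/-! ### Linear independence by characters. -/

section

section Rank

variable {m : ℕ} [NeZero m]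

lemma saw_mul {d k : ℕ} [NeZero d] (h : m = k * d) (a : ℤ) :
    saw ((k * a : ℤ) : ZMod m) = saw (a : ZMod d) := by
  have hk : k ≠ 0 := by
    rintro rfl
    exact NeZero.ne m (by rw [h, zero_mul])
  have h0 : ((k * a : ℤ) : ZMod m) = 0 ↔ (a : ZMod d) = 0 := by
    rw [ZMod.intCast_zmod_eq_zero_iff_dvd, ZMod.intCast_zmod_eq_zero_iff_dvd, h, Nat.cast_mul,
      mul_dvd_mul_iff_left (by exact_mod_cast hk)]
  rw [saw, saw, frac_mul h]
  simp only [h0]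

/-- The coefficients of an element of the group ring, as complex numbers. -/
def complexCoeff (m : ℕ) [NeZero m] : UnitRing m →ₗ[ℚ] ((ZMod m)ˣ → ℂ) where
  toFun x u := (x.coeff u : ℚ)
  map_add' x y := by
    ext u
    simp
  map_smul' c x := by
    ext u
    simp [Rat.smul_def]

lemma complexCoeff_apply (x : UnitRing m) (u : (ZMod m)ˣ) :
    complexCoeff m x u = (x.coeff u : ℚ) := rfl

lemma sum_unitsMap {d : ℕ} [NeZero d] (h : d ∣ m) (f : (ZMod d)ˣ → ℂ) : ∃ κ : ℕ, κ ≠ 0 ∧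
    ∑ s : (ZMod m)ˣ, f (ZMod.unitsMap h s) = κ * ∑ t, f t := by
  classical
  refine ⟨(Finset.univ.filter fun v => ZMod.unitsMap h v = 1).card, ?_, ?_⟩
  · exact (Finset.card_pos.2 ⟨1, by simp⟩).ne'
  · rw [← Finset.sum_fiberwise (g := ZMod.unitsMap h), Finset.mul_sum]
    refine Finset.sum_congr rfl fun t _ => ?_
    rw [Finset.sum_congr rfl (g := fun _ => f t) fun s hs => by rw [(Finset.mem_filter.1 hs).2],
      Finset.sum_const, nsmul_eq_mul]
    congr 2
    refine MonoidHom.card_fiber_eq_of_mem_range _ ?_ ⟨1, map_one _⟩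
    exact ZMod.unitsMap_surjective h t

lemma sum_units {d : ℕ} [NeZero d] (χ : DirichletCharacter ℂ d) (f : ZMod d → ℂ) :
    ∑ t : (ZMod d)ˣ, χ t * f t = ∑ j, χ j * f j := by
  classical
  have h : ∑ j with IsUnit j, χ j * f j = ∑ j, χ j * f j := by
    refine Finset.sum_filter_of_ne fun j _ hj => ?_
    by_contra h
    exact hj (by rw [χ.map_nonunit h, zero_mul])
  rw [← h]
  refine Finset.sum_bij (fun t _ => (t : ZMod d)) ?_ ?_ ?_ fun _ _ => rfl
  · exact fun t _ => Finset.mem_filter.2 ⟨Finset.mem_univ _, t.isUnit⟩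
  · exact fun _ _ _ _ h => Units.ext h
  · exact fun j hj => ⟨(Finset.mem_filter.1 hj).2.unit, Finset.mem_univ _, rfl⟩

/-- Weighting the conjugates of `psi` by `χ` gives a multiple of `χ`. With the argument `k = m / f`,
where `f` is the conductor, the multiplier is a nonzero number times the Bernoulli sum of the
primitive character. -/
lemma character_mem_of_psi_mem {W : Submodule ℂ ((ZMod m)ˣ → ℂ)}
    (hW : ∀ x : ZMod m, complexCoeff m (psi x) ∈ W) {χ : DirichletCharacter ℂ m} (hχ : χ.Odd) :
    (fun u : (ZMod m)ˣ => χ u) ∈ W := by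
  have hf0 : NeZero χ.conductor := ⟨χ.conductor_ne_zero⟩
  have hdvd := χ.conductor_dvd_level
  set χ₀ := χ.primitiveCharacter with hχ₀
  set k := m / χ.conductor
  have hk : m = k * χ.conductor := (Nat.div_mul_cancel hdvd).symm
  have hval (s : (ZMod m)ˣ) : χ s = χ₀ (ZMod.unitsMap hdvd s) := by
    conv_lhs => rw [← χ.changeLevel_primitiveCharacter]
    rw [DirichletCharacter.changeLevel_eq_cast_of_dvd]
    rfl
  have hodd : χ₀.Odd := by
    have h := hval (-1)
    rw [DirichletCharacter.Odd]
    rw [DirichletCharacter.Odd] at hχ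
    have h2 : ((ZMod.unitsMap hdvd (-1) : (ZMod χ.conductor)ˣ) : ZMod χ.conductor) = -1 := by
      simp [ZMod.unitsMap]
    rw [h2, Units.val_neg, Units.val_one, hχ] at h
    exact h.symm
  have hsaw (s : (ZMod m)ˣ) : saw (k * s : ZMod m) = saw (ZMod.unitsMap hdvd s : ZMod χ.conductor) := by
    obtain ⟨l, hl⟩ := ZMod.intCast_surjective (s : ZMod m)
    have h1 : (ZMod.unitsMap hdvd s : ZMod χ.conductor) = l := by
      rw [← map_intCast (ZMod.castHom hdvd (ZMod χ.conductor)), hl]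
      rfl
    rw [h1, ← saw_mul hk, ← hl]
    push_cast
    rfl
  have hsum : ∑ s : (ZMod m)ˣ, χ s * (saw (k * s : ZMod m) : ℚ) ≠ 0 := by
    obtain ⟨κ, hκ, h⟩ := sum_unitsMap hdvd
      (fun t => χ₀ t * (saw (t : ZMod χ.conductor) : ℚ))
    simp only [hval, hsaw]
    rw [h, sum_units χ₀ fun t => ((saw t : ℚ) : ℂ)]
    exact mul_ne_zero (by exact_mod_cast hκ)
      (sum_mul_saw_ne_zero χ.primitiveCharacter_isPrimitive hodd)
  have hmem : ∑ s : (ZMod m)ˣ, χ s • complexCoeff m (psi (-(s * k) : ZMod m)) ∈ W :=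
    sum_mem fun s _ => W.smul_mem _ (hW _)
  have heq : ∑ s : (ZMod m)ˣ, χ s • complexCoeff m (psi (-(s * k) : ZMod m))
      = (∑ s : (ZMod m)ˣ, χ s * (saw (k * s : ZMod m) : ℚ)) • fun u : (ZMod m)ˣ => χ u := by
    ext u
    rw [Finset.sum_apply, Pi.smul_apply, smul_eq_mul, Finset.sum_mul]
    refine Fintype.sum_equiv (Equiv.mulRight u⁻¹) _ _ fun s => ?_
    rw [Pi.smul_apply, smul_eq_mul, complexCoeff_apply, coeff_psi, Equiv.coe_mulRight]
    have h1 : χ ((s * u⁻¹ : (ZMod m)ˣ) : ZMod m) * χ u = χ s := by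
      rw [← map_mul, ← Units.val_mul, inv_mul_cancel_right]
    have h2 : (-(-(s * k) * ((u⁻¹ : (ZMod m)ˣ) : ZMod m)) : ZMod m)
        = k * ((s * u⁻¹ : (ZMod m)ˣ) : ZMod m) := by
      push_cast
      ring
    rw [h2, ← h1]
    ring
  rw [heq] at hmem
  exact (W.smul_mem_iff hsum).1 hmem

/-- The values `χ(-1)` are `±1` and sum to zero over all characters, since `-1 ≠ 1` for `m > 2`. -/
lemma two_mul_card_odd (hm : 2 < m) :
    2 * Nat.card {χ : DirichletCharacter ℂ m // χ.Odd} = m.totient := by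
  classical
  have hne : (-1 : ZMod m) ≠ 1 := by
    have : Fact (2 < m) := ⟨hm⟩
    exact ZMod.neg_one_ne_one
  have h1 := DirichletCharacter.sum_characters_eq_zero (R := ℂ) hne
  have h2 : ∀ χ : DirichletCharacter ℂ m, χ (-1) = 1 - 2 * if χ.Odd then 1 else 0 := by
    intro χ
    split_ifs with h
    · rw [h]; norm_num
    · rw [χ.even_or_odd.resolve_right h]; norm_num
  simp only [h2, Finset.sum_sub_distrib, ← Finset.mul_sum, Finset.sum_boole, Finset.sum_const,
    Finset.card_univ, nsmul_eq_mul, mul_one] at h1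
  rw [← DirichletCharacter.card_eq_totient_of_hasEnoughRootsOfUnity ℂ m, Nat.card_eq_fintype_card,
    Nat.card_eq_fintype_card, Fintype.card_subtype]
  have h3 : ((2 * (Finset.univ.filter fun χ : DirichletCharacter ℂ m => χ.Odd).card : ℕ) : ℂ)
      = (Fintype.card (DirichletCharacter ℂ m) : ℕ) := by
    push_cast
    linear_combination -h1
  exact_mod_cast h3

/-- A family of at most `φ(m)/2 + 1` elements whose span contains the odd distribution elements
and the norm element is linearly independent. -/
theorem linearIndependent_of_psi_mem (hm : 2 < m) {κ : Type} [Fintype κ] {v : κ → UnitRing m}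
    (hcard : Fintype.card κ ≤ m.totient / 2 + 1)
    (hpsi : ∀ x : ZMod m, psi x ∈ Submodule.span ℚ (Set.range v))
    (hnorm : unitNorm m ∈ Submodule.span ℚ (Set.range v)) : LinearIndependent ℤ v := by
  classical
  set W := Submodule.span ℂ (Set.range fun k => complexCoeff m (v k)) with hWdef
  have hW {x : UnitRing m} (hx : x ∈ Submodule.span ℚ (Set.range v)) : complexCoeff m x ∈ W := by
    have : Submodule.span ℚ (Set.range v) ≤ (W.restrictScalars ℚ).comap (complexCoeff m) := by
      rw [Submodule.span_le]
      rintro _ ⟨k, rfl⟩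
      exact Submodule.subset_span ⟨k, rfl⟩
    exact this hx
  -- The trivial character, supplied by the norm element, together with the odd ones: `φ(m)/2 + 1`
  -- distinct characters, hence independent.
  let char : Option {χ : DirichletCharacter ℂ m // χ.Odd} → ((ZMod m)ˣ →* ℂ) := fun o =>
    o.elim 1 fun χ => (χ.1 : ZMod m →* ℂ).comp (Units.coeHom (ZMod m))
  have hinj : Function.Injective char := by
    have hodd (χ : {χ : DirichletCharacter ℂ m // χ.Odd}) : char (some χ) (-1) = -1 := by
      have := χ.2
      rw [DirichletCharacter.Odd] at this
      simpa [char] using this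
    have hne (χ : {χ : DirichletCharacter ℂ m // χ.Odd}) : char none ≠ char (some χ) := by
      intro h
      have h1 := hodd χ
      rw [← h] at h1
      norm_num [char] at h1
    rintro (_ | χ) (_ | χ') h
    · rfl
    · exact absurd h (hne χ')
    · exact absurd h.symm (hne χ)
    · congr 1
      refine Subtype.ext (MulChar.ext fun u => ?_)
      exact DFunLike.congr_fun h u
  have hli : LinearIndependent ℂ fun o => (char o : (ZMod m)ˣ → ℂ) :=
    (linearIndependent_monoidHom (ZMod m)ˣ ℂ).comp char hinj
  have hle : Submodule.span ℂ (Set.range fun o => (char o : (ZMod m)ˣ → ℂ)) ≤ W := by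
    rw [Submodule.span_le]
    rintro _ ⟨_ | χ, rfl⟩
    · have h : (char none : (ZMod m)ˣ → ℂ) = complexCoeff m (unitNorm m) := by
        ext u
        rw [complexCoeff_apply, coeff_unitNorm]
        simp [char]
      change (char none : (ZMod m)ˣ → ℂ) ∈ W
      exact h ▸ hW hnorm
    · exact character_mem_of_psi_mem (fun x => hW (hpsi x)) χ.2
  have h1 := Submodule.finrank_mono hle
  rw [finrank_span_eq_card hli, Fintype.card_option, ← Nat.card_eq_fintype_card] at h1
  have h2 := two_mul_card_odd hm
  have h3 : Module.finrank ℂ W ≤ Fintype.card κ := finrank_range_le_card _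
  -- The span has dimension at least the number of generators, so the generators are independent.
  have h4 : LinearIndependent ℂ fun k => complexCoeff m (v k) := by
    rw [linearIndependent_iff_card_eq_finrank_span]
    change _ = Module.finrank ℂ W
    omega
  have h5 : LinearIndependent ℤ fun k => complexCoeff m (v k) :=
    h4.restrict_scalars (by
      intro a b hab
      simpa using hab)
  exact h5.of_comp ((complexCoeff m).restrictScalars ℤ)

end Rank

end

/-! ### The set `M` in terms of basic vectors. -/

section

section Representatives

variable {ι : Type} [Fintype ι] [LinearOrder ι] {m : ℕ} [NeZero m] {q : ι → ℕ}
  [∀ i, NeZero (q i)]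

variable (hcop : Pairwise fun i j => (q i).Coprime (q j)) (hprod : m = ∏ i, q i)

/-- The class modulo `m` that is divisible by `q i` for `i ∉ J`, and whose quotient by the product
of these `q i` is congruent to `g i` modulo `q i` for `i ∈ J`. -/
def decode (J : Finset ι) (g : ∀ i, (ZMod (q i))ˣ) : ZMod m :=
  (crt hcop hprod).symm fun i => g i * baseVec q J i

lemma psi_decode (J : Finset ι) (g : ∀ i, (ZMod (q i))ˣ) :
    psi (decode hcop hprod J g) = psiVec hcop hprod fun i => g i * baseVec q J i := rfl

lemma crt_intCast (b : ℤ) (i : ι) : crt hcop hprod (b : ZMod m) i = (b : ZMod (q i)) := by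
  rw [map_intCast]
  rfl

lemma intCast_eq_iff (b : ℤ) (a : ∀ i, ZMod (q i)) :
    (b : ZMod m) = (crt hcop hprod).symm a ↔ ∀ i, (b : ZMod (q i)) = a i := by
  have h : (b : ZMod m) = (crt hcop hprod).symm a ↔ crt hcop hprod (b : ZMod m) = a :=
    (crt hcop hprod).toEquiv.eq_symm_apply
  rw [h, funext_iff]
  simp only [crt_intCast]

include hcop hprod in
lemma intCast_eq_intCast_iff_forall (a b : ℤ) :
    (a : ZMod m) = b ↔ ∀ i, (a : ZMod (q i)) = b := by
  rw [← (crt hcop hprod).injective.eq_iff, funext_iff]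
  simp only [crt_intCast]

include hprod in
lemma prod_compl_mul_prod (J : Finset ι) : (∏ i ∈ Jᶜ, q i) * ∏ i ∈ J, q i = m := by
  rw [hprod, Finset.prod_compl_mul_prod]

include hcop hprod in
lemma gcd_eq_prod {J : Finset ι} {b : ℤ} (h0 : ∀ i ∉ J, (q i : ℤ) ∣ b)
    (h1 : ∀ i ∈ J, IsCoprime b (q i)) : Int.gcd b m = ∏ i ∈ Jᶜ, q i := by
  have h2 : (∏ i ∈ Jᶜ, q i) ∣ b.natAbs :=
    Finset.prod_dvd_of_isRelPrime (fun i _ j _ hij => Nat.coprime_iff_isRelPrime.1 (hcop hij))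
      fun i hi => Int.natCast_dvd.1 (h0 i (by simpa using hi))
  have h3 : Nat.Coprime b.natAbs (∏ i ∈ J, q i) :=
    Nat.Coprime.prod_right fun i hi => by
      have := Int.isCoprime_iff_gcd_eq_one.1 (h1 i hi)
      simpa [Int.gcd] using this
  rw [Int.gcd, Int.natAbs_natCast, ← prod_compl_mul_prod hprod J,
    Nat.Coprime.gcd_mul_right_cancel_right _ h3.symm, Nat.gcd_eq_right h2]

include hcop in
lemma eq_J'_of_eq_decode (hq2 : ∀ i, 2 < q i) {J : Finset ι} {g : ∀ i, (ZMod (q i))ˣ} {b : ℤ}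
    (hb : ∀ i, (b : ZMod (q i)) = g i * baseVec q J i) : J' q b = J := by
  ext i
  have : Fact (1 < q i) := ⟨by linarith [hq2 i]⟩
  rw [J', Finset.mem_filter, ← ZMod.intCast_zmod_eq_zero_iff_dvd, hb]
  by_cases hi : i ∈ J
  · simpa [hi] using ((g i).isUnit.mul (isUnit_baseVec hcop hi)).ne_zero
  · simp [hi, baseVec_of_notMem hi]

section

variable {J : Finset ι} {g : ∀ i, (ZMod (q i))ˣ} {b : ℤ}

include hcop in
lemma dvd_iff_of_eq_decode (hq2 : ∀ i, 2 < q i)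
    (hb : ∀ i, (b : ZMod (q i)) = g i * baseVec q J i) (i : ι) : (q i : ℤ) ∣ b ↔ i ∉ J := by
  rw [← eq_J'_of_eq_decode hcop hq2 hb, J', Finset.mem_filter]
  simp

include hcop in
lemma isCoprime_of_eq_decode (hb : ∀ i, (b : ZMod (q i)) = g i * baseVec q J i) {i : ι}
    (hi : i ∈ J) : IsCoprime b (q i) := by
  rw [isCoprime_comm, ← ZMod.coe_int_isUnit_iff_isCoprime, hb]
  exact (g i).isUnit.mul (isUnit_baseVec hcop hi)

include hcop hprod in
lemma gcd_of_eq_decode (hq2 : ∀ i, 2 < q i)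
    (hb : ∀ i, (b : ZMod (q i)) = g i * baseVec q J i) : Int.gcd b m = ∏ i ∈ Jᶜ, q i :=
  gcd_eq_prod hcop hprod (fun i hi => (dvd_iff_of_eq_decode hcop hq2 hb i).2 hi)
    fun _ hi => isCoprime_of_eq_decode hcop hb hi

include hprod in
lemma modulus_ediv_prod (J : Finset ι) :
    (m : ℤ) / ((∏ i ∈ Jᶜ, q i : ℕ) : ℤ) = ((∏ i ∈ J, q i : ℕ) : ℤ) := by
  have h : (∏ i ∈ Jᶜ, q i) ≠ 0 := Finset.prod_ne_zero_iff.2 fun i _ => NeZero.ne (q i)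
  conv_lhs => rw [← prod_compl_mul_prod hprod J, Nat.cast_mul]
  exact Int.mul_ediv_cancel_left _ (by exact_mod_cast h)

include hcop hprod in
lemma mem_X_of_eq_decode (hq2 : ∀ i, 2 < q i) (h0 : 0 < b) (hlt : b < m)
    (hb : ∀ i, (b : ZMod (q i)) = g i * baseVec q J i) : b ∈ X m := by
  refine ⟨h0, hlt, ?_⟩
  rw [gcd_of_eq_decode hcop hprod hq2 hb, modulus_ediv_prod hprod, ← Int.isCoprime_iff_gcd_eq_one,
    Nat.cast_prod]
  exact IsCoprime.prod_right fun i hi => isCoprime_of_eq_decode hcop hb hi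

include hcop in
lemma modEq_gcd_iff {i : ι} (hb : ∀ i, (b : ZMod (q i)) = g i * baseVec q J i) :
    b ≡ ((∏ i ∈ Jᶜ, q i : ℕ) : ℤ) [ZMOD q i] ↔ (i ∈ J → g i = 1) := by
  rw [← ZMod.intCast_eq_intCast_iff, hb, Int.cast_natCast]
  change _ * baseVec q J i = baseVec q J i ↔ _
  by_cases hi : i ∈ J
  · rw [(isUnit_baseVec hcop hi).mul_eq_right, Units.val_eq_one]
    simp [hi]
  · simp [hi, baseVec_of_notMem hi]

include hcop in
lemma modEq_neg_gcd_iff {i : ι} (hi : i ∈ J)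
    (hb : ∀ i, (b : ZMod (q i)) = g i * baseVec q J i) :
    b ≡ -((∏ i ∈ Jᶜ, q i : ℕ) : ℤ) [ZMOD q i] ↔ g i = -1 := by
  rw [← ZMod.intCast_eq_intCast_iff, hb, Int.cast_neg, Int.cast_natCast]
  change _ * baseVec q J i = -baseVec q J i ↔ _
  rw [← neg_one_mul, (isUnit_baseVec hcop hi).mul_left_inj, ← Units.val_one, ← Units.val_neg,
    Units.val_inj]

include hcop hprod in
lemma dvd_modulus_iff_of_eq_decode (hq2 : ∀ i, 2 < q i) (h0 : 0 < b) (hlt : b < m)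
    (hb : ∀ i, (b : ZMod (q i)) = g i * baseVec q J i) : b ∣ m ↔ ∀ i ∈ J, g i = 1 := by
  have hgcd := gcd_of_eq_decode hcop hprod hq2 hb
  constructor
  · intro h i
    rw [← modEq_gcd_iff hcop hb, ← hgcd, Int.gcd_eq_natAbs_left h, Int.natCast_natAbs,
      abs_of_pos h0]
  · intro h
    have h1 : (b : ZMod m) = (((∏ i ∈ Jᶜ, q i : ℕ) : ℤ) : ZMod m) := by
      rw [intCast_eq_intCast_iff_forall hcop hprod]
      intro i
      rw [ZMod.intCast_eq_intCast_iff, modEq_gcd_iff hcop hb]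
      exact h i
    rw [ZMod.intCast_eq_intCast_iff, ← hgcd] at h1
    have h2 : ((Int.gcd b m : ℕ) : ℤ) ≤ b := Int.le_of_dvd h0 (Int.gcd_dvd_left ..)
    have h3 : b = (Int.gcd b m : ℕ) := by
      have h4 := Int.emod_eq_of_lt h0.le hlt
      have h5 := Int.emod_eq_of_lt (Int.natCast_nonneg (Int.gcd b m)) (h2.trans_lt hlt)
      exact h4.symm.trans (Eq.trans h1 h5)
    rw [h3]
    exact Int.gcd_dvd_right ..

include hcop hprod in
lemma fract_lt_iff_of_eq_decode (hq2 : ∀ i, 2 < q i) {k : ι} (hk : k ∈ J)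
    (hb : ∀ i, (b : ZMod (q i)) = g i * baseVec q J i) :
    Int.fract ((b : ℚ) / ((Int.gcd b m : ℚ) * q k)) < 1 / 2 ↔ g k ∈ firstHalf q k := by
  obtain ⟨c, hc⟩ : ((Int.gcd b m : ℕ) : ℤ) ∣ b := Int.gcd_dvd_left ..
  have hgcd := gcd_of_eq_decode hcop hprod hq2 hb
  have hd : (Int.gcd b m : ℚ) ≠ 0 := by
    rw [hgcd]
    exact_mod_cast Finset.prod_ne_zero_iff.2 fun i _ => NeZero.ne (q i)
  have hq0 : (0 : ℚ) < q k := by exact_mod_cast NeZero.pos (q k)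
  have h1 : (c : ZMod (q k)) = g k := by
    have h2 := hb k
    rw [hc, hgcd, Int.cast_mul, Int.cast_natCast, mul_comm] at h2
    exact (isUnit_baseVec hcop hk).mul_left_inj.1 h2
  have h3 : (b : ℚ) / ((Int.gcd b m : ℚ) * q k) = (c : ℚ) / q k := by
    have h4 : (b : ℚ) = (Int.gcd b m : ℚ) * c := by exact_mod_cast hc
    rw [h4, mul_div_mul_left _ _ hd]
  rw [h3, fract_eq_frac, h1, frac, firstHalf, Finset.mem_filter, div_lt_iff₀ hq0]
  constructor
  · intro h
    refine ⟨Finset.mem_univ _, ?_⟩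
    have : (2 * (g k : ZMod (q k)).val : ℚ) < q k := by linarith
    exact_mod_cast this
  · intro h
    have : (2 * (g k : ZMod (q k)).val : ℚ) < q k := by exact_mod_cast h.2
    linarith

-- The dictionary between the arithmetic conditions of `M` and `IsBasic`: here `(b, m)` is the
-- product of the `q i` with `i ∉ J`, so `b ≡ ±(b, m)` modulo `q i` means `g i = ±1`, and the
-- fractional part condition says that `g k` lies in the first half.
include hcop hprod in
lemma mem_M_iff (hq2 : ∀ i, 2 < q i) (h0 : 0 < b) (hlt : b < m)
    (hb : ∀ i, (b : ZMod (q i)) = g i * baseVec q J i) :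
    b ∈ M m q ↔ IsBasic (-1) (firstHalf q) J g := by
  have hgcd := gcd_of_eq_decode hcop hprod hq2 hb
  have hdvd := dvd_iff_of_eq_decode hcop hq2 hb
  have hm := dvd_modulus_iff_of_eq_decode hcop hprod hq2 h0 hlt hb
  have hset : {i | ¬ b ≡ (Int.gcd b m : ℤ) [ZMOD q i]} = {i | i ∈ J ∧ g i ≠ 1} := by
    ext i
    change ¬ _ ↔ i ∈ J ∧ g i ≠ 1
    rw [hgcd, modEq_gcd_iff hcop hb]
    tauto
  have hset2 : {i | ¬ (q i : ℤ) ∣ b} = (J : Set ι) := by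
    ext i
    simp [hdvd]
  have hneg : (∀ i, ¬ (q i : ℤ) ∣ b → ¬ b ≡ -(Int.gcd b m : ℤ) [ZMOD q i]) ↔
      ∀ i ∈ J, g i ≠ (-1 : ∀ i, (ZMod (q i))ˣ) i := by
    refine forall_congr' fun i => ?_
    rw [hdvd, not_not]
    refine forall_congr' fun hi => ?_
    rw [hgcd, modEq_neg_gcd_iff hcop hi hb]
    rfl
  rw [M, Set.mem_ofPred_eq, hneg, hset, hset2, Set.ncard_coe_finset, hm, IsBasic]
  constructor
  · rintro ⟨-, h1, h2, h3⟩
    refine ⟨h1, ?_⟩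
    by_cases h : ∀ i ∈ J, g i = 1
    · exact Or.inr ⟨h, h3 h⟩
    · left
      have hne : (J.filter fun i => g i ≠ 1).Nonempty := by
        push Not at h
        obtain ⟨i, hi, hi'⟩ := h
        exact ⟨i, Finset.mem_filter.2 ⟨hi, hi'⟩⟩
      have hk := Finset.max'_mem _ hne
      set k := (J.filter fun i => g i ≠ 1).max' hne with hkdef
      rw [Finset.mem_filter] at hk
      have hgr : IsGreatest {i | i ∈ J ∧ g i ≠ 1} k :=
        ⟨hk, fun i (hi : i ∈ J ∧ g i ≠ 1) => Finset.le_max' _ _ (Finset.mem_filter.2 hi)⟩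
      refine ⟨k, hk.1, hk.2, (fract_lt_iff_of_eq_decode hcop hprod hq2 hk.1 hb).1 (h2 h k hgr),
        fun i hi hki => ?_⟩
      by_contra hgi
      exact absurd (hgr.2 ⟨hi, hgi⟩) (not_le.2 hki)
  · rintro ⟨h1, h2⟩
    refine ⟨mem_X_of_eq_decode hcop hprod hq2 h0 hlt hb, h1, fun h k hk => ?_, fun h => ?_⟩
    · rcases h2 with ⟨k', hk', hk1, hkH, hmax⟩ | h2
      · have hle := hk.2 ⟨hk', hk1⟩
        rcases hle.eq_or_lt with rfl | hlt'
        · exact (fract_lt_iff_of_eq_decode hcop hprod hq2 hk' hb).2 hkH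
        · exact absurd (hmax k hk.1.1 hlt') hk.1.2
      · exact absurd h2.1 h
    · rcases h2 with ⟨k, hk, hk1, -⟩ | h2
      · exact absurd (h k hk) hk1
      · exact h2.2

end

-- If `p_i` divides `a`, then it cannot divide `m / (a, m)`; so the whole `q i` divides `(a, m)`,
-- and hence `a`.
include hcop hprod in
lemma isCoprime_of_mem_X (hq : ∀ i, IsPrimePow (q i)) {a : ℤ} (ha : a ∈ X m) {i : ι}
    (hi : ¬ (q i : ℤ) ∣ a) : IsCoprime a (q i) := by
  obtain ⟨hp, e, he, hqe⟩ := exists_eq_pow (hq i)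
  rw [Int.isCoprime_iff_gcd_eq_one, Int.gcd, Int.natAbs_natCast]
  change Nat.Coprime _ _
  rw [coprime_iff_not_minFac_dvd (hq i)]
  intro hpa
  obtain ⟨-, -, h⟩ := ha
  set d := Int.gcd a m with hd
  have hdm : d ∣ m := by exact_mod_cast Int.gcd_dvd_right (a := a) (b := m)
  have hda : (d : ℤ) ∣ a := Int.gcd_dvd_left ..
  have h1 : ¬ (q i).minFac ∣ m / d := by
    intro h2
    have h3 : ((q i).minFac : ℤ) ∣ Int.gcd a ((m : ℤ) / d) := by
      refine Int.dvd_coe_gcd (Int.natCast_dvd.2 hpa) ?_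
      exact_mod_cast h2
    rw [h] at h3
    exact hp.one_lt.ne' (Nat.dvd_one.1 (Int.natCast_dvd_natCast.1 h3))
  have h2 : Nat.Coprime (q i) (m / d) := ((coprime_iff_not_minFac_dvd (hq i) _).2 h1).symm
  have h3 : q i ∣ d := h2.dvd_of_dvd_mul_right
    (by rw [Nat.mul_div_cancel' hdm]; exact dvd_modulus hprod i)
  exact hi ((Int.natCast_dvd_natCast.2 h3).trans hda)

-- Setting the coordinates outside `J'` to `-1`, a value excluded inside it for elements of `M`,
-- lets a single unit vector encode both the set and the residues.
include hcop hprod in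
lemma exists_eq_decode (hq : ∀ i, IsPrimePow (q i)) {a : ℤ} (ha : a ∈ X m) :
    ∃ g : ∀ i, (ZMod (q i))ˣ, (∀ i ∉ J' q a, g i = -1) ∧
      ∀ i, (a : ZMod (q i)) = g i * baseVec q (J' q a) i := by
  classical
  have hmem (i : ι) : i ∈ J' q a ↔ ¬ (q i : ℤ) ∣ a := by simp [J']
  have h (i : ι) : ∃ g : (ZMod (q i))ˣ, (i ∉ J' q a → g = -1) ∧
      (a : ZMod (q i)) = g * baseVec q (J' q a) i := by
    by_cases hi : i ∈ J' q a
    · have h1 : IsUnit (a : ZMod (q i)) := by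
        rw [ZMod.coe_int_isUnit_iff_isCoprime, isCoprime_comm]
        exact isCoprime_of_mem_X hcop hprod hq ha ((hmem i).1 hi)
      have h2 := isUnit_baseVec hcop hi
      refine ⟨h1.unit * h2.unit⁻¹, fun h => absurd hi h, ?_⟩
      rw [Units.val_mul, mul_assoc, IsUnit.val_inv_mul, mul_one]
      rfl
    · refine ⟨-1, fun _ => rfl, ?_⟩
      rw [baseVec_of_notMem hi, mul_zero, ZMod.intCast_zmod_eq_zero_iff_dvd]
      exact not_not.1 (fun h => hi ((hmem i).2 h))
  choose g hg using h
  exact ⟨g, fun i => (hg i).1, fun i => (hg i).2⟩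

end Representatives

end

/-! ### Counting `M'` by a sign change. -/

section

section Counting

variable {ι : Type} [Fintype ι] [LinearOrder ι] {m : ℕ} [NeZero m] {q : ι → ℕ}
  [∀ i, NeZero (q i)]

lemma neg_one_ne_one_units (hq2 : ∀ i, 2 < q i) (i : ι) : (-1 : (ZMod (q i))ˣ) ≠ 1 := by
  have : Fact (2 < q i) := ⟨hq2 i⟩
  intro h
  exact ZMod.neg_one_ne_one (n := q i) (by simpa using congrArg Units.val h)

lemma neg_mem_firstHalf_iff (hq2 : ∀ i, 2 < q i) {i : ι} (u : (ZMod (q i))ˣ) :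
    -u ∈ firstHalf q i ↔ u ∉ firstHalf q i := by
  rw [← neg_mem_firstHalf hq2 i u, Pi.neg_apply, Pi.one_apply, neg_one_mul]

lemma neg_one_notMem_firstHalf (hq2 : ∀ i, 2 < q i) (i : ι) : -1 ∉ firstHalf q i := by
  rw [neg_mem_firstHalf_iff hq2, not_not]
  exact one_mem_firstHalf hq2 i

lemma card_firstHalf (hq2 : ∀ i, 2 < q i) (i : ι) :
    (firstHalf q i).card = (q i).totient / 2 := by
  have h1 : (firstHalf q i).card = (firstHalf q i)ᶜ.card :=
    Finset.card_bij (fun u _ => -u)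
      (fun u hu => by rw [Finset.mem_compl, neg_mem_firstHalf_iff hq2, not_not]; exact hu)
      (fun _ _ _ _ h => neg_injective h)
      (fun u hu => ⟨-u, by rw [neg_mem_firstHalf_iff hq2]; exact Finset.mem_compl.1 hu, neg_neg u⟩)
  have h2 := Finset.card_add_card_compl (firstHalf q i)
  rw [← h1, ZMod.card_units_eq_totient] at h2
  omega

/-- The set of coordinates different from `-1`. -/
def supp (u : ∀ i, (ZMod (q i))ˣ) : Finset ι := Finset.univ.filter fun i => u i ≠ -1

/-- The set of coordinates different from `1` and `-1`. -/
def nontriv (u : ∀ i, (ZMod (q i))ˣ) : Finset ι := Finset.univ.filter fun i => u i ≠ 1 ∧ u i ≠ -1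

/-- The last element of a finite set, or a given element if the set is empty. -/
def lastIdx (i₀ : ι) (s : Finset ι) : ι := if h : s.Nonempty then s.max' h else i₀

lemma lastIdx_mem (i₀ : ι) {s : Finset ι} (h : s.Nonempty) : lastIdx i₀ s ∈ s := by
  rw [lastIdx, dif_pos h]
  exact Finset.max'_mem _ h

lemma le_lastIdx (i₀ : ι) {s : Finset ι} {i : ι} (hi : i ∈ s) : i ≤ lastIdx i₀ s := by
  rw [lastIdx, dif_pos ⟨i, hi⟩]
  exact Finset.le_max' _ _ hi

/-- Change of the sign of the last nontrivial coordinate, or of a given one. -/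
def signFlip (i₀ : ι) (u : ∀ i, (ZMod (q i))ˣ) : ∀ i, (ZMod (q i))ˣ :=
  Function.update u (lastIdx i₀ (nontriv u)) (-u (lastIdx i₀ (nontriv u)))

lemma nontriv_update_neg (u : ∀ i, (ZMod (q i))ˣ) (i : ι) :
    nontriv (Function.update u i (-u i)) = nontriv u := by
  ext j
  simp only [nontriv, Finset.mem_filter, Finset.mem_univ, true_and]
  by_cases hj : j = i
  · subst hj
    rw [Function.update_self, ne_eq, neg_eq_iff_eq_neg, ne_eq, neg_inj]
    tauto
  · rw [Function.update_of_ne hj]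

lemma nontriv_signFlip (i₀ : ι) (u : ∀ i, (ZMod (q i))ˣ) :
    nontriv (signFlip i₀ u) = nontriv u :=
  nontriv_update_neg u _

lemma signFlip_signFlip (i₀ : ι) (u : ∀ i, (ZMod (q i))ˣ) : signFlip i₀ (signFlip i₀ u) = u := by
  rw [signFlip, nontriv_signFlip, signFlip]
  simp

/-- If some coordinate differs from `±1`, negating the last such coordinate moves it out of the
first half. If all are `±1`, changing the sign at `i₀` alters the size of the support by one, hence
its parity. So basic vectors are at most half of all vectors. -/
lemma not_isBasic_signFlip (hq2 : ∀ i, 2 < q i) (i₀ : ι) {u : ∀ i, (ZMod (q i))ˣ}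
    (hu : IsBasic (-1) (firstHalf q) (supp u) u) :
    ¬ IsBasic (-1) (firstHalf q) (supp (signFlip i₀ u)) (signFlip i₀ u) := by
  have hlast {u : ∀ i, (ZMod (q i))ˣ} (hu : IsBasic (-1) (firstHalf q) (supp u) u)
      (h : (nontriv u).Nonempty) : u (lastIdx i₀ (nontriv u)) ∈ firstHalf q (lastIdx i₀ (nontriv u)) := by
    have hmem := lastIdx_mem i₀ h
    have hle (i : ι) (hi : i ∈ nontriv u) := le_lastIdx i₀ hi
    set k := lastIdx i₀ (nontriv u)
    have hk : u k ≠ 1 ∧ u k ≠ -1 := (Finset.mem_filter.1 hmem).2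
    have hks : k ∈ supp u := Finset.mem_filter.2 ⟨Finset.mem_univ _, hk.2⟩
    rcases hu.2 with ⟨k', hk', hk1, hkH, hmax⟩ | h2
    · have h3 : k' ∈ nontriv u :=
        Finset.mem_filter.2 ⟨Finset.mem_univ _, hk1, (Finset.mem_filter.1 hk').2⟩
      rcases (hle k' h3).eq_or_lt with h4 | h4
      · rw [← h4]
        exact hkH
      · exact absurd (hmax k hks h4) hk.1
    · exact absurd (h2.1 k hks) hk.1
  have hodd {u : ∀ i, (ZMod (q i))ˣ} (hu : IsBasic (-1) (firstHalf q) (supp u) u)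
      (h : ¬ (nontriv u).Nonempty) : Odd (supp u).card := by
    rcases hu.2 with ⟨k', hk', hk1, -⟩ | h2
    · exact absurd ⟨k', Finset.mem_filter.2
        ⟨Finset.mem_univ _, hk1, (Finset.mem_filter.1 hk').2⟩⟩ h
    · exact h2.2
  intro hf
  have hnt := nontriv_signFlip i₀ u
  by_cases h : (nontriv u).Nonempty
  · have h1 := hlast hu h
    have h2 := hlast hf (by rwa [hnt])
    rw [hnt] at h2
    have h3 : signFlip i₀ u (lastIdx i₀ (nontriv u)) = -u (lastIdx i₀ (nontriv u)) := by
      rw [signFlip, Function.update_self]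
    rw [h3, neg_mem_firstHalf_iff hq2] at h2
    exact h2 h1
  · have h1 := hodd hu h
    have h2 := hodd hf (by rwa [hnt])
    rw [signFlip, lastIdx, dif_neg h] at h2
    have h3 : u i₀ = 1 ∨ u i₀ = -1 := by
      by_contra! h4
      exact h ⟨i₀, Finset.mem_filter.2 ⟨Finset.mem_univ _, h4⟩⟩
    have hne := neg_one_ne_one_units hq2 i₀
    have hrest (j : ι) (hj : j ≠ i₀) (x : (ZMod (q i₀))ˣ) :
        j ∈ supp (Function.update u i₀ x) ↔ j ∈ supp u := by
      rw [supp, supp, Finset.mem_filter, Finset.mem_filter, Function.update_of_ne hj]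
    rcases h3 with h3 | h3
    · have h4 : supp u = insert i₀ (supp (Function.update u i₀ (-u i₀))) := by
        ext j
        rw [Finset.mem_insert]
        by_cases hj : j = i₀
        · subst hj
          simp [supp, h3, hne.symm]
        · rw [hrest j hj]
          simp [hj]
      rw [h4, Finset.card_insert_of_notMem (by simp [supp, h3])] at h1
      rw [Nat.odd_add_one] at h1
      exact h1 h2
    · have h4 : supp (Function.update u i₀ (-u i₀)) = insert i₀ (supp u) := by
        ext j
        rw [Finset.mem_insert]
        by_cases hj : j = i₀
        · subst hj
          simp [supp, h3, hne.symm]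
        · rw [hrest j hj]
          simp [hj]
      rw [h4, Finset.card_insert_of_notMem (by simp [supp, h3])] at h2
      rw [Nat.odd_add_one] at h2
      exact h2 h1

variable (hcop : Pairwise fun i j => (q i).Coprime (q j)) (hprod : m = ∏ i, q i)

variable (q) in
/-- The set of vectors that are basic on their support. -/
def basicVec : Finset (∀ i, (ZMod (q i))ˣ) :=
  open Classical in Finset.univ.filter fun u => IsBasic (-1) (firstHalf q) (supp u) u

lemma mem_basicVec {u : ∀ i, (ZMod (q i))ˣ} :
    u ∈ basicVec q ↔ IsBasic (-1) (firstHalf q) (supp u) u := by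
  simp [basicVec]

include hcop hprod in
lemma card_basicVec_le [Nonempty ι] (hq2 : ∀ i, 2 < q i) :
    (basicVec q).card ≤ m.totient / 2 := by
  obtain ⟨i₀⟩ := ‹Nonempty ι›
  have h1 : ((basicVec q).image (signFlip i₀)).card = (basicVec q).card :=
    Finset.card_image_of_injective _ (Function.LeftInverse.injective (signFlip_signFlip i₀))
  have h2 : Disjoint (basicVec q) ((basicVec q).image (signFlip i₀)) := by
    rw [Finset.disjoint_left]
    intro u hu hu'
    obtain ⟨v, hv, rfl⟩ := Finset.mem_image.1 hu'
    exact not_isBasic_signFlip hq2 i₀ (mem_basicVec.1 hv) (mem_basicVec.1 hu)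
  have h3 := Finset.card_le_univ (basicVec q ∪ (basicVec q).image (signFlip i₀))
  rw [Finset.card_union_of_disjoint h2, h1, ← Fintype.card_congr (unitsCrt hcop hprod).toEquiv,
    ZMod.card_units_eq_totient] at h3
  omega

/-- The elements `mb/q_i` of `M'` replace the elements of `M` of level `{i}`; this numbering matches
them with the first half of the units, which has the same size. -/
lemma exists_enumeration (hq2 : ∀ i, 2 < q i) (i : ι) : ∃ f : (ZMod (q i))ˣ → ℕ,
    ∀ b, 1 ≤ b → b ≤ (q i).totient / 2 → ∃ u ∈ firstHalf q i, f u = b := by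
  classical
  have h : (firstHalf q i).card = (Finset.Icc 1 ((q i).totient / 2)).card := by
    rw [card_firstHalf hq2]
    simp
  let e := Finset.equivOfCardEq h
  refine ⟨fun u => if hu : u ∈ firstHalf q i then e ⟨u, hu⟩ else 0, fun b h1 h2 => ?_⟩
  refine ⟨e.symm ⟨b, Finset.mem_Icc.2 ⟨h1, h2⟩⟩, (e.symm _).2, ?_⟩
  simp

include hprod in
lemma prod_compl_singleton (j : ι) : ∏ i ∈ {j}ᶜ, q i = m / q j := by
  rw [← prod_compl_mul_prod hprod {j}, Finset.prod_singleton,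
    Nat.mul_div_cancel _ (NeZero.pos (q j))]

include hcop hprod in
lemma exists_isBasic_of_mem_M (hq : ∀ i, IsPrimePow (q i)) (hq2 : ∀ i, 2 < q i) {a : ℤ}
    (ha : a ∈ M m q) : ∃ u : ∀ i, (ZMod (q i))ˣ, supp u = J' q a ∧
      IsBasic (-1) (firstHalf q) (supp u) u ∧
      ∀ i, (a : ZMod (q i)) = u i * baseVec q (supp u) i := by
  obtain ⟨u, hu, hau⟩ := exists_eq_decode hcop hprod hq ha.1
  have hb := (mem_M_iff hcop hprod hq2 ha.1.1 ha.1.2.1 hau).1 ha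
  have hs : supp u = J' q a := by
    ext i
    rw [supp, Finset.mem_filter]
    constructor
    · rintro ⟨-, h⟩
      by_contra hi
      exact h (hu i hi)
    · exact fun hi => ⟨Finset.mem_univ _, hb.1 i hi⟩
  exact ⟨u, hs, by rwa [hs], by rwa [hs]⟩

include hcop hprod in
/-- The set `M'` has at most `φ(m)/2` elements. -/
theorem finite_M'_and_ncard_le [Nonempty ι] (hq : ∀ i, IsPrimePow (q i)) (hq2 : ∀ i, 2 < q i) :
    (M' m q).Finite ∧ (M' m q).ncard ≤ m.totient / 2 := by
  classical
  choose f hf using exists_enumeration hq2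
  -- Vectors supported on one index `j` (which `choose` recovers, being unique) are sent to the
  -- multiples of `m / q j`, all others to the class that they encode. The image of the basic
  -- vectors covers `M'`.
  let dec : (∀ i, (ZMod (q i))ˣ) → ℤ := fun u =>
    if h : ∃ j, supp u = {j} then ((m / q h.choose * f _ (u h.choose) : ℕ) : ℤ)
    else (decode hcop hprod (supp u) u).val
  have hsub : M' m q ⊆ ((basicVec q).image dec : Finset ℤ) := by
    rintro a (⟨ha, ha'⟩ | ha)
    · obtain ⟨u, hs, hb, hau⟩ := exists_isBasic_of_mem_M hcop hprod hq hq2 ha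
      rw [Finset.coe_image]
      refine ⟨u, mem_basicVec.2 hb, ?_⟩
      have hns : ¬ ∃ j, supp u = {j} := by
        rintro ⟨j, hj⟩
        refine ha' j ?_
        have h := gcd_of_eq_decode hcop hprod hq2 hau
        rw [hj, prod_compl_singleton hprod] at h
        rw [← h]
        exact Int.gcd_dvd_left ..
      have h1 : (a : ZMod m) = decode hcop hprod (supp u) u :=
        (intCast_eq_iff hcop hprod _ _).2 hau
      simp only [dec, dif_neg hns]
      rw [← h1, ZMod.val_intCast, Int.emod_eq_of_lt ha.1.1.le ha.1.2.1]
    · obtain ⟨j, b, hb1, hb2, rfl⟩ := Set.mem_iUnion.1 ha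
      obtain ⟨v, hv, hvb⟩ := hf j b hb1 hb2
      have hv1 : v ≠ -1 := by
        rintro rfl
        exact neg_one_notMem_firstHalf hq2 j hv
      set u : ∀ i, (ZMod (q i))ˣ := Function.update (-1) j v with hu
      have hs : supp u = {j} := by
        ext i
        rw [supp, Finset.mem_filter, Finset.mem_singleton]
        by_cases hi : i = j
        · subst hi
          simp [hu, hv1]
        · simp [hu, hi]
      have huj : u j = v := Function.update_self ..
      rw [Finset.coe_image]
      refine ⟨u, mem_basicVec.2 ?_, ?_⟩
      · rw [hs]
        refine ⟨fun i hi => ?_, ?_⟩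
        · rw [Finset.mem_singleton.1 hi, huj]
          exact hv1
        · by_cases hv2 : v = 1
          · right
            refine ⟨fun i hi => ?_, by simp⟩
            rw [Finset.mem_singleton.1 hi, huj, hv2]
          · refine Or.inl ⟨j, Finset.mem_singleton_self j, by rwa [huj], by rwa [huj],
              fun i hi hij => ?_⟩
            exact absurd (Finset.mem_singleton.1 hi) hij.ne'
      · have hex : ∃ j, supp u = {j} := ⟨j, hs⟩
        have hch : hex.choose = j := by
          exact (Finset.singleton_injective (hs.symm.trans hex.choose_spec)).symm
        simp only [dec, dif_pos hex]
        have key (k : ι) (hk : k = j) : m / q k * f k (u k) = m / q j * b := by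
          subst hk
          rw [huj, hvb]
        rw [key _ hch]
  refine ⟨(Finset.finite_toSet _).subset hsub, ?_⟩
  refine (Set.ncard_le_ncard hsub (Finset.finite_toSet _)).trans ?_
  rw [Set.ncard_coe_finset]
  exact Finset.card_image_le.trans (card_basicVec_le hcop hprod hq2)

end Counting

end

/-! ### Shortness and integrality of the elements `alpha`. -/

section

section Alpha

variable {ι : Type} [Fintype ι] [LinearOrder ι] {m : ℕ} [NeZero m] {q : ι → ℕ}
  [∀ i, NeZero (q i)]

variable (hcop : Pairwise fun i j => (q i).Coprime (q j)) (hprod : m = ∏ i, q i)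

lemma mem_J'_iff {b : ℤ} {i : ι} : i ∈ J' q b ↔ (b : ZMod (q i)) ≠ 0 := by
  rw [J', Finset.mem_filter, Ne, ZMod.intCast_zmod_eq_zero_iff_dvd]
  simp

include hcop hprod in
lemma intCast_eq_zero_iff_forall (b : ℤ) : (b : ZMod m) = 0 ↔ ∀ i, (b : ZMod (q i)) = 0 := by
  simpa using intCast_eq_intCast_iff_forall hcop hprod b 0

lemma intCast_ne_zero_of_lt {b : ℤ} (h0 : 0 < b) (hlt : b < m) : (b : ZMod m) ≠ 0 := by
  rw [Ne, ZMod.intCast_zmod_eq_zero_iff_dvd]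
  exact fun h => absurd (Int.le_of_dvd h0 h) (not_le.2 hlt)

include hcop hprod in
lemma J'_nonempty {b : ℤ} (h0 : (b : ZMod m) ≠ 0) : (J' q b).Nonempty := by
  by_contra h
  rw [Finset.not_nonempty_iff_eq_empty] at h
  refine h0 ((intCast_eq_zero_iff_forall hcop hprod b).2 fun i => ?_)
  by_contra hi
  have := mem_J'_iff.2 hi
  simp [h] at this

-- The Bézout identity splits `-b` into `c`, which vanishes modulo `q j` and is `-b` modulo the
-- other `q i`, and `d`, which lives at `j` alone. Thus `c` and `d` have lower level than `b`.
include hcop hprod in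
lemma exists_alpha_eq {b : ℤ} (h : 1 < (J' q b).card) : ∃ c d : ℤ, ∃ j ∈ J' q b,
    galRing m (alpha m q b) = unitTheta (b : ZMod m) + unitTheta (c : ZMod m)
      + unitTheta (d : ZMod m) - unitNorm m ∧
    (b : ZMod m) + c + d = 0 ∧
    (∀ i, i ≠ j → (c : ZMod (q i)) = -b) ∧ (c : ZMod (q j)) = 0 := by
  have hne : (J' q b).Nonempty := Finset.card_pos.1 (by omega)
  set j := (J' q b).min' hne with hj
  have hjm : j ∈ J' q b := Finset.min'_mem _ _
  have hrad : rad q b = ∏ i ∈ (J' q b)ᶜ, q i := by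
    rw [rad]
    refine Finset.prod_congr ?_ fun _ _ => rfl
    ext i
    simp [J']
  have hv : m / (q j * rad q b) = ∏ i ∈ (J' q b).erase j, q i := by
    have h1 := prod_compl_mul_prod hprod (J' q b)
    rw [← Finset.mul_prod_erase _ _ hjm, ← hrad, ← mul_assoc, mul_comm (rad q b)] at h1
    conv_lhs => rw [← h1]
    refine Nat.mul_div_cancel_left _ (Nat.pos_of_ne_zero ?_)
    intro h2
    exact NeZero.ne m (by rw [← h1, h2, zero_mul])
  have hc : Nat.Coprime (q j) (m / (q j * rad q b)) := by
    rw [hv]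
    exact Nat.Coprime.prod_right fun i hi => hcop (Finset.ne_of_mem_erase hi).symm
  have hg := Nat.gcd_eq_gcd_ab (q j) (m / (q j * rad q b))
  rw [Nat.coprime_iff_gcd_eq_one.1 hc] at hg
  set v := m / (q j * rad q b) with hvdef
  set A := Nat.gcdA (q j) v
  set B := Nat.gcdB (q j) v
  refine ⟨b * q j * -A, b * v * -B, j, hjm, ?_, ?_, ?_, ?_⟩
  · rw [← galRing_theta, ← galRing_theta, ← galRing_theta, ← galRing_normElt, ← map_add, ← map_add,
      ← map_sub]
    congr 1
    simp only [alpha, dif_pos hne, if_pos h]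
    rfl
  · have hg' := congrArg (Int.cast : ℤ → ZMod m) hg
    push_cast at hg' ⊢
    linear_combination (b : ZMod m) * hg'
  · intro i hi
    have hg' := congrArg (Int.cast : ℤ → ZMod (q i)) hg
    -- For `i ≠ j`, `q i` divides `v` if `i` lies in `J'`, and divides `b` otherwise.
    have hbv : (b : ZMod (q i)) * v = 0 := by
      by_cases hib : i ∈ J' q b
      · have : (v : ZMod (q i)) = 0 := by
          rw [hv, ZMod.natCast_eq_zero_iff]
          exact Finset.dvd_prod_of_mem q (Finset.mem_erase.2 ⟨hi, hib⟩)
        rw [this, mul_zero]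
      · rw [mem_J'_iff, not_not] at hib
        rw [hib, zero_mul]
    push_cast at hg' ⊢
    linear_combination (b : ZMod (q i)) * hg' + B * hbv
  · push_cast
    rw [ZMod.natCast_self]
    ring

lemma galRing_alpha_of_ne {b : ℤ} {j : ι} (hJ : J' q b = {j}) (hb : b ≠ ((m / q j : ℕ) : ℤ)) :
    galRing m (alpha m q b) = unitTheta (-b : ZMod m) + unitTheta (b - (m / q j : ℕ) : ZMod m)
      + unitTheta ((m / q j : ℕ) : ZMod m) - unitNorm m := by
  have h (s : Finset ι) (hs : s = {j}) (hne : s.Nonempty) : s.min' hne = j := by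
    subst hs
    simp
  have hne : (J' q b).Nonempty := by simp [hJ]
  have hcard : ¬ 1 < (J' q b).card := by simp [hJ]
  simp only [alpha, dif_pos hne, if_neg hcard, h _ hJ, if_neg hb, map_add, map_sub, galRing_theta,
    galRing_normElt, Int.cast_neg, Int.cast_sub, Int.cast_natCast]

lemma galRing_alpha_base {j : ι} (hJ : J' q ((m / q j : ℕ) : ℤ) = {j}) :
    galRing m (alpha m q ((m / q j : ℕ) : ℤ))
      = 2 • unitTheta ((m / q j * ((q j).totient / 2) : ℕ) : ZMod m)
        + unitTheta ((m / (q j).minFac : ℕ) : ZMod m) - unitNorm m := by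
  have h (s : Finset ι) (hs : s = {j}) (hne : s.Nonempty) : s.min' hne = j := by
    subst hs
    simp
  have hne : (J' q ((m / q j : ℕ) : ℤ)).Nonempty := hJ ▸ Finset.singleton_nonempty j
  have hcard : ¬ 1 < (J' q ((m / q j : ℕ) : ℤ)).card := by rw [hJ]; simp
  rw [← Int.cast_natCast (m / q j * ((q j).totient / 2)), ← Int.cast_natCast (m / (q j).minFac),
    ← galRing_theta, ← galRing_theta, ← galRing_normElt, ← map_nsmul, ← map_add, ← map_sub]
  congr 1
  simp only [alpha, dif_pos hne, if_neg hcard, h _ hJ, if_true]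

lemma coeff_eq_zero_or_one {x y z : ZMod m} (h : x + y + z = 0) (hx : x ≠ 0) (u : (ZMod m)ˣ) :
    (unitTheta x + unitTheta y + unitTheta z - unitNorm m).coeff u = 0 ∨
      (unitTheta x + unitTheta y + unitTheta z - unitNorm m).coeff u = 1 := by
  simp only [MonoidAlgebra.coeff_sub, MonoidAlgebra.coeff_add, Finsupp.sub_apply, Finsupp.add_apply,
    coeff_unitTheta, coeff_unitNorm]
  refine frac_add_frac_add_frac ?_ ?_
  · linear_combination (-((u⁻¹ : (ZMod m)ˣ) : ZMod m)) * h
  · simpa using hx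

/-- It makes the three arguments of `α(m/q_j)` add up to `m`, and it measures the gap between the
two ranges treated in `psiSingle_mem_of_mul_mem`. -/
lemma exists_totient_eq {n : ℕ} (hn : IsPrimePow n) (hn2 : 2 < n) :
    2 * (n.totient / 2) + n / n.minFac = n := by
  have h2 := Nat.totient_even hn2
  rw [Nat.two_mul_div_two_of_even h2]
  obtain ⟨hp, e, he, hne⟩ := exists_eq_pow hn
  set p := n.minFac
  obtain ⟨e, rfl⟩ := Nat.exists_eq_succ_of_ne_zero he.ne'
  rw [hne, Nat.totient_prime_pow_succ hp, pow_succ, Nat.mul_div_cancel _ hp.pos]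
  obtain ⟨k, hk⟩ := Nat.exists_eq_succ_of_ne_zero hp.ne_zero
  rw [hk, Nat.succ_sub_one]
  simp only [Nat.succ_eq_add_one]
  ring

lemma two_mul_half_totient_lt {n : ℕ} (hn2 : 2 < n) : 2 * (n.totient / 2) < n :=
  (Nat.mul_div_le _ _).trans_lt (Nat.totient_lt n (by omega))

lemma half_totient_pos {n : ℕ} (hn2 : 2 < n) : 0 < n.totient / 2 := by
  have := Nat.totient_even hn2
  have := Nat.totient_pos.2 (show 0 < n by omega)
  rw [Nat.even_iff] at *
  omega

include hprod in
lemma modulus_div_pos (j : ι) : 0 < m / q j :=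
  Nat.div_pos (Nat.le_of_dvd (NeZero.pos m) (dvd_modulus hprod j)) (NeZero.pos (q j))

include hprod in
lemma modulus_div_minFac (j : ι) :
    m / (q j).minFac = m / q j * (q j / (q j).minFac) := by
  refine Nat.div_eq_of_eq_mul_left (Nat.minFac_pos _) ?_
  rw [mul_assoc, Nat.div_mul_cancel (Nat.minFac_dvd _), Nat.div_mul_cancel (dvd_modulus hprod j)]

include hprod in
lemma mul_lt_modulus {j : ι} {k : ℕ} (hk : k < q j) : m / q j * k < m :=
  calc m / q j * k < m / q j * q j := Nat.mul_lt_mul_of_pos_left hk (modulus_div_pos hprod j)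
    _ = m := Nat.div_mul_cancel (dvd_modulus hprod j)

include hcop hprod in
/-- The element `alpha b` is a combination of three elements `theta` whose arguments have
sum zero. -/
lemma exists_alpha_eq_sum (hq : ∀ i, IsPrimePow (q i)) (hq2 : ∀ i, 2 < q i) {b : ℤ} (h0 : 0 < b)
    (hlt : b < m) : ∃ x y z : ℤ, (x : ZMod m) + y + z = 0 ∧ (x : ZMod m) ≠ 0 ∧
      alpha m q b = theta m x + theta m y + theta m z - normElt m := by
  have hb := intCast_ne_zero_of_lt h0 hlt
  have hne := J'_nonempty hcop hprod hb
  have key (x y z : ℤ) (h : galRing m (alpha m q b) = unitTheta (x : ZMod m)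
      + unitTheta (y : ZMod m) + unitTheta (z : ZMod m) - unitNorm m) :
      alpha m q b = theta m x + theta m y + theta m z - normElt m := by
    refine (galRing m).injective ?_
    rw [h, map_sub, map_add, map_add, galRing_theta, galRing_theta, galRing_theta, galRing_normElt]
  by_cases h1 : 1 < (J' q b).card
  · obtain ⟨c, d, j, -, h2, h3, -⟩ := exists_alpha_eq hcop hprod h1
    exact ⟨b, c, d, h3, hb, key _ _ _ h2⟩
  · obtain ⟨j, hj⟩ := Finset.card_eq_one.1 (le_antisymm (not_lt.1 h1) (Finset.card_pos.2 hne))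
    by_cases h2 : b = ((m / q j : ℕ) : ℤ)
    · have h3 := galRing_alpha_base (h2 ▸ hj)
      rw [← h2] at h3
      set k := (q j).totient / 2
      have hk : 2 * k + q j / (q j).minFac = q j := exists_totient_eq (hq j) (hq2 j)
      have hm : m / q j * q j = m := Nat.div_mul_cancel (dvd_modulus hprod j)
      refine ⟨(m / q j * k : ℕ), (m / q j * k : ℕ), (m / (q j).minFac : ℕ), ?_, ?_, key _ _ _ ?_⟩
      · have h5 : m / q j * k + m / q j * k + m / (q j).minFac = m := by
          conv_rhs => rw [← hm]
          rw [modulus_div_minFac hprod, ← mul_add, ← mul_add, ← two_mul, hk]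
        have h6 := congrArg (Nat.cast : ℕ → ZMod m) h5
        rw [ZMod.natCast_self, Nat.cast_add, Nat.cast_add] at h6
        rwa [Int.cast_natCast, Int.cast_natCast]
      · have hpos := Nat.mul_pos (modulus_div_pos hprod j) (half_totient_pos (hq2 j))
        refine intCast_ne_zero_of_lt (by exact_mod_cast hpos) ?_
        have := two_mul_half_totient_lt (hq2 j)
        exact_mod_cast mul_lt_modulus hprod (j := j) (k := k) (by omega)
      · rw [h3, two_smul, Int.cast_natCast, Int.cast_natCast]
    · have h3 := galRing_alpha_of_ne hj h2
      refine ⟨-b, b - (m / q j : ℕ), (m / q j : ℕ), ?_, ?_, key _ _ _ ?_⟩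
      · rw [Int.cast_neg, Int.cast_sub]
        ring
      · rw [Int.cast_neg]
        exact neg_ne_zero.2 hb
      · rw [h3, Int.cast_neg, Int.cast_sub, Int.cast_natCast]

include hcop hprod in
lemma isShort_alpha (hq : ∀ i, IsPrimePow (q i)) (hq2 : ∀ i, 2 < q i) {b : ℤ} (h0 : 0 < b)
    (hlt : b < m) : IsShort (alpha m q b) := by
  obtain ⟨x, y, z, h, hx, hb⟩ := exists_alpha_eq_sum hcop hprod hq hq2 h0 hlt
  intro σ
  have h1 := coeff_eq_zero_or_one h hx (galEquiv m σ)
  rwa [← galRing_theta, ← galRing_theta, ← galRing_theta, ← galRing_normElt, ← map_add, ← map_add,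
    ← map_sub, ← hb, coeff_galRing, MulEquiv.symm_apply_apply] at h1

lemma isShort_normElt : IsShort (normElt m) := fun σ => by
  right
  have h := coeff_galRing (normElt m) (galEquiv m σ)
  rw [galRing_normElt, coeff_unitNorm, MulEquiv.symm_apply_apply] at h
  exact h.symm

lemma IsShort.mem_integralGroupRing {x : QG m} (hx : IsShort x) : x ∈ integralGroupRing m := by
  rw [mem_integralGroupRing_iff]
  intro u
  rw [coeff_galRing]
  rcases hx ((galEquiv m).symm u) with h | h
  · exact ⟨0, by simp [h]⟩
  · exact ⟨1, by simp [h]⟩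

include hcop hprod in
lemma alpha_mem_stickelbergerIdeal (hm : 1 < m) (hq : ∀ i, IsPrimePow (q i)) (hq2 : ∀ i, 2 < q i)
    {b : ℤ} (h0 : 0 < b) (hlt : b < m) : alpha m q b ∈ stickelbergerIdeal m := by
  refine AddSubgroup.mem_inf.2
    ⟨?_, (isShort_alpha hcop hprod hq hq2 h0 hlt).mem_integralGroupRing⟩
  obtain ⟨x, y, z, -, -, hb⟩ := exists_alpha_eq_sum hcop hprod hq hq2 h0 hlt
  rw [hb]
  exact sub_mem (add_mem (add_mem (theta_mem_Sprime m x) (theta_mem_Sprime m y))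
    (theta_mem_Sprime m z)) (normElt_mem_Sprime hm)

lemma normElt_mem_stickelbergerIdeal (hm : 1 < m) : normElt m ∈ stickelbergerIdeal m :=
  ⟨normElt_mem_Sprime hm, isShort_normElt.mem_integralGroupRing⟩

include hcop hprod in
lemma pos_and_lt_of_mem_M' (hq2 : ∀ i, 2 < q i) {b : ℤ}
    (hb : b ∈ M' m q) : 0 < b ∧ b < m := by
  rcases hb with ⟨hb, -⟩ | hb
  · exact ⟨hb.1.1, hb.1.2.1⟩
  · obtain ⟨j, k, hk1, hk2, rfl⟩ := Set.mem_iUnion.1 hb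
    have hlt : k < q j := by
      have := two_mul_half_totient_lt (hq2 j)
      omega
    exact ⟨by exact_mod_cast Nat.mul_pos (modulus_div_pos hprod j) hk1,
      by exact_mod_cast mul_lt_modulus hprod hlt⟩

end Alpha

end

/-! ### Generation up to `N/2` and the elements `θ(m/q_j)`. -/

section

section Generators

variable {ι : Type} [Fintype ι] [LinearOrder ι] {m : ℕ} [NeZero m] {q : ι → ℕ}
  [∀ i, NeZero (q i)]

variable (m q) in
/-- The group generated by the elements `alpha a`, `a ∈ M'`, and the norm element. -/
def alphaSpan : Submodule ℤ (UnitRing m) :=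
  Submodule.span ℤ ((fun a => galRing m (alpha m q a)) '' M' m q ∪ {unitNorm m})

lemma alpha_mem_alphaSpan {a : ℤ} (ha : a ∈ M' m q) : galRing m (alpha m q a) ∈ alphaSpan m q :=
  Submodule.subset_span (Or.inl ⟨a, ha, rfl⟩)

lemma unitNorm_mem_alphaSpan : unitNorm m ∈ alphaSpan m q := Submodule.subset_span (Or.inr rfl)

variable (m q) in
/-- The element `θ(m / q j)`. -/
def thetaBase (j : ι) : UnitRing m := unitTheta ((m / q j : ℕ) : ZMod m)

variable (m q) in
/-- The group generated by `alphaSpan`, one half of the norm element, and the elements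
`θ(m / q j)`. -/
def extSpan : Submodule ℤ (UnitRing m) :=
  alphaSpan m q ⊔ Submodule.span ℤ {halfUnitNorm m} ⊔ Submodule.span ℤ (Set.range (thetaBase m q))

lemma alphaSpan_le_extSpan : alphaSpan m q ≤ extSpan m q := le_sup_left.trans le_sup_left

lemma halfUnitNorm_mem_extSpan : halfUnitNorm m ∈ extSpan m q :=
  (le_sup_right.trans le_sup_left : Submodule.span ℤ {halfUnitNorm m} ≤ extSpan m q)
    (Submodule.mem_span_singleton_self _)

lemma thetaBase_mem_extSpan (j : ι) : thetaBase m q j ∈ extSpan m q :=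
  (le_sup_right : Submodule.span ℤ (Set.range (thetaBase m q)) ≤ extSpan m q)
    (Submodule.subset_span ⟨j, rfl⟩)

variable (hcop : Pairwise fun i j => (q i).Coprime (q j)) (hprod : m = ∏ i, q i)

include hprod in
lemma natCast_modulus_div (j i : ι) : ((m / q j : ℕ) : ZMod (q i)) = baseVec q {j} i := by
  rw [baseVec, prod_compl_singleton hprod]

include hcop hprod in
lemma J'_mul {j : ι} {k : ℕ} (hk0 : 0 < k) (hk : k < q j) :
    J' q ((m / q j * k : ℕ) : ℤ) = {j} := by
  ext i
  rw [mem_J'_iff, Finset.mem_singleton, Int.cast_natCast, Nat.cast_mul,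
    natCast_modulus_div hprod]
  by_cases hi : i = j
  · subst hi
    simp only [iff_true]
    rw [Ne, (isUnit_baseVec hcop (Finset.mem_singleton_self i)).mul_right_eq_zero,
      ZMod.natCast_eq_zero_iff]
    exact Nat.not_dvd_of_pos_of_lt hk0 hk
  · simp [baseVec_of_notMem (show i ∉ ({j} : Finset ι) by simpa using hi), hi]

lemma mul_mem_M' {j : ι} {k : ℕ} (hk0 : 1 ≤ k) (hk : k ≤ (q j).totient / 2) :
    ((m / q j * k : ℕ) : ℤ) ∈ M' m q :=
  Or.inr (Set.mem_iUnion.2 ⟨j, k, hk0, hk, rfl⟩)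

lemma modulus_div_mem_M' {j : ι} (h : 2 < q j) : ((m / q j : ℕ) : ℤ) ∈ M' m q := by
  have := mul_mem_M' (m := m) (j := j) le_rfl (half_totient_pos h)
  rwa [mul_one] at this

-- With `b = mk/q_j`, `k > 1`, and `θ(b) + θ(-b) = N`, the element `α(b)` becomes `θ(b - m/q_j) +
-- θ(m/q_j) - θ(b)`, and the sum over `k` telescopes.
include hcop hprod in
lemma unitTheta_sub_mem (hq2 : ∀ i, 2 < q i) (j : ι) {k : ℕ} (hk : k ≤ (q j).totient / 2) :
    unitTheta ((m / q j * k : ℕ) : ZMod m) - k • thetaBase m q j ∈ alphaSpan m q := by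
  induction k with
  | zero => simp [unitTheta_zero]
  | succ k ih =>
    have hlt := two_mul_half_totient_lt (hq2 j)
    have ih := ih (by omega)
    by_cases hk0 : k = 0
    · simp [hk0, thetaBase]
    · have h1 := galRing_alpha_of_ne (m := m) (J'_mul hcop hprod (j := j) (k := k + 1) (by omega)
        (by omega)) (by
          intro h
          have h2 : m / q j * (k + 1) = m / q j * 1 := by rw [mul_one]; exact_mod_cast h
          have h3 := Nat.eq_of_mul_eq_mul_left (modulus_div_pos hprod j) h2
          omega)
      have h2 := alpha_mem_alphaSpan (mul_mem_M' (m := m) (by omega) hk)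
      have hx : ((m / q j * (k + 1) : ℕ) : ZMod m) ≠ 0 := by
        have := intCast_ne_zero_of_lt (m := m) (b := (m / q j * (k + 1) : ℕ))
          (by exact_mod_cast Nat.mul_pos (modulus_div_pos hprod j) (Nat.succ_pos k))
          (by exact_mod_cast mul_lt_modulus hprod (by omega))
        rwa [Int.cast_natCast] at this
      have h3 := unitTheta_add_neg hx
      rw [h1, Int.cast_natCast] at h2
      have h4 : ((m / q j * (k + 1) : ℕ) : ZMod m) - ((m / q j : ℕ) : ZMod m)
          = ((m / q j * k : ℕ) : ZMod m) := by
        rw [mul_add, mul_one, Nat.cast_add]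
        ring
      rw [h4] at h2
      convert sub_mem ih h2 using 1
      rw [thetaBase, add_smul, one_smul, ← h3]
      ring

/-- This uses `p_j ≥ 3`. It brings `m/p_j = (m/q_j)(q_j/p_j)` into the range of `unitTheta_sub_mem`.
-/
lemma modulus_nsmul_mem_aux (hq : ∀ i, IsPrimePow (q i)) (j : ι) (h : ¬ 2 ∣ q j) :
    q j / (q j).minFac ≤ (q j).totient / 2 := by
  have h1 : (q j).minFac ≠ 2 := fun h2 => h (h2 ▸ Nat.minFac_dvd _)
  have h2 := (exists_eq_pow (hq j)).1.two_le
  have h3 : q j / (q j).minFac * (q j).minFac = q j := Nat.div_mul_cancel (Nat.minFac_dvd _)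
  have hq2 : 2 < q j := by
    have := Nat.minFac_le (NeZero.pos (q j))
    omega
  have h4 := exists_totient_eq (hq j) hq2
  generalize q j / (q j).minFac = r at *
  generalize (q j).totient / 2 = f at *
  have h5 : r * 3 ≤ r * (q j).minFac := Nat.mul_le_mul_left _ (by omega)
  omega

-- For `p_j = 2` the class `m/2` is its own negative, so `θ(m/2) = N/2`. Then `α(m/q_j)` reduces to
-- `φ(q_j) θ(m/q_j) - N/2`, with `φ(q_j) = q_j/2`.
include hcop hprod in
lemma half_nsmul_thetaBase_add_mem (hq : ∀ i, IsPrimePow (q i)) (hq2 : ∀ i, 2 < q i) (j : ι)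
    (h : 2 ∣ q j) : (q j / 2) • thetaBase m q j + halfUnitNorm m ∈ alphaSpan m q := by
  have hmin : (q j).minFac = 2 := (Nat.minFac_eq_two_iff _).2 h
  have h1 := galRing_alpha_base (m := m) (j := j) (by
    simpa using J'_mul hcop hprod (j := j) (k := 1) one_pos (by linarith [hq2 j]))
  have h2 := alpha_mem_alphaSpan (modulus_div_mem_M' (m := m) (hq2 j))
  have h3 := unitTheta_sub_mem hcop hprod hq2 j le_rfl
  have h4 : unitTheta ((m / (q j).minFac : ℕ) : ZMod m) = halfUnitNorm m := by
    have hm : m / 2 * 2 = m := Nat.div_mul_cancel (h.trans (dvd_modulus hprod j))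
    have hx : ((m / 2 : ℕ) : ZMod m) ≠ 0 := by
      rw [Ne, ZMod.natCast_eq_zero_iff]
      have := NeZero.pos m
      exact Nat.not_dvd_of_pos_of_lt (by omega) (by omega)
    have h5 : -((m / 2 : ℕ) : ZMod m) = ((m / 2 : ℕ) : ZMod m) := by
      have := congrArg (Nat.cast : ℕ → ZMod m) hm
      rw [ZMod.natCast_self] at this
      push_cast at this
      linear_combination -this
    have h6 := unitTheta_add_neg hx
    rw [h5, ← two_smul ℚ] at h6
    rw [hmin, halfUnitNorm, ← h6, smul_smul]
    norm_num
  have h5 : 2 * ((q j).totient / 2) = q j / 2 := by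
    have := exists_totient_eq (hq j) (hq2 j)
    rw [hmin] at this
    omega
  rw [h1, h4] at h2
  convert add_mem (sub_mem h2 (nsmul_mem h3 2)) (unitNorm_mem_alphaSpan (m := m) (q := q)) using 1
  rw [← h5, mul_smul, smul_sub]
  abel

-- For odd `q_j`, `α(m/q_j)` reduces to `(φ(q_j) + q_j/p_j) θ(m/q_j) - N`, and the coefficient is
-- `q_j`. For even `q_j` the previous relation is doubled.
include hcop hprod in
lemma nsmul_thetaBase_mem (hq : ∀ i, IsPrimePow (q i)) (hq2 : ∀ i, 2 < q i) (j : ι) :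
    q j • thetaBase m q j ∈ alphaSpan m q := by
  by_cases h : 2 ∣ q j
  · have h1 := half_nsmul_thetaBase_add_mem hcop hprod hq hq2 j h
    convert sub_mem (add_mem h1 h1) (unitNorm_mem_alphaSpan (m := m) (q := q)) using 1
    rw [← two_smul_halfUnitNorm]
    conv_lhs => rw [← Nat.div_mul_cancel h, mul_smul, two_smul, smul_add]
    abel
  · have h1 := galRing_alpha_base (m := m) (j := j) (by
      simpa using J'_mul hcop hprod (j := j) (k := 1) one_pos (by linarith [hq2 j]))
    have h2 := alpha_mem_alphaSpan (modulus_div_mem_M' (m := m) (hq2 j))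
    have h3 := unitTheta_sub_mem hcop hprod hq2 j le_rfl
    have h4 := unitTheta_sub_mem hcop hprod hq2 j (modulus_nsmul_mem_aux hq j h)
    rw [← modulus_div_minFac hprod] at h4
    rw [h1] at h2
    convert add_mem (sub_mem (sub_mem h2 (nsmul_mem h3 2)) h4)
      (unitNorm_mem_alphaSpan (m := m) (q := q)) using 1
    conv_lhs => rw [← exists_totient_eq (hq j) (hq2 j), add_smul, mul_smul]
    rw [smul_sub]
    abel

lemma psi_mem_of_unitTheta_mem {x : ZMod m} (h : unitTheta x ∈ extSpan m q) :
    psi x ∈ extSpan m q := by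
  by_cases hx : x = 0
  · rw [hx, psi_zero]
    exact zero_mem _
  · rw [← add_sub_cancel_right (psi x) (halfUnitNorm m), ← unitTheta_eq hx]
    exact sub_mem h halfUnitNorm_mem_extSpan

/-- The elements `psi` at the vectors with only one nonzero coordinate. -/
def psiSingle (j : ι) (c : ZMod (q j)) : UnitRing m :=
  psiVec hcop hprod (Pi.single j (baseVec q {j} j * c))

lemma psiSingle_natCast (j : ι) (k : ℕ) :
    psiSingle hcop hprod j k = psi ((m / q j * k : ℕ) : ZMod m) := by
  rw [psiSingle, psiVec]
  congr 1
  have h := (intCast_eq_iff hcop hprod ((m / q j * k : ℕ) : ℤ)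
    (Pi.single j (baseVec q {j} j * (k : ZMod (q j))))).2 fun i => ?_
  · rw [Int.cast_natCast] at h
    exact h.symm
  · rw [Int.cast_natCast, Nat.cast_mul, natCast_modulus_div hprod]
    by_cases hi : i = j
    · subst hi
      rw [Pi.single_eq_same]
    · rw [Pi.single_eq_of_ne hi, baseVec_of_notMem (by simpa using hi), zero_mul]

lemma psiSingle_neg (j : ι) (c : ZMod (q j)) :
    psiSingle hcop hprod j (-c) = -psiSingle hcop hprod j c := by
  rw [psiSingle, psiSingle, mul_neg, Pi.single_neg, psiVec, psiVec, map_neg, psi_neg]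

lemma sum_psiSingle (j : ι) {N : ℕ} (hN : N ∣ q j) (c : ZMod (q j)) :
    ∑ x with (N : ZMod (q j)) * x = N * c, psiSingle hcop hprod j x
      = psiSingle hcop hprod j (N * c) := by
  have hu := isUnit_baseVec hcop (Finset.mem_singleton_self j)
  have h := sum_psiVec_update hcop hprod hN (Pi.single j (baseVec q {j} j * c))
  rw [Pi.single_eq_same] at h
  have h2 : (N : ∀ i, ZMod (q i)) * Pi.single j (baseVec q {j} j * c)
      = Pi.single j (baseVec q {j} j * (N * c)) := by
    ext i
    by_cases hi : i = j
    · subst hi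
      simp only [Pi.mul_apply, Pi.natCast_apply, Pi.single_eq_same]
      ring
    · simp [hi]
  rw [h2] at h
  rw [psiSingle, ← h]
  refine Finset.sum_bij (fun x _ => baseVec q {j} j * x) ?_ ?_ ?_ ?_
  · intro x hx
    rw [Finset.mem_filter] at hx ⊢
    exact ⟨Finset.mem_univ _, by linear_combination baseVec q {j} j * hx.2⟩
  · intro x _ y _ hxy
    exact hu.mul_right_inj.1 hxy
  · intro y hy
    rw [Finset.mem_filter] at hy
    obtain ⟨u, hu'⟩ := hu
    refine ⟨(u⁻¹ : (ZMod (q j))ˣ) * y, ?_, ?_⟩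
    · rw [Finset.mem_filter]
      refine ⟨Finset.mem_univ _, ?_⟩
      rw [← hu'] at hy
      have := u.inv_mul
      linear_combination ((u⁻¹ : (ZMod (q j))ˣ) : ZMod (q j)) * hy.2 + N * c * this
    · rw [← hu', Units.mul_inv_cancel_left]
  · intro x _
    rw [psiSingle]
    congr 1
    ext i
    by_cases hi : i = j
    · subst hi
      simp
    · simp [hi]

include hcop hprod in
lemma psiSingle_mem_of_val_le (hq2 : ∀ i, 2 < q i) {j : ι} {c : ZMod (q j)}
    (hc : c.val ≤ (q j).totient / 2) : psiSingle hcop hprod j c ∈ extSpan m q := by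
  rw [← ZMod.natCast_zmod_val c, psiSingle_natCast]
  refine psi_mem_of_unitTheta_mem ?_
  rw [← sub_add_cancel (unitTheta _) (c.val • thetaBase m q j)]
  exact add_mem (alphaSpan_le_extSpan (unitTheta_sub_mem hcop hprod hq2 j hc))
    (nsmul_mem (thetaBase_mem_extSpan j) _)

lemma psiSingle_mem_of_le_val (hq2 : ∀ i, 2 < q i) {j : ι} {c : ZMod (q j)}
    (hc : q j ≤ c.val + (q j).totient / 2) : psiSingle hcop hprod j c ∈ extSpan m q := by
  rw [← neg_neg c, psiSingle_neg]
  refine neg_mem (psiSingle_mem_of_val_le hcop hprod hq2 ?_)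
  rw [ZMod.neg_val]
  split_ifs
  · exact Nat.zero_le _
  · omega

/-- Residues at most `φ(q_j)/2` in absolute value are already covered. The gap between the two
ranges holds `q_j/p_j - 1` residues, whereas members of a fibre of multiplication by `p_j` differ by
multiples of `q_j/p_j`. So at most one member lies in the gap, and the distribution relation solves
for it. -/
lemma psiSingle_mem_of_mul_mem (hq : ∀ i, IsPrimePow (q i)) (hq2 : ∀ i, 2 < q i) {j : ι}
    {c : ZMod (q j)}
    (hc : psiSingle hcop hprod j ((q j).minFac * c : ZMod (q j)) ∈ extSpan m q) :
    psiSingle hcop hprod j c ∈ extSpan m q := by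
  by_cases h1 : c.val ≤ (q j).totient / 2
  · exact psiSingle_mem_of_val_le hcop hprod hq2 h1
  by_cases h2 : q j ≤ c.val + (q j).totient / 2
  · exact psiSingle_mem_of_le_val hcop hprod hq2 h2
  have hsum := sum_psiSingle hcop hprod j (Nat.minFac_dvd (q j)) c
  have hmem : c ∈ Finset.univ.filter
      fun x : ZMod (q j) => ((q j).minFac : ZMod (q j)) * x = (q j).minFac * c :=
    Finset.mem_filter.2 ⟨Finset.mem_univ c, rfl⟩
  rw [← Finset.add_sum_erase _ _ hmem] at hsum
  rw [eq_sub_of_add_eq hsum]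
  refine sub_mem hc (sum_mem fun x hx => ?_)
  rw [Finset.mem_erase, Finset.mem_filter] at hx
  by_cases h3 : x.val ≤ (q j).totient / 2
  · exact psiSingle_mem_of_val_le hcop hprod hq2 h3
  by_cases h4 : q j ≤ x.val + (q j).totient / 2
  · exact psiSingle_mem_of_le_val hcop hprod hq2 h4
  exfalso
  have h5 := exists_totient_eq (hq j) (hq2 j)
  have h6 : q j / (q j).minFac * (q j).minFac = q j := Nat.div_mul_cancel (Nat.minFac_dvd _)
  have h7 : (((q j).minFac * x.val : ℕ) : ZMod (q j)) = ((q j).minFac * c.val : ℕ) := by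
    push_cast
    rw [ZMod.natCast_zmod_val, ZMod.natCast_zmod_val]
    exact hx.2.2
  have h8 : (q j).minFac * x.val ≡ (q j).minFac * c.val [MOD q j / (q j).minFac * (q j).minFac] := by
    rw [h6]
    exact (ZMod.natCast_eq_natCast_iff _ _ _).1 h7
  rw [mul_comm (q j / _)] at h8
  have h9 := Nat.ModEq.mul_left_cancel' (Nat.minFac_pos (q j)).ne' h8
  have hne : x.val ≠ c.val := fun h => hx.1 (ZMod.val_injective _ h)
  generalize q j / (q j).minFac = r at *
  generalize (q j).totient / 2 = f at *
  rcases lt_or_gt_of_ne hne with h | h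
  · have := (Nat.modEq_iff_dvd' h.le).1 h9
    have := Nat.le_of_dvd (by omega) this
    omega
  · have := (Nat.modEq_iff_dvd' h.le).1 h9.symm
    have := Nat.le_of_dvd (by omega) this
    omega

/-- Repeated multiplication by `p_j` ends at zero, since `q_j` is a power of `p_j`. -/
lemma psiSingle_mem (hq : ∀ i, IsPrimePow (q i)) (hq2 : ∀ i, 2 < q i) (j : ι) (c : ZMod (q j)) :
    psiSingle hcop hprod j c ∈ extSpan m q := by
  have key (k : ℕ) : ∀ c : ZMod (q j), psiSingle hcop hprod j (((q j).minFac ^ k : ℕ) * c : ZMod (q j))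
      ∈ extSpan m q → psiSingle hcop hprod j c ∈ extSpan m q := by
    induction k with
    | zero => exact fun c hc => by simpa using hc
    | succ k ih =>
      intro c hc
      refine psiSingle_mem_of_mul_mem hcop hprod hq hq2 (ih _ ?_)
      rwa [← mul_assoc, ← Nat.cast_mul, ← pow_succ]
  obtain ⟨-, e, -, he⟩ := exists_eq_pow (hq j)
  refine key e c ?_
  rw [← he, ZMod.natCast_self, zero_mul]
  exact psiSingle_mem_of_val_le hcop hprod hq2 (by simp)

include hcop in
lemma exists_eq_mul_baseVec {K : Finset ι} {a : ∀ i, ZMod (q i)} (h1 : ∀ i ∈ K, IsUnit (a i))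
    (h0 : ∀ i ∉ K, a i = 0) :
    ∃ h : ∀ i, (ZMod (q i))ˣ, a = fun i => h i * baseVec q K i := by
  have (i : ι) : ∃ h : (ZMod (q i))ˣ, a i = h * baseVec q K i := by
    by_cases hi : i ∈ K
    · refine ⟨(h1 i hi).unit * (isUnit_baseVec hcop hi).unit⁻¹, ?_⟩
      rw [Units.val_mul, mul_assoc, IsUnit.val_inv_mul, mul_one]
      rfl
    · exact ⟨1, by rw [h0 i hi, baseVec_of_notMem hi, mul_zero]⟩
  choose h hh using this
  exact ⟨h, funext hh⟩

lemma psi_mem_of_lower {Y : Submodule ℤ (UnitRing m)} {J K : Finset ι} (hK : K ⊂ J)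
    (hlow : ∀ K ⊂ J, ∀ h : ∀ i, (ZMod (q i))ˣ,
      psiVec hcop hprod (fun i => h i * baseVec q K i) ∈ Y) {c : ℤ}
    (h1 : ∀ i ∈ K, IsUnit (c : ZMod (q i))) (h0 : ∀ i ∉ K, (c : ZMod (q i)) = 0) :
    psi (c : ZMod m) ∈ Y := by
  obtain ⟨h, hh⟩ := exists_eq_mul_baseVec hcop (a := fun i => (c : ZMod (q i))) h1 h0
  have := hlow K hK h
  rw [← hh, psiVec] at this
  rwa [(intCast_eq_iff hcop hprod c _).2 fun i => rfl]

/-- For `|J| > 1` the class lies in `M'`, and `α` writes its `psi` in terms of the levels `J \ {j}`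
and `{j}`, both proper subsets of `J`. Level one is `psiSingle_mem`. -/
lemma psiVec_mem_extSpan_of_isBasic (hq : ∀ i, IsPrimePow (q i)) (hq2 : ∀ i, 2 < q i)
    (J : Finset ι) (g : ∀ i, (ZMod (q i))ˣ) (hg : IsBasic (-1) (firstHalf q) J g)
    (hlow : ∀ K ⊂ J, ∀ h : ∀ i, (ZMod (q i))ˣ,
      psiVec hcop hprod (fun i => h i * baseVec q K i) ∈ extSpan m q) :
    psiVec hcop hprod (fun i => g i * baseVec q J i) ∈ extSpan m q := by
  have hne : J.Nonempty := by
    rcases hg.2 with ⟨k, hk, -⟩ | h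
    · exact ⟨k, hk⟩
    · exact Finset.card_pos.1 h.2.pos
  by_cases hcard : 1 < J.card
  · rw [← psi_decode]
    set x := decode hcop hprod J g with hx
    set b : ℤ := ((x.val : ℕ) : ℤ) with hb
    have hbx : (b : ZMod m) = x := by rw [hb, Int.cast_natCast, ZMod.natCast_zmod_val]
    have hbi : ∀ i, (b : ZMod (q i)) = g i * baseVec q J i :=
      (intCast_eq_iff hcop hprod _ _).1 hbx
    have hJ : J' q b = J := eq_J'_of_eq_decode hcop hq2 hbi
    have hunit (i : ι) (hi : i ∈ J) : IsUnit (b : ZMod (q i)) := by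
      rw [hbi]
      exact (g i).isUnit.mul (isUnit_baseVec hcop hi)
    have hzero (i : ι) (hi : i ∉ J) : (b : ZMod (q i)) = 0 := by
      rw [hbi, baseVec_of_notMem hi, mul_zero]
    have hnz (i : ι) (hi : i ∈ J) : (b : ZMod (q i)) ≠ 0 := mem_J'_iff.1 (hJ.symm ▸ hi)
    have hb0 : (b : ZMod m) ≠ 0 := by
      obtain ⟨i, hi⟩ := hne
      exact fun h => hnz i hi ((intCast_eq_zero_iff_forall hcop hprod b).1 h i)
    have hpos : 0 < b := by
      rcases (hb ▸ Int.natCast_nonneg _ : 0 ≤ b).eq_or_lt with h | h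
      · exact absurd (by rw [← h, Int.cast_zero]) hb0
      · exact h
    have hlt : b < m := hb ▸ Int.ofNat_lt.2 (ZMod.val_lt x)
    have hM : b ∈ M m q := (mem_M_iff hcop hprod hq2 hpos hlt hbi).2 hg
    have hM' : b ∈ M' m q := by
      refine Or.inl ⟨hM, fun i hi => ?_⟩
      have h1 : J ⊆ {i} := by
        intro l hl
        by_contra hli
        refine hnz l hl ?_
        rw [ZMod.intCast_zmod_eq_zero_iff_dvd]
        refine (Int.natCast_dvd_natCast.2 ?_).trans hi
        rw [← prod_compl_singleton hprod]
        exact Finset.dvd_prod_of_mem q (by simpa using hli)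
      have := Finset.card_le_card h1
      rw [Finset.card_singleton] at this
      omega
    obtain ⟨c, d, j, hj, hα, hsum, hc, hcj⟩ := exists_alpha_eq hcop hprod (b := b) (by rwa [hJ])
    rw [hJ] at hj
    have hd (i : ι) : (b : ZMod (q i)) + c + d = 0 := by
      have := (intCast_eq_zero_iff_forall hcop hprod (b + c + d)).1 (by push_cast; exact hsum) i
      push_cast at this
      exact this
    have hdj : (d : ZMod (q j)) = -b := by linear_combination hd j - hcj
    have hdi (i : ι) (hi : i ≠ j) : (d : ZMod (q i)) = 0 := by
      linear_combination hd i - hc i hi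
    have hc0 : (c : ZMod m) ≠ 0 := by
      obtain ⟨i, hi, hij⟩ := Finset.exists_mem_ne hcard j
      intro h
      have := (intCast_eq_zero_iff_forall hcop hprod c).1 h i
      rw [hc i hij, neg_eq_zero] at this
      exact hnz i hi this
    have hd0 : (d : ZMod m) ≠ 0 := by
      intro h
      have := (intCast_eq_zero_iff_forall hcop hprod d).1 h j
      rw [hdj, neg_eq_zero] at this
      exact hnz j hj this
    have hcmem : psi (c : ZMod m) ∈ extSpan m q := by
      refine psi_mem_of_lower hcop hprod (Finset.erase_ssubset hj) hlow (fun i hi => ?_)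
        fun i hi => ?_
      · rw [hc i (Finset.ne_of_mem_erase hi)]
        exact (hunit i (Finset.mem_of_mem_erase hi)).neg
      · by_cases hij : i = j
        · rw [hij, hcj]
        · rw [hc i hij, hzero i fun h => hi (Finset.mem_erase.2 ⟨hij, h⟩), neg_zero]
    have hdmem : psi (d : ZMod m) ∈ extSpan m q := by
      refine psi_mem_of_lower hcop hprod (K := {j}) ?_ hlow (fun i hi => ?_) fun i hi => ?_
      · refine Finset.ssubset_iff_subset_ne.2 ⟨by simpa using hj, fun h => ?_⟩
        rw [← h, Finset.card_singleton] at hcard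
        exact lt_irrefl _ hcard
      · rw [Finset.mem_singleton] at hi
        subst hi
        rw [hdj]
        exact (hunit i hj).neg
      · exact hdi i (by simpa using hi)
    have hα' := alphaSpan_le_extSpan (alpha_mem_alphaSpan hM')
    rw [hα, unitTheta_eq hb0, unitTheta_eq hc0, unitTheta_eq hd0, ← two_smul_halfUnitNorm] at hα'
    rw [← hbx]
    -- The three halves of `N` from the `θ`, minus `N`, leave one `N/2`.
    convert sub_mem (sub_mem (sub_mem hα' hcmem) hdmem) (halfUnitNorm_mem_extSpan (q := q)) using 1
    ring
  · obtain ⟨j, rfl⟩ := Finset.card_eq_one.1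
      (le_antisymm (not_lt.1 hcard) (Finset.card_pos.2 hne))
    convert psiSingle_mem hcop hprod hq hq2 j (g j) using 1
    rw [psiSingle]
    congr 1
    ext i
    by_cases hi : i = j
    · subst hi
      rw [Pi.single_eq_same, mul_comm]
    · rw [Pi.single_eq_of_ne hi, baseVec_of_notMem (by simpa using hi), mul_zero]

include hcop hprod in
theorem psi_mem_extSpan (hq : ∀ i, IsPrimePow (q i)) (hq2 : ∀ i, 2 < q i) (x : ZMod m) :
    psi x ∈ extSpan m q :=
  psi_mem_of_isBasic hcop hprod hq hq2 (psiVec_mem_extSpan_of_isBasic hcop hprod hq hq2) x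

include hcop hprod in
lemma unitSprime_le_extSpan (hq : ∀ i, IsPrimePow (q i)) (hq2 : ∀ i, 2 < q i) :
    unitSprime m ≤ extSpan m q := by
  rw [unitSprime, Submodule.span_le]
  rintro x (⟨x, rfl⟩ | rfl)
  · by_cases hx : x = 0
    · rw [hx, unitTheta_zero]
      exact zero_mem _
    · rw [unitTheta_eq hx]
      exact add_mem (psi_mem_extSpan hcop hprod hq hq2 x) halfUnitNorm_mem_extSpan
  · exact halfUnitNorm_mem_extSpan

end Generators

end

/-! ### Removal of the extra generators by integrality, and the basis. -/

section

section Integrality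

variable {ι : Type} [Fintype ι] [LinearOrder ι] {m : ℕ} [NeZero m] {q : ι → ℕ}
  [∀ i, NeZero (q i)]
  (hcop : Pairwise fun i j => (q i).Coprime (q j)) (hprod : m = ∏ i, q i)

lemma coeff_zsmul (c : ℤ) (x : UnitRing m) (u : (ZMod m)ˣ) :
    (c • x).coeff u = c * x.coeff u := by
  rw [← Int.cast_smul_eq_zsmul ℚ, MonoidAlgebra.coeff_smul, Finsupp.smul_apply, smul_eq_mul]

lemma exists_eq_of_mem_extSpan {s : UnitRing m} (hs : s ∈ extSpan m q) :
    ∃ a ∈ alphaSpan m q, ∃ (n : ℤ) (k : ι → ℤ),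
      s = a + n • halfUnitNorm m + ∑ j, k j • thetaBase m q j := by
  obtain ⟨b, hb, c, hc, rfl⟩ := Submodule.mem_sup.1 hs
  obtain ⟨a, ha, d, hd, rfl⟩ := Submodule.mem_sup.1 hb
  obtain ⟨n, rfl⟩ := Submodule.mem_span_singleton.1 hd
  obtain ⟨k, rfl⟩ := (Submodule.mem_span_range_iff_exists_fun ℤ).1 hc
  exact ⟨a, ha, n, k, rfl⟩

include hprod in
lemma coeff_one_thetaBase (hq2 : ∀ i, 2 < q i) (j : ι) :
    (thetaBase m q j).coeff 1 = 1 - ((m / q j : ℕ) : ℚ) / m := by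
  have hlt : m / q j < m := Nat.div_lt_self (NeZero.pos m) (by linarith [hq2 j])
  have h0 : ((m / q j : ℕ) : ZMod m) ≠ 0 := by
    rw [Ne, ZMod.natCast_eq_zero_iff]
    exact Nat.not_dvd_of_pos_of_lt (modulus_div_pos hprod j) hlt
  rw [thetaBase, coeff_unitTheta, inv_one, Units.val_one, mul_one, frac_neg h0, frac,
    ZMod.val_natCast_of_lt hlt]

include hcop hprod in
lemma exists_coeff_eq_of_mem_alphaSpan (hq : ∀ i, IsPrimePow (q i)) (hq2 : ∀ i, 2 < q i)
    {a : UnitRing m} (ha : a ∈ alphaSpan m q) (u : (ZMod m)ˣ) : ∃ n : ℤ, a.coeff u = n := by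
  induction ha using Submodule.span_induction with
  | mem x hx =>
    rcases hx with ⟨b, hb, rfl⟩ | rfl
    · obtain ⟨h0, hlt⟩ := pos_and_lt_of_mem_M' hcop hprod hq2 hb
      exact mem_integralGroupRing_iff.1
        (isShort_alpha hcop hprod hq hq2 h0 hlt).mem_integralGroupRing u
    · exact ⟨1, by rw [coeff_unitNorm, Int.cast_one]⟩
  | zero => exact ⟨0, by simp⟩
  | add x y _ _ hx hy =>
    obtain ⟨a, ha⟩ := hx
    obtain ⟨b, hb⟩ := hy
    exact ⟨a + b, by simp [ha, hb]⟩
  | smul c x _ hx =>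
    obtain ⟨a, ha⟩ := hx
    exact ⟨c * a, by rw [coeff_zsmul, ha, Int.cast_mul]⟩

-- Modulo `q i` both `m` and the `m / q j` with `j ≠ i` vanish, while `m / q i` is a unit.
include hcop hprod in
lemma dvd_two_mul_of_eq {n z : ℤ} {k : ι → ℤ}
    (h : m * n - 2 * ∑ j, k j * ((m / q j : ℕ) : ℤ) = 2 * m * z) (i : ι) :
    (q i : ℤ) ∣ 2 * k i := by
  have h1 := congrArg (Int.cast : ℤ → ZMod (q i)) h
  have h2 : (m : ZMod (q i)) = 0 := (ZMod.natCast_eq_zero_iff _ _).2 (dvd_modulus hprod i)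
  rw [Int.cast_sub, Int.cast_mul, Int.cast_mul, Int.cast_mul, Int.cast_mul, Int.cast_natCast, h2,
    Int.cast_sum, Finset.sum_eq_single i] at h1
  · rw [Int.cast_mul (k i), Int.cast_natCast, natCast_modulus_div hprod] at h1
    rw [← ZMod.intCast_zmod_eq_zero_iff_dvd, Int.cast_mul,
      ← (isUnit_baseVec hcop (Finset.mem_singleton_self i)).mul_left_eq_zero]
    linear_combination -h1
  · intro j _ hj
    rw [Int.cast_mul, Int.cast_natCast, natCast_modulus_div hprod,
      baseVec_of_notMem (by simpa using hj.symm), mul_zero]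
  · exact fun h => absurd (Finset.mem_univ i) h

-- For even `q j` this is a multiple of `half_nsmul_thetaBase_add_mem`. For odd `q j` the integer
-- `n` is even, and `q_j θ(m/q_j)` and `N` lie in `alphaSpan` separately.
include hcop hprod in
lemma smul_thetaBase_add_mem (hq : ∀ i, IsPrimePow (q i)) (hq2 : ∀ i, 2 < q i) {j : ι} {k n : ℤ}
    (h : 2 * k = q j * n) : k • thetaBase m q j + n • halfUnitNorm m ∈ alphaSpan m q := by
  by_cases h2 : 2 ∣ q j
  · have h3 : k = n * (q j / 2 : ℕ) := by
      obtain ⟨r, hr⟩ := h2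
      rw [hr, Nat.mul_div_cancel_left r two_pos]
      rw [hr] at h
      push_cast at h
      linarith
    convert zsmul_mem (half_nsmul_thetaBase_add_mem hcop hprod hq hq2 j h2) n using 1
    rw [smul_add, h3, mul_smul, natCast_zsmul]
  · have h3 : Even (q j * n) := ⟨k, by omega⟩
    obtain ⟨c, rfl⟩ := (Int.even_mul.1 h3).resolve_left fun h4 =>
      h2 (even_iff_two_dvd.1 ((Int.even_coe_nat _).1 h4))
    have h4 : k = c * q j := by linarith
    convert add_mem (zsmul_mem (nsmul_thetaBase_mem hcop hprod hq hq2 j) c)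
      (zsmul_mem (unitNorm_mem_alphaSpan (m := m) (q := q)) c) using 1
    rw [h4, mul_smul, natCast_zsmul, add_smul, ← smul_add, two_smul_halfUnitNorm]

-- The coefficient at the identity alone decides. If `s` exceeds an element of `alphaSpan` by `n N/2
-- + ∑ k_j θ(m/q_j)`, its integrality forces `2 k_j = q_j c_j` and `n ≡ ∑ c_j` modulo `2`. The
-- excess then regroups into the elements `k_j θ(m/q_j) + c_j N/2` of `alphaSpan` and a multiple of
-- `N`.
include hcop hprod in
theorem mem_alphaSpan_of_mem_extSpan (hq : ∀ i, IsPrimePow (q i)) (hq2 : ∀ i, 2 < q i)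
    {s : UnitRing m} (hs : s ∈ extSpan m q) (hint : ∃ z : ℤ, s.coeff 1 = z) :
    s ∈ alphaSpan m q := by
  obtain ⟨a, ha, n, k, rfl⟩ := exists_eq_of_mem_extSpan hs
  obtain ⟨z, hz⟩ := hint
  obtain ⟨y, hy⟩ := exists_coeff_eq_of_mem_alphaSpan hcop hprod hq hq2 ha 1
  have hm := cast_modulus_ne_zero (m := m)
  have h1 : (y : ℚ) + n * (1 / 2) + ∑ j, k j * (1 - ((m / q j : ℕ) : ℚ) / m) = z := by
    rw [← hz, MonoidAlgebra.coeff_add, Finsupp.add_apply, MonoidAlgebra.coeff_add,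
      Finsupp.add_apply, MonoidAlgebra.coeff_sum, Finsupp.finsetSum_apply, hy]
    simp only [coeff_zsmul, coeff_halfUnitNorm, coeff_one_thetaBase hprod hq2]
  have h2 : m * n - 2 * ∑ j, k j * ((m / q j : ℕ) : ℤ) = 2 * m * (z - y - ∑ j, k j) := by
    have h3 : ∑ j, (k j : ℚ) * (1 - ((m / q j : ℕ) : ℚ) / m)
        = ∑ j, (k j : ℚ) - (∑ j, (k j : ℚ) * ((m / q j : ℕ) : ℚ)) / m := by
      rw [Finset.sum_div, ← Finset.sum_sub_distrib]
      exact Finset.sum_congr rfl fun j _ => by ring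
    rw [h3] at h1
    have h4 : (m : ℚ) * n - 2 * ∑ j, (k j : ℚ) * ((m / q j : ℕ) : ℚ)
        = 2 * m * (z - y - ∑ j, (k j : ℚ)) := by
      rw [← h1]
      field_simp
      ring
    have h5 : ((m * n - 2 * ∑ j, k j * ((m / q j : ℕ) : ℤ) : ℤ) : ℚ)
        = (2 * m * (z - y - ∑ j, k j) : ℤ) := by
      simp only [Int.cast_sub, Int.cast_mul, Int.cast_sum, Int.cast_natCast, Int.cast_ofNat]
      exact h4
    exact_mod_cast h5
  choose c hc using dvd_two_mul_of_eq hcop hprod h2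
  have h6 : n - ∑ j, c j = 2 * (z - y - ∑ j, k j) := by
    have h7 : 2 * ∑ j, k j * ((m / q j : ℕ) : ℤ) = m * ∑ j, c j := by
      rw [Finset.mul_sum, Finset.mul_sum]
      refine Finset.sum_congr rfl fun j _ => ?_
      have h8 : ((q j : ℕ) : ℤ) * ((m / q j : ℕ) : ℤ) = m := by
        rw [← Nat.cast_mul, Nat.mul_div_cancel' (dvd_modulus hprod j)]
      rw [← mul_assoc, hc j, ← h8]
      ring
    rw [h7] at h2
    refine mul_left_cancel₀ (a := (m : ℤ)) (by exact_mod_cast NeZero.ne m) ?_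
    linear_combination h2
  have h9 : (∑ j, k j • thetaBase m q j) + n • halfUnitNorm m
      = (∑ j, (k j • thetaBase m q j + c j • halfUnitNorm m))
        + (z - y - ∑ j, k j) • unitNorm m := by
    have h10 : n = ∑ j, c j + (z - y - ∑ j, k j) * 2 := by linarith
    rw [Finset.sum_add_distrib, ← Finset.sum_smul, add_assoc, ← two_smul_halfUnitNorm,
      ← two_smul ℤ (halfUnitNorm m), smul_smul, ← add_smul, ← h10]
  rw [add_assoc, add_comm (n • _), h9]
  exact add_mem ha (add_mem (sum_mem fun j _ => smul_thetaBase_add_mem hcop hprod hq hq2 (hc j))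
    (zsmul_mem unitNorm_mem_alphaSpan _))

end Integrality

section Basis

variable {ι : Type} [Fintype ι] [LinearOrder ι] {m : ℕ} [NeZero m] {q : ι → ℕ}
  [∀ i, NeZero (q i)]
  (hcop : Pairwise fun i j => (q i).Coprime (q j)) (hprod : m = ∏ i, q i)

variable (m q) in
/-- The elements `alpha a`, `a ∈ M'`, and the norm element. -/
def shortFamily : Option (M' m q) → UnitRing m
  | some a => galRing m (alpha m q a)
  | none => unitNorm m

lemma span_range_shortFamily : Submodule.span ℤ (Set.range (shortFamily m q)) = alphaSpan m q := by
  rw [alphaSpan]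
  congr 1
  ext x
  constructor
  · rintro ⟨_ | a, rfl⟩
    · exact Or.inr rfl
    · exact Or.inl ⟨a, a.2, rfl⟩
  · rintro (⟨a, ha, rfl⟩ | rfl)
    · exact ⟨some ⟨a, ha⟩, rfl⟩
    · exact ⟨none, rfl⟩

lemma alphaSpan_subset_span : (alphaSpan m q : Set (UnitRing m))
    ⊆ Submodule.span ℚ (Set.range (shortFamily m q)) := by
  rw [← span_range_shortFamily]
  exact Submodule.span_subset_span ℤ ℚ _

-- Over `ℚ` the extra generators are superfluous, since `q_j θ(m/q_j)` lies in `alphaSpan`; this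
-- supplies the spanning hypothesis of `linearIndependent_of_psi_mem`.
include hcop hprod in
lemma extSpan_subset_span (hq : ∀ i, IsPrimePow (q i)) (hq2 : ∀ i, 2 < q i) :
    (extSpan m q : Set (UnitRing m)) ⊆ Submodule.span ℚ (Set.range (shortFamily m q)) := by
  intro s hs
  obtain ⟨a, ha, n, k, rfl⟩ := exists_eq_of_mem_extSpan hs
  refine add_mem (add_mem (alphaSpan_subset_span ha) (zsmul_mem ?_ n))
    (sum_mem fun j _ => zsmul_mem ?_ _)
  · exact Submodule.smul_mem _ _ (alphaSpan_subset_span unitNorm_mem_alphaSpan)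
  · have h := alphaSpan_subset_span (nsmul_thetaBase_mem hcop hprod hq hq2 j)
    have hne : (q j : ℚ) ≠ 0 := by exact_mod_cast NeZero.ne (q j)
    rw [SetLike.mem_coe, ← Nat.cast_smul_eq_nsmul ℚ] at h
    exact (Submodule.smul_mem_iff _ hne).1 h

include hcop hprod in
theorem linearIndependent_shortFamily [Nonempty ι] (hm : 2 < m) (hq : ∀ i, IsPrimePow (q i))
    (hq2 : ∀ i, 2 < q i) : LinearIndependent ℤ (shortFamily m q) := by
  obtain ⟨hfin, hcard⟩ := finite_M'_and_ncard_le hcop hprod hq hq2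
  have : Fintype (M' m q) := hfin.fintype
  refine linearIndependent_of_psi_mem hm ?_
    (fun x => extSpan_subset_span hcop hprod hq hq2 (psi_mem_extSpan hcop hprod hq hq2 x))
    (alphaSpan_subset_span unitNorm_mem_alphaSpan)
  rw [Fintype.card_option, ← Nat.card_eq_fintype_card, Nat.card_coe_set_eq]
  omega

variable (m) in
/-- The inclusion of the Stickelberger ideal into the group ring of `(ℤ/m)ˣ`. -/
def stickelbergerIncl : stickelbergerIdeal m →ₗ[ℤ] UnitRing m where
  toFun x := galRing m x
  map_add' x y := by rw [AddSubgroup.coe_add, map_add]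
  map_smul' c x := by rw [AddSubgroup.coe_zsmul, map_zsmul, RingHom.id_apply]

lemma stickelbergerIncl_injective : Function.Injective (stickelbergerIncl m) :=
  fun _ _ h => Subtype.ext ((galRing m).injective h)

include hcop hprod in
theorem exists_basis [Nonempty ι] (hm : 2 < m) (hq : ∀ i, IsPrimePow (q i))
    (hq2 : ∀ i, 2 < q i) :
    ∃ B : Module.Basis (Option (M' m q)) ℤ (stickelbergerIdeal m),
      (∀ a : M' m q, (B (some a) : QG m) = alpha m q a) ∧ (B none : QG m) = normElt m := by
  have hm1 : 1 < m := by omega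
  let w : Option (M' m q) → stickelbergerIdeal m
    | some a => ⟨alpha m q a, alpha_mem_stickelbergerIdeal hcop hprod hm1 hq hq2
        (pos_and_lt_of_mem_M' hcop hprod hq2 a.2).1 (pos_and_lt_of_mem_M' hcop hprod hq2 a.2).2⟩
    | none => ⟨normElt m, normElt_mem_stickelbergerIdeal hm1⟩
  have hw : stickelbergerIncl m ∘ w = shortFamily m q := by
    funext a
    rcases a with _ | a
    · exact galRing_normElt m
    · rfl
  have hli : LinearIndependent ℤ w := by
    refine LinearIndependent.of_comp (stickelbergerIncl m) ?_
    rw [hw]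
    exact linearIndependent_shortFamily hcop hprod hm hq hq2
  have hspan : ⊤ ≤ Submodule.span ℤ (Set.range w) := by
    intro x _
    have hx : stickelbergerIncl m x ∈ alphaSpan m q :=
      mem_alphaSpan_of_mem_extSpan hcop hprod hq hq2
        (unitSprime_le_extSpan hcop hprod hq hq2 (galRing_mem_unitSprime x.2.1))
        (mem_integralGroupRing_iff.1 x.2.2 1)
    rw [← span_range_shortFamily, ← hw, Set.range_comp, Submodule.span_image] at hx
    obtain ⟨y, hy, hxy⟩ := hx
    rwa [← stickelbergerIncl_injective hxy]
  refine ⟨Module.Basis.mk hli hspan, fun a => ?_, ?_⟩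
  · rw [Module.Basis.mk_apply]
  · rw [Module.Basis.mk_apply]

end Basis

/-- If a product of pairwise coprime numbers is not `2` modulo `4`, no factor equals `2`. -/
lemma two_lt_of_not_modEq {ι : Type} [Fintype ι] {m : ℕ} {q : ι → ℕ} (hm4 : ¬ m ≡ 2 [MOD 4])
    (hq : ∀ i, IsPrimePow (q i)) (hcop : Pairwise fun i j => (q i).Coprime (q j))
    (hprod : m = ∏ i, q i) (i : ι) : 2 < q i := by
  classical
  have h1 := (hq i).one_lt
  by_contra h
  have h2 : q i = 2 := by omega
  refine hm4 ?_
  have h3 : Nat.Coprime 2 (∏ j ∈ Finset.univ.erase i, q j) :=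
    Nat.Coprime.prod_right fun j hj => h2 ▸ hcop (Finset.ne_of_mem_erase hj).symm
  rw [hprod, ← Finset.mul_prod_erase _ _ (Finset.mem_univ i), h2]
  rw [Nat.coprime_two_left] at h3
  obtain ⟨r, hr⟩ := h3
  rw [hr, Nat.ModEq]
  omega

end

end ShortStickelberger

end

theorem mainTheorem1 (m : ℕ) [NeZero m] (hm : 1 < m) (hm4 : ¬ m ≡ 2 [MOD 4])
    (t : ℕ) (q : Fin t → ℕ) (hq : ∀ i, IsPrimePow (q i))
    (hcop : Pairwise fun i j => (q i).Coprime (q j)) (hprod : m = ∏ i, q i) :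
    (∃ B : Module.Basis (Option (ShortStickelberger.M' m q)) ℤ
        (ShortStickelberger.stickelbergerIdeal m),
      (∀ a : ShortStickelberger.M' m q,
        (B (some a) : ShortStickelberger.QG m) = ShortStickelberger.alpha m q a) ∧
      (B none : ShortStickelberger.QG m) = ShortStickelberger.normElt m) ∧
    (∀ a ∈ ShortStickelberger.M' m q,
      ShortStickelberger.IsShort (ShortStickelberger.alpha m q a)) ∧
    ShortStickelberger.IsShort (ShortStickelberger.normElt m) := by
  have hq2 := ShortStickelberger.two_lt_of_not_modEq hm4 hq hcop hprod
  have : ∀ i, NeZero (q i) := fun i => ⟨(hq i).ne_zero⟩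
  have : Nonempty (Fin t) := by
    by_contra h
    rw [not_nonempty_iff] at h
    rw [Fintype.prod_empty] at hprod
    omega
  have hm2 : 2 < m := by
    obtain ⟨i⟩ := this
    exact (hq2 i).trans_le
      (Nat.le_of_dvd (NeZero.pos m) (ShortStickelberger.dvd_modulus hprod i))
  refine ⟨ShortStickelberger.exists_basis hcop hprod hm2 hq hq2, fun a ha => ?_,
    ShortStickelberger.isShort_normElt⟩
  obtain ⟨h0, hlt⟩ := ShortStickelberger.pos_and_lt_of_mem_M' hcop hprod hq2 ha
  exact ShortStickelberger.isShort_alpha hcop hprod hq hq2 h0 hlt
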